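/- Let $d\ge 1$, let $S^d\subset\mathbb R^{d+1}$ be the unit sphere with its round metric, fix a spin structure on $S^d$ (it is unique for $d\ge 2$; for $d=1$ there are two, and either one is allowed), and let $\mathcal D$ be the Dirac operator acting on the associated complex spinor bundle of rank $2^{\lfloor d/2\rfloor}$, regarded as the closure, in the Hilbert space of square-integrable spinor fields, of the Dirac operator on smooth spinor fields. Let $|\mathcal D|=(\mathcal D^*\mathcal D)^{1/2}$, let $M(\mu)=\dim\ker(|\mathcal D|-\mu)$ for $\mu\ge 0$, and let $h=M(0)=\dim\ker\mathcal D$. (One has $h=0$ except for the trivial spin structure on $S^1$, where $h=1$.) Then $|\mathcal D|$ and the semigroup $e^{-t|\mathcal D|}$ are well defined, and $e^{-t|\mathcal D|}$ is of trace class for every $t>0$. The spectral zeta function $$\zeta_{|\mathcal D|}(s)=\sum_{\mu>0}M(\mu)\,\mu^{-s}$$ converges for $\operatorname{Re}s>d$ and has a meromorphic continuation to $\mathbb C$. The function $\Gamma(s)\,\zeta_{|\mathcal D|}(s)$ has poles only at points $s=d-k$, $k\in\mathbb N=\{0,1,2,\dots\}$, all of them simple, and, with $$a_k=\operatorname*{Res}_{s=d-k}\bigl(\Gamma(s)\,\zeta_{|\mathcal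 D|}(s)\bigr)\in\mathbb R$$ (which is $0$ if $d-k$ is not a pole), the heat trace has the small-$t$ asymptotic expansion $$\operatorname{Tr}e^{-t|\mathcal D|}\ \sim_{t\downarrow 0}\ h+\sum_{k=0}^{\infty}a_k\,t^{k-d},$$ that is, $\operatorname{Tr}e^{-t|\mathcal D|}-h-\sum_{k<N}a_k\,t^{k-d}=O(t^{N-d})$ as $t\downarrow 0$, for every $N\in\mathbb N$. Moreover, this asymptotic expansion converges to the heat trace on $(0,2\pi)$: $$\operatorname{Tr}e^{-t|\mathcal D|}=h+\sum_{k=0}^{\infty}a_k\,t^{k-d}\qquad\text{for all } t\in(0,2\pi),$$ where the series converges unconditionally, locally uniformly on $(0,2\pi)$. -/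

import Mathlib

open Filter Topology MeasureTheory Asymptotics Metric
open scoped Manifold ContDiff RealInnerProductSpace LinearPMap

noncomputable section

namespace SphereDirac

/-! ### The round sphere, its spin structures and its spinor bundle -/

/-- The Euclidean space in which the round `d`-sphere is the unit sphere. -/
abbrev Ambient (d : ℕ) : Type := EuclideanSpace ℝ (Fin (d + 1))

/-- The unit sphere `S^d`; Mathlib equips it with its standard smooth structure. -/
abbrev Sph (d : ℕ) : Type := sphere (0 : Ambient d) 1

/-- The Riemannian volume (surface measure) of the round sphere. -/
abbrev sphVolume (d : ℕ) : Measure (Sph d) := (volume : Measure (Ambient d)).toSphere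

/-- The quadratic form `x ↦ -‖x‖²`, so that `x * x = -‖x‖²` in its Clifford algebra. -/
def negNormSq (d : ℕ) : QuadraticForm ℝ (Ambient d) :=
  -LinearMap.BilinMap.toQuadraticMap (innerₗ (Ambient d))

/-- The spinor space of complex dimension `2 ^ ⌊d / 2⌋`, with its Hermitian inner product. -/
abbrev Spinor (d : ℕ) : Type := EuclideanSpace ℂ (Fin (2 ^ (d / 2)))

/-- A unitary spinor module: a complex representation, on a space of the smallest possible
dimension `2 ^ ⌊d / 2⌋` (so an irreducible one), of the even Clifford algebra of `ℝ^(d+1)`,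
in which unit vectors act unitarily.  Its restriction to `Spin(d+1)` is the
(half-)spin representation.  For a unit vector `x`, the map `X ↦ x * X`, for `X` orthogonal
to `x`, extends to an isomorphism of the Clifford algebra of `T_x S^d` onto this even algebra;
the module thus is the irreducible spinor module of every tangent space of the sphere. -/
structure SpinorModule (d : ℕ) where
  /-- the representation -/
  rep : CliffordAlgebra.even (negNormSq d) →ₐ[ℝ] (Spinor d →L[ℂ] Spinor d)
  adjoint_rep : ∀ X Y : Ambient d,
    ContinuousLinearMap.adjoint (rep ((CliffordAlgebra.even.ι (negNormSq d)).bilin X Y)) =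
      rep ((CliffordAlgebra.even.ι (negNormSq d)).bilin Y X)

/-- The spin structures of `S^d`: the bounding one, `Spin(d+1) → SO(d+1)`, which exists for
every `d` and is the only one if `d ≥ 2`, and on the circle also the trivial one. -/
inductive SpinStructure : ℕ → Type
  | bounding (d : ℕ) : SpinStructure d
  | trivial : SpinStructure 1

variable {d : ℕ}

/-- Clifford multiplication by a tangent vector `X` at `x`, in the spinor bundle
`S^d × Spinor d`: it is the action of `x * X`, whose square is `-‖X‖²` for `X ⊥ x`. -/
def cliffordMul (ρ : SpinorModule d) (x X : Ambient d) : Spinor d →L[ℂ] Spinor d :=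
  ρ.rep ((CliffordAlgebra.even.ι (negNormSq d)).bilin x X)

/-- The extension of a spinor field to the ambient space that is constant along rays. -/
def radialExtension (ψ : Sph d → Spinor d) (y : Ambient d) : Spinor d :=
  if h : y = 0 then 0 else
    ψ ⟨‖y‖⁻¹ • y, by
      simp [norm_smul, inv_mul_cancel₀ (norm_ne_zero_iff.mpr h)]⟩

/-- The componentwise derivative of a spinor field at `x` along a tangent vector `X ⊥ x`. -/
def tangentDeriv (ψ : Sph d → Spinor d) (x : Sph d) (X : Ambient d) : Spinor d :=
  fderiv ℝ (radialExtension ψ) (x : Ambient d) X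

/-- The spin connection `∇_X ψ` at `x`, for `X ⊥ x`.

For the bounding spin structure the spinor bundle is `Spin(d+1) ×_{Spin(d)} Spinor d`, which is
trivialised by `[g, v] ↦ (g · e, ρ(g) v)`.  In this trivialisation, which is that of the spinor
bundle of the ambient space restricted to the hypersurface `S^d`, the lift of the Levi-Civita
connection reads `∂_X - (1/2) x * X`: it is metric and satisfies
`∇_X (Y · ψ) = (∇_X Y) · ψ + Y · ∇_X ψ` with `∇_X Y = ∂_X Y + ⟨X, Y⟩ x`.

For the trivial spin structure of the circle, spinor fields are functions on the circle and
`∇_X = ∂_X`. -/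
def spinConnection : {d : ℕ} → SpinStructure d → SpinorModule d →
    (Sph d → Spinor d) → (x : Sph d) → Ambient d → Spinor d
  | _, .bounding _, ρ, ψ, x, X => tangentDeriv ψ x X - (1 / 2 : ℂ) • cliffordMul ρ x X (ψ x)
  | _, .trivial, _, ψ, x, X => tangentDeriv ψ x X

/-- The Dirac operator `(D ψ)(x) = ∑ j, e_j · ∇_{e_j} ψ` on spinor fields, where `(e_j)` is an
orthonormal basis of the tangent space of the sphere at `x`. -/
def dirac (σ : SpinStructure d) (ρ : SpinorModule d) (ψ : Sph d → Spinor d) (x : Sph d) :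
    Spinor d :=
  ∑ j, cliffordMul ρ x (stdOrthonormalBasis ℝ (ℝ ∙ (x : Ambient d))ᗮ j : Ambient d)
    (spinConnection σ ρ ψ x (stdOrthonormalBasis ℝ (ℝ ∙ (x : Ambient d))ᗮ j : Ambient d))

/-! ### The Dirac operator on square-integrable spinor fields -/

/-- The Hilbert space of square-integrable spinor fields. -/
abbrev L2Spinor (d : ℕ) : Type := Lp (Spinor d) 2 (sphVolume d)

/-- The graph of the Dirac operator on smooth spinor fields.  (The set is a linear subspace, so
that taking the span only serves to bundle it.) -/
def smoothDiracGraph (σ : SpinStructure d) (ρ : SpinorModule d) :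
    Submodule ℂ (L2Spinor d × L2Spinor d) :=
  Submodule.span ℂ {p | ∃ ψ : Sph d → Spinor d,
    ContMDiff (𝓡 d) 𝓘(ℝ, Spinor d) ∞ ψ ∧
      p.1 =ᵐ[sphVolume d] ψ ∧ p.2 =ᵐ[sphVolume d] dirac σ ρ ψ}

/-- The Dirac operator as an unbounded operator on square-integrable spinor fields: the closure
of the Dirac operator on smooth spinor fields. -/
def diracOperator (σ : SpinStructure d) (ρ : SpinorModule d) :
    L2Spinor d →ₗ.[ℂ] L2Spinor d :=
  (smoothDiracGraph σ ρ).topologicalClosure.toLinearPMap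

/-! ### Absolute values, heat semigroups, traces and multiplicities -/

variable {H : Type} [NormedAddCommGroup H] [InnerProductSpace ℂ H] [CompleteSpace H]

/-- `A = |D|`, the non-negative self-adjoint square root of `D† D` (equality of unbounded
operators, domains included). -/
structure IsAbsoluteValue (D A : H →ₗ.[ℂ] H) : Prop where
  isSelfAdjoint : IsSelfAdjoint A
  nonneg : ∀ x : A.domain, 0 ≤ RCLike.re (inner ℂ (A x) (x : H))
  sq_eq : ∀ x z : H, (∃ y, (x, y) ∈ A.graph ∧ (y, z) ∈ A.graph) ↔
    ∃ y, (x, y) ∈ D.graph ∧ (y, z) ∈ D†.graph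

/-- `T t = e^{-t A}` for `t ≥ 0`: the strongly continuous semigroup with generator `-A`. -/
structure IsHeatSemigroup (A : H →ₗ.[ℂ] H) (T : ℝ → H →L[ℂ] H) : Prop where
  zero : T 0 = 1
  add : ∀ s t : ℝ, 0 ≤ s → 0 ≤ t → T (s + t) = T s * T t
  continuousOn : ∀ x : H, ContinuousOn (fun t => T t x) (Set.Ici 0)
  generator : ∀ x y : H,
    (x, y) ∈ A.graph ↔ HasDerivWithinAt (fun t => T t x) (-y) (Set.Ici 0) 0

/-- `T` is of trace class with trace `τ`: for every orthonormal basis `b`, the series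
`∑ i, ⟪b i, T (b i)⟫` converges (unconditionally) to `τ`. -/
def HasTrace (T : H →L[ℂ] H) (τ : ℂ) : Prop :=
  ∀ (ι : Type) (b : HilbertBasis ι ℂ H), HasSum (fun i => inner ℂ (b i) (T (b i))) τ

/-- The multiplicity `dim ker (A - μ)` of the real number `μ` as an eigenvalue of `A`. -/
def multiplicity (A : H →ₗ.[ℂ] H) (μ : ℝ) : ℕ :=
  Module.finrank ℂ (LinearMap.ker (A.toFun - (μ : ℂ) • A.domain.subtype))

end SphereDirac

end

open SphereDirac

noncomputable section

namespace SphereDirac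

/-! The spectrum of the Dirac operator is computed algebraically; the heat trace then has a closed
form from which everything else is read off.

Spectrum. In the trivialised spinor bundle the Dirac operator is `ambientDirac` plus a constant, `d
/ 2` for the bounding spin structure and `0` for the trivial one (`dirac_eq_ambientDirac`). On the
space `F_k` of homogeneous spinor-valued polynomials of degree `k`, `ambientDirac` acts as an
operator `L` with `(L - k)(L + k + d - 1) = -r²Δ` (`sq_weylClifford`, `homIncl_quadratic`). It
commutes with `r²` and has trace zero (`trace_homDirac`). Hence on a complement of `r² F_{k-2}` only
the eigenvalues `k` and `-(k + d - 1)` occur, and the vanishing trace determines both multiplicities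
(`finrank_eigenspace_homDirac`). On the sphere `r² = 1`, polynomial fields are dense by
Stone-Weierstrass, and the Dirac operator is symmetric by the divergence theorem
(`integral_inner_dirac`). So the polynomial eigenfields give a Hilbert basis in which the closed
operator is diagonal with maximal domain (`diracOperator_eq_diagOp`). Its eigenvalues are `±(k +
d/2)`, each sign with multiplicity `2^⌊d/2⌋ * choose (k + d - 1) (d - 1)`; for the trivial structure
on the circle they are all the integers, each simple.

Expansion. The absolute value and the semigroup of a diagonal operator are diagonal and unique. The
heat trace is `h + c e^{-θt} / (1 - e^{-t})^d` with `c = 2 * 2^⌊d/2⌋` and `θ = d/2`, or `θ = 1` for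
the trivial structure. The zeros of `1 - e^{-z}` are the multiples of `2πi`, so `t^d` times the
second summand is holomorphic in `|z| < 2π`, and its Taylor series is the convergent expansion. The
Mellin transform of this summand is `Γ ζ`: the integral over `(0, 1]`, taken term by term, is `∑ a_k
/ (s - d + k)`, and the integral over `(1, ∞)` is entire. Thus the Taylor coefficients are the
residues (`exists_zeta_expansion`). -/

lemma _root_.HasSum.congr_fun' {ι M : Type*} [AddCommMonoid M] [TopologicalSpace M] {f g : ι → M}
    {x : M} (h : HasSum g x) (hfg : ∀ i, f i = g i) : HasSum f x := by
  rwa [funext hfg]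

/-! ### The zeta function attached to a power of the Bose-Einstein kernel -/

/-- The heat trace `∑ k, c * (k + d - 1).choose (d - 1) * e^{-(k + θ) t}` in closed form. -/
def heatSum (d : ℕ) (θ c t : ℝ) : ℝ := c * Real.exp (-θ * t) / (1 - Real.exp (-t)) ^ d

/-- The negative binomial series in `e^{-t}`, multiplied by `c e^{-θt}`. -/
lemma hasSum_heatSum {d : ℕ} (hd : 1 ≤ d) (θ c : ℝ) {t : ℝ} (ht : 0 < t) :
    HasSum (fun k : ℕ => c * ((k + (d - 1)).choose (d - 1) : ℝ) * Real.exp (-(k + θ) * t))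
      (heatSum d θ c t) := by
  have h1 : ‖Real.exp (-t)‖ < 1 := by
    rw [Real.norm_eq_abs, abs_of_pos (Real.exp_pos _)]
    exact Real.exp_lt_one_iff.2 (by linarith)
  have h := (hasSum_choose_mul_geometric_of_norm_lt_one (d - 1) h1).mul_left
    (c * Real.exp (-θ * t))
  rw [Nat.sub_add_cancel hd] at h
  rw [mul_one_div] at h
  refine h.congr_fun' fun k => ?_
  rw [← Real.exp_nat_mul, show -((k : ℝ) + θ) * t = -θ * t + k * -t by ring, Real.exp_add]
  ring

/-- The zeros of `1 - e^{-z}` are the multiples of `2πi`; this is where the radius `2π` comes from.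
-/
lemma one_sub_exp_neg_ne_zero {z : ℂ} (hz : z ≠ 0) (h : ‖z‖ < 2 * Real.pi) :
    1 - Complex.exp (-z) ≠ 0 := by
  intro h0
  obtain ⟨n, hn⟩ := Complex.exp_eq_one_iff.1 (sub_eq_zero.1 h0).symm
  have hn0 : n ≠ 0 := by
    rintro rfl
    simp at hn
    exact hz hn
  have h1 : ‖z‖ = |(n : ℝ)| * (2 * Real.pi) := by
    rw [← norm_neg, hn]
    simp [abs_of_pos Real.pi_pos]
  have h2 : (1 : ℝ) ≤ |(n : ℝ)| := by exact_mod_cast Int.one_le_abs hn0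
  nlinarith [Real.pi_pos]

/-- With `E z = (1 - e^{-z}) / z`, the function in question is `c e^{-θz} / E(z)^d`. It is
holomorphic on the disc of radius `2π`, so its Taylor series converges on the whole disc. -/
lemma exists_hasSum_heatSum_expansion (d : ℕ) (θ c : ℝ) :
    ∃ a : ℕ → ℝ, ∀ t ∈ Set.Ioo 0 (2 * Real.pi),
      HasSum (fun k => a k * t ^ k) (t ^ d * heatSum d θ c t) := by
  -- `dslope` fills the removable singularity at `0` with the derivative, which is `1`.
  set E : ℂ → ℂ := dslope (fun z => 1 - Complex.exp (-z)) 0 with hE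
  have hEd : DifferentiableOn ℂ E (ball 0 (2 * Real.pi)) := by
    refine (Complex.differentiableOn_dslope (ball_mem_nhds _ (by positivity))).2 ?_
    fun_prop
  have hE1 : ∀ z ≠ 0, z * E z = 1 - Complex.exp (-z) := by
    intro z hz
    rw [hE, dslope_of_ne _ hz, slope_def_field]
    rw [neg_zero, Complex.exp_zero, sub_self, sub_zero, sub_zero, mul_div_cancel₀ _ hz]
  have hE0 : ∀ z ∈ ball (0 : ℂ) (2 * Real.pi), E z ≠ 0 := by
    intro z hz
    by_cases h : z = 0
    · subst h
      have : HasDerivAt (fun z : ℂ => 1 - Complex.exp (-z)) 1 0 := by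
        have := (((hasDerivAt_id (0 : ℂ)).neg).cexp).const_sub 1
        simpa using this
      rw [hE, dslope_same, this.deriv]
      exact one_ne_zero
    · intro h0
      have := hE1 z h
      rw [h0, mul_zero] at this
      exact one_sub_exp_neg_ne_zero h (by simpa using hz) this.symm
  set G : ℂ → ℂ := fun z => c * Complex.exp (-θ * z) / E z ^ d with hG
  have hGd : DifferentiableOn ℂ G (ball 0 (2 * Real.pi)) := by
    refine DifferentiableOn.div (by fun_prop) (hEd.pow _) fun z hz => pow_ne_zero _ (hE0 z hz)
  -- Taking real parts of the coefficients loses nothing, since the sum is real at real `t`; their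
  -- reality need not be proved.
  refine ⟨fun k => ((k.factorial : ℂ)⁻¹ * iteratedDeriv k G 0).re, fun t ht => ?_⟩
  have htb : (t : ℂ) ∈ ball (0 : ℂ) (2 * Real.pi) := by
    simp [abs_of_pos ht.1, ht.2]
  have ht0 : (t : ℂ) ≠ 0 := by exact_mod_cast ht.1.ne'
  have h := Complex.hasSum_re (Complex.hasSum_taylorSeries_on_ball hGd htb)
  convert h using 1
  · ext k
    have : ((k.factorial : ℂ))⁻¹ • ((t : ℂ) - 0) ^ k • iteratedDeriv k G 0
        = ((k.factorial : ℂ)⁻¹ * iteratedDeriv k G 0) * ((t ^ k : ℝ) : ℂ) := by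
      simp only [smul_eq_mul, sub_zero]; push_cast; ring
    rw [this, Complex.re_mul_ofReal]
  · have h3 : G t = ((t ^ d * heatSum d θ c t : ℝ) : ℂ) := by
      have h4 : E t = (1 - Complex.exp (-t)) / t := by
        rw [← hE1 _ ht0]; field_simp
      have h5 : (1 - Complex.exp (-t)) ≠ 0 :=
        one_sub_exp_neg_ne_zero ht0 (by simpa using htb)
      rw [hG, heatSum]
      simp only [h4]
      push_cast
      rw [div_pow]
      field_simp
    rw [h3, Complex.ofReal_re]

/-! ### Convergence and remainder of the Laurent expansion. -/

lemma summable_abs_mul_pow {a : ℕ → ℝ} {f : ℝ → ℝ}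
    (ha : ∀ t ∈ Set.Ioo 0 (2 * Real.pi), HasSum (fun k => a k * t ^ k) (f t))
    {t : ℝ} (ht : t ∈ Set.Ioo 0 (2 * Real.pi)) : Summable fun k => |a k| * t ^ k := by
  have := (ha t ht).summable.norm
  refine this.congr fun k => ?_
  simp [abs_of_pos ht.1]

/-- The point `t = 1` lies inside the interval of convergence. This bound controls the remainder,
the sum of simple fractions and the Mellin integral over `(0, 1]`. -/
lemma summable_abs_coeff {a : ℕ → ℝ} {f : ℝ → ℝ}
    (ha : ∀ t ∈ Set.Ioo 0 (2 * Real.pi), HasSum (fun k => a k * t ^ k) (f t)) :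
    Summable fun k => |a k| := by
  simpa using summable_abs_mul_pow ha (t := 1) ⟨one_pos, by linarith [Real.pi_gt_three]⟩

lemma hasSum_laurent {d : ℕ} {a : ℕ → ℝ} {F : ℝ → ℝ}
    (ha : ∀ t ∈ Set.Ioo 0 (2 * Real.pi), HasSum (fun k => a k * t ^ k) (t ^ d * F t))
    {t : ℝ} (ht : t ∈ Set.Ioo 0 (2 * Real.pi)) :
    HasSum (fun k : ℕ => a k * t ^ ((k : ℤ) - (d : ℤ))) (F t) := by
  have ht0 : t ≠ 0 := ht.1.ne'
  have := (ha t ht).mul_left ((t ^ d)⁻¹)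
  rw [inv_mul_cancel_left₀ (pow_ne_zero _ ht0)] at this
  refine this.congr_fun' fun k => ?_
  rw [zpow_sub₀ ht0, zpow_natCast, zpow_natCast]
  field_simp

lemma hasSumLocallyUniformlyOn_laurent {d : ℕ} {a : ℕ → ℝ} {F : ℝ → ℝ}
    (ha : ∀ t ∈ Set.Ioo 0 (2 * Real.pi), HasSum (fun k => a k * t ^ k) (t ^ d * F t)) :
    HasSumLocallyUniformlyOn (fun (k : ℕ) (t : ℝ) => a k * t ^ ((k : ℤ) - (d : ℤ)))
      F (Set.Ioo 0 (2 * Real.pi)) := by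
  have hS : SummableLocallyUniformlyOn (fun (k : ℕ) (t : ℝ) => a k * t ^ ((k : ℤ) - (d : ℤ)))
      (Set.Ioo 0 (2 * Real.pi)) := by
    refine SummableLocallyUniformlyOn_of_locally_bounded isOpen_Ioo fun K hK hKc => ?_
    rcases K.eq_empty_or_nonempty with rfl | hne
    · exact ⟨0, summable_zero, by simp⟩
    obtain ⟨R, hRK, hR⟩ := hKc.exists_isMaxOn hne continuousOn_id
    obtain ⟨r, hrK, hr⟩ := hKc.exists_isMinOn hne continuousOn_id
    have hr0 : 0 < r := (hK hrK).1
    -- Weierstrass test on a compact set with minimum `r` and maximum `R`: the positive powers are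
    -- bounded at `R`, the factor `t^{-d}` at `r`.
    refine ⟨fun k => (r ^ d)⁻¹ * (|a k| * R ^ k),
      (summable_abs_mul_pow ha (hK hRK)).mul_left _, fun k t ht => ?_⟩
    have ht0 : 0 < t := (hK ht).1
    have h1 : t ≤ R := hR ht
    have h2 : r ≤ t := hr ht
    rw [zpow_sub₀ ht0.ne', zpow_natCast, zpow_natCast, Real.norm_eq_abs, abs_mul,
      abs_of_pos (by positivity : 0 < t ^ k / t ^ d), div_eq_inv_mul, mul_left_comm]
    refine mul_le_mul (inv_anti₀ (by positivity) (pow_le_pow_left₀ hr0.le h2 _))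
      (mul_le_mul_of_nonneg_left (pow_le_pow_left₀ ht0.le h1 _) (abs_nonneg _)) (by positivity)
      (by positivity)
  exact hS.hasSumLocallyUniformlyOn.congr_right
    fun t ht => (hasSum_laurent ha ht).tsum_eq

/-- For `t < 1` each term of index at least `N` is at most `|a_k| t^{N-d}`, so `∑ |a_k|` serves as
the constant. -/
lemma isBigO_laurent {d : ℕ} {a : ℕ → ℝ} {F : ℝ → ℝ}
    (ha : ∀ t ∈ Set.Ioo 0 (2 * Real.pi), HasSum (fun k => a k * t ^ k) (t ^ d * F t)) (N : ℕ) :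
    (fun t : ℝ => F t - ∑ k ∈ Finset.range N, a k * t ^ ((k : ℤ) - (d : ℤ)))
      =O[𝓝[>] 0] fun t : ℝ => t ^ ((N : ℤ) - (d : ℤ)) := by
  have hsum := summable_abs_coeff ha
  refine IsBigO.of_bound (∑' k, |a k|) ?_
  filter_upwards [Ioo_mem_nhdsGT one_pos] with t ht
  have htm : t ∈ Set.Ioo 0 (2 * Real.pi) := ⟨ht.1, by linarith [ht.2, Real.pi_gt_three]⟩
  have h1 := (hasSum_nat_add_iff' N).2 (hasSum_laurent ha htm)
  have hpos : 0 < t ^ ((N : ℤ) - (d : ℤ)) := zpow_pos ht.1 _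
  have hbd : ∀ k : ℕ, ‖a (k + N) * t ^ (((k + N : ℕ) : ℤ) - (d : ℤ))‖
      ≤ |a (k + N)| * t ^ ((N : ℤ) - (d : ℤ)) := by
    intro k
    rw [Real.norm_eq_abs, abs_mul, abs_of_pos (zpow_pos ht.1 _)]
    refine mul_le_mul_of_nonneg_left ?_ (abs_nonneg _)
    rw [show (((k + N : ℕ) : ℤ) - (d : ℤ)) = (k : ℤ) + ((N : ℤ) - d) by push_cast; ring,
      zpow_add₀ ht.1.ne', zpow_natCast]
    exact mul_le_of_le_one_left hpos.le (pow_le_one₀ ht.1.le ht.2.le)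
  have hs2 : Summable fun k => |a (k + N)| := (summable_nat_add_iff N).2 hsum
  have h2 := tsum_of_norm_bounded (hs2.hasSum.mul_right (t ^ ((N : ℤ) - (d : ℤ)))) hbd
  rw [h1.tsum_eq] at h2
  refine h2.trans ?_
  rw [Real.norm_eq_abs, abs_of_pos hpos]
  refine mul_le_mul_of_nonneg_right ?_ hpos.le
  rw [← hsum.sum_add_tsum_nat_add N]
  exact le_add_of_nonneg_left (Finset.sum_nonneg fun _ _ => abs_nonneg _)

end SphereDirac

end

/-! ### Poles and residues of `Γ ζ`. -/

noncomputable section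

namespace SphereDirac

/-- The sum `∑ k, a k / (s - d + k)` of simple fractions. -/
def polarSum (d : ℕ) (a : ℕ → ℝ) (s : ℂ) : ℂ := ∑' k : ℕ, (a k : ℂ) / (s - d + k)

/-- In the ball of radius `K - d - 1` all denominators with index at least `K` have modulus at least
`1`. The tail is therefore dominated by `∑ |a_k|` and holomorphic, and finitely many explicit
fractions remain. -/
lemma exists_polarSum_eq (d : ℕ) {a : ℕ → ℝ} (ha : Summable fun k => |a k|) (K : ℕ) :
    ∃ g : ℂ → ℂ, DifferentiableOn ℂ g (ball 0 (K - d - 1)) ∧ ∀ s ∈ ball (0 : ℂ) (K - d - 1),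
      polarSum d a s = ∑ k ∈ Finset.range K, (a k : ℂ) / (s - d + k) + g s := by
  have hlow : ∀ s ∈ ball (0 : ℂ) (K - d - 1), ∀ k : ℕ, 1 ≤ ‖s - d + ((k + K : ℕ) : ℂ)‖ := by
    intro s hs k
    rw [mem_ball_zero_iff] at hs
    have h1 : ‖(((k + K : ℕ) : ℂ) - d)‖ - ‖-s‖ ≤ ‖(((k + K : ℕ) : ℂ) - d) - -s‖ :=
      norm_sub_norm_le _ _
    have h2 : ((k + K : ℕ) : ℝ) - d ≤ ‖(((k + K : ℕ) : ℂ) - d)‖ := by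
      have := Complex.re_le_norm (((k + K : ℕ) : ℂ) - d)
      simpa using this
    rw [norm_neg] at h1
    rw [show s - d + ((k + K : ℕ) : ℂ) = (((k + K : ℕ) : ℂ) - d) - -s by ring]
    push_cast at h2 h1 ⊢
    have : (0 : ℝ) ≤ k := k.cast_nonneg
    linarith
  have hbd : ∀ k : ℕ, ∀ s ∈ ball (0 : ℂ) (K - d - 1),
      ‖(a (k + K) : ℂ) / (s - d + ((k + K : ℕ) : ℂ))‖ ≤ |a (k + K)| := by
    intro k s hs
    rw [norm_div, Complex.norm_real, Real.norm_eq_abs]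
    exact div_le_self (abs_nonneg _) (hlow s hs k)
  have hs2 : Summable fun k => |a (k + K)| := (summable_nat_add_iff K).2 ha
  refine ⟨fun s => ∑' k : ℕ, (a (k + K) : ℂ) / (s - d + ((k + K : ℕ) : ℂ)), ?_, fun s hs => ?_⟩
  · refine Complex.differentiableOn_tsum_of_summable_norm hs2 (fun k => ?_) isOpen_ball hbd
    refine DifferentiableOn.div (by fun_prop) (by fun_prop) fun s hs h0 => ?_
    have := hlow s hs k
    rw [h0, norm_zero] at this
    linarith
  · have hs3 : Summable fun k : ℕ => (a k : ℂ) / (s - d + (k : ℂ)) :=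
      (summable_nat_add_iff K).1 (Summable.of_norm_bounded hs2 fun k => hbd k s hs)
    rw [polarSum, ← hs3.sum_add_tsum_nat_add K]

lemma mem_ball_pole_range (d : ℕ) (s : ℂ) :
    ∃ K : ℕ, s ∈ ball (0 : ℂ) (K - d - 1) := by
  obtain ⟨K, hK⟩ := exists_nat_gt (‖s‖ + d + 1)
  exact ⟨K, by rw [mem_ball_zero_iff]; linarith⟩

lemma meromorphicAt_polarSum (d : ℕ) {a : ℕ → ℝ} (ha : Summable fun k => |a k|) (s : ℂ) :
    MeromorphicAt (polarSum d a) s := by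
  obtain ⟨K, hK⟩ := mem_ball_pole_range d s
  obtain ⟨g, hg, hgs⟩ := exists_polarSum_eq d ha K
  have hn := isOpen_ball.mem_nhds hK
  have h1 : AnalyticAt ℂ g s := hg.analyticAt hn
  have h2 : MeromorphicAt (fun s : ℂ => ∑ k ∈ Finset.range K, (a k : ℂ) / (s - d + k) + g s) s := by
    refine MeromorphicAt.add (MeromorphicAt.fun_sum fun k _ => ?_) h1.meromorphicAt
    fun_prop
  refine h2.congr ?_
  filter_upwards [nhdsWithin_le_nhds hn] with z hz using (hgs z hz).symm

lemma sub_add_ne_zero_of_ne {d : ℕ} {s : ℂ} {k : ℕ} (h : s ≠ (d : ℂ) - k) : s - d + k ≠ 0 := by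
  intro h0
  exact h (by linear_combination h0)

lemma analyticAt_polarSum (d : ℕ) {a : ℕ → ℝ} (ha : Summable fun k => |a k|) {s : ℂ}
    (hs : ∀ k : ℕ, s ≠ (d : ℂ) - k) : AnalyticAt ℂ (polarSum d a) s := by
  obtain ⟨K, hK⟩ := mem_ball_pole_range d s
  obtain ⟨g, hg, hgs⟩ := exists_polarSum_eq d ha K
  have hn := isOpen_ball.mem_nhds hK
  have h1 : AnalyticAt ℂ g s := hg.analyticAt hn
  have h2 : AnalyticAt ℂ (fun s : ℂ => ∑ k ∈ Finset.range K, (a k : ℂ) / (s - d + k) + g s) s := by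
    refine AnalyticAt.add (Finset.analyticAt_fun_sum _ fun k _ => ?_) h1
    exact AnalyticAt.div (by fun_prop) (by fun_prop) (sub_add_ne_zero_of_ne (hs k))
  refine h2.congr ?_
  filter_upwards [hn] with z hz using (hgs z hz).symm

lemma tendsto_polarSum_residue (d : ℕ) {a : ℕ → ℝ} (ha : Summable fun k => |a k|) (k : ℕ) :
    Tendsto (fun s : ℂ => (s - ((d : ℂ) - k)) * polarSum d a s) (𝓝[≠] ((d : ℂ) - k))
      (𝓝 (a k : ℂ)) := by
  obtain ⟨K₀, hK₀⟩ := mem_ball_pole_range d ((d : ℂ) - k)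
  -- The cut-off is enlarged so that the fraction with its pole at `d - k` belongs to the finite
  -- sum.
  set K := max K₀ (k + 1) with hKdef
  have hK : (d : ℂ) - k ∈ ball (0 : ℂ) (K - d - 1) := by
    rw [mem_ball_zero_iff] at hK₀ ⊢
    have : (K₀ : ℝ) ≤ K := by exact_mod_cast le_max_left _ _
    linarith
  have hkK : k ∈ Finset.range K := Finset.mem_range.2 (lt_of_lt_of_le k.lt_succ_self
    (le_max_right _ _))
  obtain ⟨g, hg, hgs⟩ := exists_polarSum_eq d ha K
  have hn := isOpen_ball.mem_nhds hK
  have hgc : ContinuousAt g ((d : ℂ) - k) := (hg.analyticAt hn).continuousAt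
  have hc : ContinuousAt (fun s : ℂ => (a k : ℂ) + (s - ((d : ℂ) - k)) *
      (∑ j ∈ (Finset.range K).erase k, (a j : ℂ) / (s - d + j) + g s)) ((d : ℂ) - k) := by
    refine continuousAt_const.add (ContinuousAt.mul (by fun_prop) (ContinuousAt.add ?_ hgc))
    refine tendsto_finsetSum _ fun j hj => ?_
    refine ContinuousAt.div (by fun_prop) (by fun_prop) ?_
    have hjk : j ≠ k := (Finset.mem_erase.1 hj).1
    intro h0
    apply hjk
    have : (j : ℂ) = k := by linear_combination h0
    exact_mod_cast this
  have hlim := hc.tendsto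
  simp only [sub_self, zero_mul, add_zero] at hlim
  refine (hlim.mono_left nhdsWithin_le_nhds).congr' ?_
  filter_upwards [nhdsWithin_le_nhds hn, self_mem_nhdsWithin] with z hz hne
  rw [hgs z hz, ← Finset.add_sum_erase _ _ hkK]
  have h0 : z - d + k ≠ 0 := sub_add_ne_zero_of_ne hne
  have : (z - ((d : ℂ) - k)) * ((a k : ℂ) / (z - d + k)) = a k := by
    rw [show z - ((d : ℂ) - k) = z - d + k by ring]
    field_simp
  rw [add_assoc, mul_add _ ((a k : ℂ) / (z - d + k)), this]

/-! ### The Mellin transform of the heat trace -/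

lemma continuousOn_heatSum (d : ℕ) (θ c : ℝ) : ContinuousOn (heatSum d θ c) (Set.Ioi 0) := by
  unfold heatSum
  refine ContinuousOn.div (by fun_prop) (by fun_prop) fun t ht => pow_ne_zero _ ?_
  have : Real.exp (-t) < 1 := Real.exp_lt_one_iff.2 (by simpa using ht)
  linarith

/-- The part of the Mellin transform of the heat trace that comes from `t > 1`. -/
def mellinTail (d : ℕ) (θ c : ℝ) : ℂ → ℂ :=
  mellin ((Set.Ioi 1).indicator fun t => (heatSum d θ c t : ℂ))

/-- The hypotheses under which a Mellin transform is entire: decay at rate `θ` at infinity, and any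
power bound at `0`, since the truncated function vanishes there. -/
lemma mellinTail_aux (d : ℕ) (θ c : ℝ) :
    LocallyIntegrableOn ((Set.Ioi 1).indicator fun t => (heatSum d θ c t : ℂ)) (Set.Ioi 0) ∧
    ((Set.Ioi 1).indicator fun t => (heatSum d θ c t : ℂ)) =O[atTop]
      (fun t : ℝ => Real.exp (-θ * t)) ∧
    ∀ b : ℝ, ((Set.Ioi 1).indicator fun t => (heatSum d θ c t : ℂ)) =O[𝓝[>] 0]
      (fun t : ℝ => t ^ (-b)) := by
  refine ⟨?_, ?_, fun b => ?_⟩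
  · have : LocallyIntegrableOn (fun t => (heatSum d θ c t : ℂ)) (Set.Ioi 0) :=
      (Complex.continuous_ofReal.comp_continuousOn (continuousOn_heatSum d θ c)).locallyIntegrableOn
        measurableSet_Ioi
    intro x hx
    obtain ⟨u, hu, hui⟩ := this x hx
    exact ⟨u, hu, hui.indicator measurableSet_Ioi⟩
  · have h1 : Real.exp (-1) < 1 := Real.exp_lt_one_iff.2 (by norm_num)
    refine IsBigO.of_bound (|c| / (1 - Real.exp (-1)) ^ d) ?_
    filter_upwards [eventually_gt_atTop 1] with t ht
    have h2 : Real.exp (-t) ≤ Real.exp (-1) := Real.exp_le_exp.2 (by linarith)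
    have h3 : 0 < 1 - Real.exp (-1) := by linarith
    rw [Set.indicator_of_mem (Set.mem_Ioi.2 ht), Complex.norm_real, heatSum, norm_div, norm_mul, Real.norm_eq_abs,
      Real.norm_eq_abs, Real.norm_eq_abs, abs_of_pos (Real.exp_pos _),
      abs_of_pos (pow_pos (by linarith) _ : 0 < (1 - Real.exp (-t)) ^ d), div_mul_eq_mul_div]
    refine div_le_div_of_nonneg_left (by positivity) (by positivity) ?_
    exact pow_le_pow_left₀ h3.le (by linarith) _
  · refine (isBigO_zero _ _).congr' ?_ EventuallyEq.rfl
    filter_upwards [Ioo_mem_nhdsGT one_pos] with t ht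
    rw [Set.indicator_of_notMem (by simpa using ht.2.le)]

lemma differentiable_mellinTail (d : ℕ) {θ : ℝ} (hθ : 0 < θ) (c : ℝ) :
    Differentiable ℂ (mellinTail d θ c) := by
  intro s
  obtain ⟨h1, h2, h3⟩ := mellinTail_aux d θ c
  exact mellin_differentiableAt_of_isBigO_rpow_exp hθ h1 h2 (h3 (s.re - 1)) (by linarith)

/-- The integral is split at `t = 1`. On `(0, 1]` the Laurent series is integrated termwise, each
power giving `1 / (s - d + k)`; this is legitimate because the integrals of the norms are at most
`|a_k| / (Re s - d)`. -/
lemma mellin_heatSum {d : ℕ} {θ : ℝ} (hθ : 0 < θ) (c : ℝ) {a : ℕ → ℝ}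
    (ha : ∀ t ∈ Set.Ioo 0 (2 * Real.pi), HasSum (fun k => a k * t ^ k) (t ^ d * heatSum d θ c t))
    {s : ℂ} (hs : (d : ℝ) < s.re) :
    mellin (fun t => (heatSum d θ c t : ℂ)) s = polarSum d a s + mellinTail d θ c s := by
  have hsum := summable_abs_coeff ha
  set e : ℕ → ℂ := fun k => s - 1 + ((k : ℂ) - d) with he
  have hre : ∀ k : ℕ, -1 < (e k).re := by
    intro k
    simp only [he, Complex.add_re, Complex.sub_re, Complex.one_re, Complex.natCast_re]
    have : (0 : ℝ) ≤ k := k.cast_nonneg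
    linarith
  have hint : ∀ k, IntegrableOn (fun t : ℝ => (a k : ℂ) * (t : ℂ) ^ e k) (Set.Ioc 0 1) := by
    intro k
    have := intervalIntegral.intervalIntegrable_cpow' (a := 0) (b := 1) (hre k)
    rw [intervalIntegrable_iff_integrableOn_Ioc_of_le zero_le_one] at this
    exact this.const_mul _
  have hval : ∀ k, ∫ t in Set.Ioc (0 : ℝ) 1, (a k : ℂ) * (t : ℂ) ^ e k = a k / (s - d + k) := by
    intro k
    rw [integral_const_mul, ← intervalIntegral.integral_of_le zero_le_one,
      integral_cpow (Or.inl (hre k))]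
    have h0 : e k + 1 ≠ 0 := by
      intro h0
      have := congrArg Complex.re h0
      simp only [Complex.add_re, Complex.one_re, Complex.zero_re] at this
      linarith [hre k]
    rw [Complex.ofReal_zero, Complex.zero_cpow h0, Complex.ofReal_one, Complex.one_cpow, sub_zero,
      show e k + 1 = s - d + k by simp only [he]; ring, mul_one_div]
  have hnorm : ∀ k, ∫ t in Set.Ioc (0 : ℝ) 1, ‖(a k : ℂ) * (t : ℂ) ^ e k‖
      ≤ |a k| * (1 / (s.re - d)) := by
    intro k
    have h1 : ∀ t ∈ Set.Ioc (0 : ℝ) 1, ‖(a k : ℂ) * (t : ℂ) ^ e k‖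
        = |a k| * t ^ (e k).re := by
      intro t ht
      rw [norm_mul, Complex.norm_real, Real.norm_eq_abs,
        Complex.norm_cpow_eq_rpow_re_of_pos ht.1]
    rw [setIntegral_congr_fun measurableSet_Ioc h1, integral_const_mul,
      ← intervalIntegral.integral_of_le zero_le_one, integral_rpow (Or.inl (hre k)),
      Real.one_rpow, Real.zero_rpow (by linarith [hre k]), sub_zero]
    refine mul_le_mul_of_nonneg_left (one_div_le_one_div_of_le (by linarith) ?_) (abs_nonneg _)
    simp only [he, Complex.add_re, Complex.sub_re, Complex.one_re, Complex.natCast_re]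
    have : (0 : ℝ) ≤ k := k.cast_nonneg
    linarith
  have hsumint : Summable fun k => ∫ t in Set.Ioc (0 : ℝ) 1, ‖(a k : ℂ) * (t : ℂ) ^ e k‖ :=
    Summable.of_nonneg_of_le (fun k => integral_nonneg fun t => norm_nonneg _) hnorm
      (hsum.mul_right _)
  have hpt : ∀ t ∈ Set.Ioc (0 : ℝ) 1, HasSum (fun k => (a k : ℂ) * (t : ℂ) ^ e k)
      ((t : ℂ) ^ (s - 1) * (heatSum d θ c t : ℂ)) := by
    intro t ht
    have htm : t ∈ Set.Ioo 0 (2 * Real.pi) := ⟨ht.1, by linarith [ht.2, Real.pi_gt_three]⟩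
    have h1 := (Complex.hasSum_ofReal.2 (hasSum_laurent ha htm)).mul_left ((t : ℂ) ^ (s - 1))
    refine h1.congr_fun' fun k => ?_
    have ht0 : (t : ℂ) ≠ 0 := by exact_mod_cast ht.1.ne'
    rw [he, Complex.cpow_add _ _ ht0]
    push_cast
    rw [← Complex.cpow_intCast]
    push_cast
    ring
  have hmain := hasSum_integral_of_summable_integral_norm hint hsumint
  -- Splitting the Mellin integral requires integrability on each piece; on `(0, 1]` it follows from
  -- Tonelli and the same summable bound.
  have hI1 : IntegrableOn (fun t : ℝ => (t : ℂ) ^ (s - 1) * (heatSum d θ c t : ℂ))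
      (Set.Ioc 0 1) := by
    have hb := hasSum_integral_of_summable_integral_norm hint hsumint
    have : IntegrableOn (fun t : ℝ => ∑' k, (a k : ℂ) * (t : ℂ) ^ e k) (Set.Ioc 0 1) := by
      refine ⟨?_, ?_⟩
      · refine AEStronglyMeasurable.congr (f := fun t : ℝ => (t : ℂ) ^ (s - 1) *
          (heatSum d θ c t : ℂ)) ?_ ?_
        · refine ContinuousOn.aestronglyMeasurable ?_ measurableSet_Ioc
          refine ContinuousOn.mul (fun t ht => ?_) ?_
          · exact (Complex.continuousAt_ofReal_cpow_const _ _ (Or.inr ht.1.ne')).continuousWithinAt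
          · exact (Complex.continuous_ofReal.comp_continuousOn
              (continuousOn_heatSum d θ c)).mono Set.Ioc_subset_Ioi_self
        · filter_upwards [ae_restrict_mem measurableSet_Ioc] with t ht
          exact (hpt t ht).tsum_eq.symm
      · have : ∀ k, ∫⁻ t in Set.Ioc (0 : ℝ) 1, ‖(a k : ℂ) * (t : ℂ) ^ e k‖ₑ
            = ENNReal.ofReal (∫ t in Set.Ioc (0 : ℝ) 1, ‖(a k : ℂ) * (t : ℂ) ^ e k‖) :=
          fun k => (ofReal_integral_norm_eq_lintegral_enorm (hint k)).symm
        rw [hasFiniteIntegral_iff_enorm]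
        calc ∫⁻ t in Set.Ioc (0 : ℝ) 1, ‖∑' k, (a k : ℂ) * (t : ℂ) ^ e k‖ₑ
            ≤ ∫⁻ t in Set.Ioc (0 : ℝ) 1, ∑' k, ‖(a k : ℂ) * (t : ℂ) ^ e k‖ₑ :=
              lintegral_mono fun t => enorm_tsum_le_tsum_enorm
          _ = ∑' k, ∫⁻ t in Set.Ioc (0 : ℝ) 1, ‖(a k : ℂ) * (t : ℂ) ^ e k‖ₑ :=
              lintegral_tsum fun k => (hint k).aestronglyMeasurable.enorm
          _ = ENNReal.ofReal (∑' k, ∫ t in Set.Ioc (0 : ℝ) 1, ‖(a k : ℂ) * (t : ℂ) ^ e k‖) := by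
              simp_rw [this]
              exact (ENNReal.ofReal_tsum_of_nonneg
                (fun k => integral_nonneg fun t => norm_nonneg _) hsumint).symm
          _ < ⊤ := ENNReal.ofReal_lt_top
    refine this.congr_fun (fun t ht => (hpt t ht).tsum_eq) measurableSet_Ioc
  have hJ : MellinConvergent ((Set.Ioi 1).indicator fun t => (heatSum d θ c t : ℂ)) s := by
    obtain ⟨h1, h2, h3⟩ := mellinTail_aux d θ c
    exact mellinConvergent_of_isBigO_rpow_exp hθ h1 h2 (h3 (s.re - 1)) (by linarith)
  have hJe : (fun t : ℝ => (t : ℂ) ^ (s - 1) •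
      (Set.Ioi 1).indicator (fun t => (heatSum d θ c t : ℂ)) t)
      = (Set.Ioi 1).indicator fun t : ℝ => (t : ℂ) ^ (s - 1) * (heatSum d θ c t : ℂ) := by
    ext t
    by_cases h : t ∈ Set.Ioi (1 : ℝ) <;> simp [h]
  have hIoi : Set.Ioi (0 : ℝ) ∩ Set.Ioi 1 = Set.Ioi 1 :=
    Set.inter_eq_right.2 (Set.Ioi_subset_Ioi zero_le_one)
  have hI2 : IntegrableOn (fun t : ℝ => (t : ℂ) ^ (s - 1) * (heatSum d θ c t : ℂ))
      (Set.Ioi 1) := by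
    have := hJ
    rw [MellinConvergent, hJe, IntegrableOn, integrable_indicator_iff measurableSet_Ioi,
      IntegrableOn, Measure.restrict_restrict measurableSet_Ioi, Set.inter_comm, hIoi] at this
    exact this
  simp_rw [mellin, mellinTail, mellin, hJe, smul_eq_mul]
  rw [ setIntegral_indicator measurableSet_Ioi, hIoi,
    ← Set.Ioc_union_Ioi_eq_Ioi zero_le_one,
    setIntegral_union (Set.Ioc_disjoint_Ioi le_rfl) measurableSet_Ioi hI1 hI2]
  congr 1
  rw [polarSum, ← tsum_congr hval, hmain.tsum_eq]
  exact setIntegral_congr_fun measurableSet_Ioc fun t ht => (hpt t ht).tsum_eq.symm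

/-! ### The Dirichlet series and its Mellin representation. -/

lemma summable_choose_div_rpow (d : ℕ) {θ : ℝ} (hθ : 0 < θ) {σ : ℝ} (hσ : (d : ℝ) < σ)
    (hd : 1 ≤ d) :
    Summable fun k : ℕ => ((k + (d - 1)).choose (d - 1) : ℝ) / (k + θ) ^ σ := by
  -- The constant comes from `k + d - 1 ≤ (1 + d/θ)(k + θ)`, which compares the binomial coefficient
  -- with `(k + θ)^(d - 1)`.
  set C : ℝ := (1 + d / θ) ^ (d - 1) with hC
  have hs : Summable fun k : ℕ => C * (1 / |(k : ℝ) + θ| ^ (σ - (d - 1 : ℕ))) := by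
    refine (Real.summable_one_div_nat_add_rpow θ _).2 ?_ |>.mul_left C
    have : ((d - 1 : ℕ) : ℝ) = d - 1 := by rw [Nat.cast_sub hd, Nat.cast_one]
    rw [this]; linarith
  refine Summable.of_nonneg_of_le (fun k => by positivity) (fun k => ?_) hs
  have hk : (0 : ℝ) < k + θ := by positivity
  rw [abs_of_pos hk, Real.rpow_sub hk, Real.rpow_natCast, one_div, inv_div, ← mul_div_assoc]
  gcongr
  calc ((k + (d - 1)).choose (d - 1) : ℝ) ≤ ((k + (d - 1) : ℕ) : ℝ) ^ (d - 1) := by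
        exact_mod_cast Nat.choose_le_pow _ _
    _ ≤ ((1 + d / θ) * (k + θ)) ^ (d - 1) := by
        gcongr
        have h1 : ((d - 1 : ℕ) : ℝ) = d - 1 := by rw [Nat.cast_sub hd, Nat.cast_one]
        push_cast [h1]
        have h2 : (d : ℝ) / θ * θ = d := by field_simp
        have h3 : 0 ≤ (d : ℝ) / θ * k := by positivity
        nlinarith
    _ = C * (k + θ) ^ (d - 1) := by rw [hC, mul_pow]

/-- The Mellin transform of `e^{-pt}` is `Γ(s) p^{-s}`; summing over the spectrum gives `Γ ζ`, and
`Γ` has no zero where `Re s > 0`. -/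
lemma hasSum_zeta {d : ℕ} (hd : 1 ≤ d) {θ : ℝ} (hθ : 0 < θ) (c : ℝ) {a : ℕ → ℝ}
    (ha : ∀ t ∈ Set.Ioo 0 (2 * Real.pi), HasSum (fun k => a k * t ^ k) (t ^ d * heatSum d θ c t))
    {s : ℂ} (hs : (d : ℝ) < s.re) :
    HasSum (fun k : ℕ => ((c * ((k + (d - 1)).choose (d - 1) : ℝ) : ℝ) : ℂ) *
      ((k + θ : ℝ) : ℂ) ^ (-s)) ((Complex.Gamma s)⁻¹ * (polarSum d a s + mellinTail d θ c s)) := by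
  have hs0 : 0 < s.re := lt_of_le_of_lt (Nat.cast_nonneg d) hs
  have h := hasSum_mellin (a := fun k : ℕ => ((c * ((k + (d - 1)).choose (d - 1) : ℝ) : ℝ) : ℂ))
    (p := fun k : ℕ => (k : ℝ) + θ) (F := fun t => (heatSum d θ c t : ℂ)) (s := s)
    (fun k => Or.inr (by positivity)) hs0 (fun t ht => ?_) ?_
  · rw [mellin_heatSum hθ c ha hs] at h
    refine (h.mul_left (Complex.Gamma s)⁻¹).congr_fun' fun k => ?_
    rw [mul_div_assoc, inv_mul_cancel_left₀ (Complex.Gamma_ne_zero_of_re_pos hs0),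
      Complex.cpow_neg, div_eq_mul_inv]
  · have := Complex.hasSum_ofReal.2 (hasSum_heatSum hd θ c ht)
    refine this.congr_fun' fun k => ?_
    push_cast
    ring
  · refine ((summable_choose_div_rpow d hθ hs hd).mul_left |c|).congr fun k => ?_
    rw [Complex.norm_real, Real.norm_eq_abs, abs_mul, Nat.abs_cast, mul_div_assoc]

/-- The zeta function and the short-time expansion of a heat trace with the eigenvalues `k + θ` of
multiplicity `c * (k + d - 1).choose (d - 1)`. -/
theorem exists_zeta_expansion {d : ℕ} (hd : 1 ≤ d) {θ : ℝ} (hθ : 0 < θ) (c : ℝ) :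
    ∃ (ζ : ℂ → ℂ) (a : ℕ → ℝ),
      (∀ s : ℂ, (d : ℝ) < s.re →
        HasSum (fun k : ℕ => ((c * ((k + (d - 1)).choose (d - 1) : ℝ) : ℝ) : ℂ) *
          ((k + θ : ℝ) : ℂ) ^ (-s)) (ζ s)) ∧
      MeromorphicOn ζ Set.univ ∧
      (∀ s : ℂ, (∀ k : ℕ, s ≠ (d : ℂ) - k) → AnalyticAt ℂ ζ s) ∧
      (∀ k : ℕ, Tendsto (fun s : ℂ => (s - ((d : ℂ) - k)) * (Complex.Gamma s * ζ s))
        (𝓝[≠] ((d : ℂ) - k)) (𝓝 (a k : ℂ))) ∧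
      (∀ N : ℕ, (fun t : ℝ => heatSum d θ c t -
          ∑ k ∈ Finset.range N, a k * t ^ ((k : ℤ) - (d : ℤ)))
        =O[𝓝[>] 0] fun t : ℝ => t ^ ((N : ℤ) - (d : ℤ))) ∧
      HasSumLocallyUniformlyOn (fun (k : ℕ) (t : ℝ) => a k * t ^ ((k : ℤ) - (d : ℤ)))
        (heatSum d θ c) (Set.Ioo 0 (2 * Real.pi)) := by
  obtain ⟨a, ha⟩ := exists_hasSum_heatSum_expansion d θ c
  have hsum := summable_abs_coeff ha
  have hG : ∀ s, AnalyticAt ℂ (fun s => (Complex.Gamma s)⁻¹) s :=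
    fun s => Complex.differentiable_one_div_Gamma.analyticAt s
  have hT : ∀ s, AnalyticAt ℂ (mellinTail d θ c) s :=
    fun s => (differentiable_mellinTail d hθ c).analyticAt s
  -- The continuation is the continued Mellin transform divided by `Γ`; as `1/Γ` is entire, no new
  -- poles appear.
  refine ⟨fun s => (Complex.Gamma s)⁻¹ * (polarSum d a s + mellinTail d θ c s), a,
    fun s hs => hasSum_zeta hd hθ c ha hs, fun s _ => ?_, fun s hs => ?_, fun k => ?_,
    isBigO_laurent ha, hasSumLocallyUniformlyOn_laurent ha⟩
  · exact (hG s).meromorphicAt.mul ((meromorphicAt_polarSum d hsum s).add (hT s).meromorphicAt)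
  · exact (hG s).mul ((analyticAt_polarSum d hsum hs).add (hT s))
  · have h1 := tendsto_polarSum_residue d hsum k
    have h2 : Tendsto (fun s : ℂ => (s - ((d : ℂ) - k)) * mellinTail d θ c s)
        (𝓝[≠] ((d : ℂ) - k)) (𝓝 0) := by
      have : ContinuousAt (fun s : ℂ => (s - ((d : ℂ) - k)) * mellinTail d θ c s)
          ((d : ℂ) - k) := ContinuousAt.mul (by fun_prop) (hT _).continuousAt
      have := this.tendsto
      rw [sub_self, zero_mul] at this
      exact this.mono_left nhdsWithin_le_nhds
    have h3 := h1.add h2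
    rw [add_zero] at h3
    refine h3.congr' ?_
    -- `Complex.Gamma` takes the value `0` at its poles, so `Γ Γ⁻¹ = 1` holds only off them. By the
    -- identity theorem the zeros of `1/Γ` are isolated, and a punctured neighbourhood avoids them.
    have hne : ∀ᶠ s : ℂ in 𝓝[≠] ((d : ℂ) - k), Complex.Gamma s ≠ 0 := by
      have := ((hG ((d : ℂ) - k)).eventually_eq_zero_or_eventually_ne_zero).resolve_left ?_
      · filter_upwards [this] with s hs using fun h => hs (by rw [h, inv_zero])
      · intro h0
        have hz : (fun s => (Complex.Gamma s)⁻¹) = fun _ => (0 : ℂ) :=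
          AnalyticOnNhd.eq_of_eventuallyEq (fun s _ => hG s) (fun s _ => analyticAt_const) h0
        have := congrFun hz 1
        simp at this
    filter_upwards [hne] with s hs
    rw [mul_inv_cancel_left₀ hs, mul_add]

end SphereDirac

end

noncomputable section

namespace SphereDirac

/-! ### Diagonal operators in a Hilbert basis -/

section Diagonal

variable {H : Type} [NormedAddCommGroup H] [InnerProductSpace ℂ H] {ι : Type}
  (b : HilbertBasis ι ℂ H)

lemma hilbertBasis_ext {x y : H} (h : ∀ i, inner ℂ (b i) x = inner ℂ (b i) y) : x = y := by
  apply b.repr.injective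
  ext i
  simp only [b.repr_apply_apply, h]

lemma hilbertBasis_hasSum (x : H) : HasSum (fun i => inner ℂ (b i) x • b i) x :=
  (b.hasSum_repr x).congr_fun' fun i => by rw [b.repr_apply_apply]

lemma hilbertBasis_hasSum_norm_sq (x : H) : HasSum (fun i => ‖inner ℂ (b i) x‖ ^ 2) (‖x‖ ^ 2) := by
  have h := Complex.hasSum_re (b.hasSum_inner_mul_inner x x)
  have e : (inner ℂ x x).re = ‖x‖ ^ 2 := (norm_sq_eq_re_inner (𝕜 := ℂ) x).symm
  rw [e] at h
  refine h.congr_fun' fun i => ?_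
  rw [← inner_conj_symm x (b i), ← Complex.normSq_eq_conj_mul_self, Complex.ofReal_re,
    Complex.normSq_eq_norm_sq]

lemma hilbertBasis_inner_ne {i j : ι} (h : i ≠ j) : inner ℂ (b i) (b j) = 0 :=
  b.orthonormal.2 h

lemma exists_diagCLM (m : ι → ℂ) (hm : ∀ i, ‖m i‖ ≤ 1) :
    ∃ T : H →L[ℂ] H, ∀ i x, inner ℂ (b i) (T x) = m i * inner ℂ (b i) x := by
  have hmem : ∀ x : H, Memℓp (fun i => m i * inner ℂ (b i) x) 2 := by
    intro x
    rw [memℓp_gen_iff (by norm_num)]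
    refine Summable.of_nonneg_of_le (fun i => by positivity) (fun i => ?_)
      (hilbertBasis_hasSum_norm_sq b x).summable
    rw [norm_mul]
    norm_num
    exact pow_le_pow_left₀ (by positivity)
      (mul_le_of_le_one_left (norm_nonneg _) (hm i)) 2
  set T₀ : H → H := fun x => b.repr.symm ⟨_, hmem x⟩ with hT₀
  have hT : ∀ i x, inner ℂ (b i) (T₀ x) = m i * inner ℂ (b i) x := by
    intro i x
    rw [← b.repr_apply_apply, hT₀, LinearIsometryEquiv.apply_symm_apply]
  let T₁ : H →ₗ[ℂ] H :=
    { toFun := T₀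
      map_add' := fun x y => hilbertBasis_ext b fun i => by
        simp only [inner_add_right, hT, mul_add]
      map_smul' := fun c x => hilbertBasis_ext b fun i => by
        simp only [inner_smul_right, hT, RingHom.id_apply]; ring }
  refine ⟨T₁.mkContinuous 1 fun x => ?_, fun i x => hT i x⟩
  rw [one_mul]
  refine le_of_sq_le_sq ?_ (norm_nonneg _)
  refine hasSum_le (fun i => ?_) (hilbertBasis_hasSum_norm_sq b _) (hilbertBasis_hasSum_norm_sq b x)
  rw [show inner ℂ (b i) (T₁ x) = m i * inner ℂ (b i) x from hT i x, norm_mul]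
  exact pow_le_pow_left₀ (by positivity) (mul_le_of_le_one_left (norm_nonneg _) (hm i)) 2

/-- Dominated convergence for the Parseval sum of the difference. Strong continuity and
differentiability of the semigroup both reduce to it. -/
lemma tendsto_of_coeff {α : Type*} {l : Filter α} {f : α → H} {g : H} {bound : ι → ℝ}
    (hb : Summable bound)
    (h1 : ∀ i, Tendsto (fun a => inner ℂ (b i) (f a)) l (𝓝 (inner ℂ (b i) g)))
    (h2 : ∀ᶠ a in l, ∀ i, ‖inner ℂ (b i) (f a) - inner ℂ (b i) g‖ ^ 2 ≤ bound i) :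
    Tendsto f l (𝓝 g) := by
  rw [tendsto_iff_norm_sub_tendsto_zero]
  have h3 : Tendsto (fun a => ∑' i, ‖inner ℂ (b i) (f a) - inner ℂ (b i) g‖ ^ 2) l
      (𝓝 (∑' _ : ι, (0 : ℝ))) := by
    refine tendsto_tsum_of_dominated_convergence hb (fun i => ?_) ?_
    · have := ((h1 i).sub_const (inner ℂ (b i) g)).norm.pow 2
      simpa using this
    · filter_upwards [h2] with a ha i
      rw [Real.norm_of_nonneg (by positivity)]
      exact ha i
  rw [tsum_zero] at h3
  have h4 : ∀ a, ∑' i, ‖inner ℂ (b i) (f a) - inner ℂ (b i) g‖ ^ 2 = ‖f a - g‖ ^ 2 := by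
    intro a
    rw [← (hilbertBasis_hasSum_norm_sq b (f a - g)).tsum_eq]
    simp only [inner_sub_right]
  simp only [h4] at h3
  have h5 := h3.sqrt
  simpa [Real.sqrt_sq] using h5

variable (lam : ι → ℝ)

/-- The graph of the diagonal operator with eigenvalues `lam`. -/
def diagGraph : Submodule ℂ (H × H) where
  carrier := {p | ∀ i, inner ℂ (b i) p.2 = lam i * inner ℂ (b i) p.1}
  add_mem' := by
    intro p q hp hq i
    simp only [Prod.fst_add, Prod.snd_add, inner_add_right, hp i, hq i, mul_add]
  zero_mem' := by simp
  smul_mem' := by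
    intro c p hp i
    simp only [Prod.smul_fst, Prod.smul_snd, inner_smul_right, hp i]
    ring

/-- The diagonal operator, with its maximal domain, with eigenvalues `lam`. -/
def diagOp : H →ₗ.[ℂ] H := (diagGraph b lam).toLinearPMap

lemma mem_diagGraph {p : H × H} :
    p ∈ diagGraph b lam ↔ ∀ i, inner ℂ (b i) p.2 = lam i * inner ℂ (b i) p.1 := Iff.rfl

lemma diagOp_graph : (diagOp b lam).graph = diagGraph b lam := by
  refine Submodule.toLinearPMap_graph_eq _ fun x hx h0 => hilbertBasis_ext b fun i => ?_
  rw [hx i, h0, inner_zero_right, mul_zero]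

lemma mem_diagOp_graph {x y : H} :
    (x, y) ∈ (diagOp b lam).graph ↔ ∀ i, inner ℂ (b i) y = lam i * inner ℂ (b i) x := by
  rw [diagOp_graph]; rfl

lemma basis_mem_diagGraph (i : ι) : (b i, (lam i : ℂ) • b i) ∈ diagGraph b lam := by
  intro j
  simp only [inner_smul_right]
  by_cases h : j = i
  · rw [h]
  · rw [hilbertBasis_inner_ne b h, mul_zero, mul_zero]

lemma isClosed_diagGraph : IsClosed (diagGraph b lam : Set (H × H)) := by
  have : (diagGraph b lam : Set (H × H)) =
      ⋂ i, {p | inner ℂ (b i) p.2 = lam i * inner ℂ (b i) p.1} := by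
    ext p; simp [mem_diagGraph]
  rw [this]
  exact isClosed_iInter fun i => isClosed_eq (by fun_prop) (by fun_prop)

/-- A subspace of the graph of a diagonal operator that contains the eigenvectors is dense in it. -/
lemma topologicalClosure_eq_diagGraph {G : Submodule ℂ (H × H)} (hG : G ≤ diagGraph b lam)
    (hb : ∀ i, (b i, (lam i : ℂ) • b i) ∈ G) : G.topologicalClosure = diagGraph b lam := by
  refine le_antisymm (G.topologicalClosure_minimal hG (isClosed_diagGraph b lam)) ?_
  rintro ⟨x, y⟩ hxy
  have h2 : HasSum (fun i => inner ℂ (b i) x • ((b i, (lam i : ℂ) • b i) : H × H)) (x, y) := by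
    refine ((hilbertBasis_hasSum b x).prodMk (hilbertBasis_hasSum b y)).congr_fun' fun i => ?_
    rw [hxy i, Prod.smul_mk, smul_smul, mul_comm]
  refine G.isClosed_topologicalClosure.mem_of_tendsto h2 (Eventually.of_forall fun s => ?_)
  exact G.le_topologicalClosure (Submodule.sum_mem _ fun i _ => Submodule.smul_mem _ _ (hb i))

lemma dense_domain_of_basis_mem {A : H →ₗ.[ℂ] H} (hb : ∀ i, ∃ y, (b i, y) ∈ A.graph) :
    Dense (A.domain : Set H) := by
  refine (Submodule.dense_iff_topologicalClosure_eq_top.2 b.dense_span).mono ?_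
  refine Submodule.span_le.2 ?_
  rintro _ ⟨i, rfl⟩
  obtain ⟨y, hy⟩ := hb i
  exact LinearPMap.mem_domain_of_mem_graph hy

/-- Testing against the eigenvectors gives one inclusion, Parseval's identity the other; the
eigenvalues are real. -/
lemma diagGraph_adjoint : (diagGraph b lam).adjoint = diagGraph b lam := by
  ext ⟨x, y⟩
  rw [Submodule.mem_adjoint_iff]
  constructor
  · intro h i
    have := h _ _ (basis_mem_diagGraph b lam i)
    rw [inner_smul_left, Complex.conj_ofReal] at this
    exact (sub_eq_zero.1 this).symm
  · intro h u v huv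
    rw [← b.tsum_inner_mul_inner v x, ← b.tsum_inner_mul_inner u y, sub_eq_zero]
    refine tsum_congr fun i => ?_
    have h1 : inner ℂ (b i) v = lam i * inner ℂ (b i) u := huv i
    have h2 : inner ℂ (b i) y = lam i * inner ℂ (b i) x := h i
    rw [h2, ← inner_conj_symm v, ← inner_conj_symm u, h1, map_mul, Complex.conj_ofReal]
    ring

variable [CompleteSpace H]

lemma diagOp_adjoint : (diagOp b lam)† = diagOp b lam := by
  apply LinearPMap.eq_of_eq_graph
  rw [LinearPMap.adjoint_graph_eq_graph_adjoint, diagOp_graph, diagGraph_adjoint]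
  refine dense_domain_of_basis_mem b fun i => ⟨(lam i : ℂ) • b i, ?_⟩
  rw [diagOp_graph]
  exact basis_mem_diagGraph b lam i

lemma graph_adjoint_eq_self {A : H →ₗ.[ℂ] H} (hA : IsSelfAdjoint A) : A.graph.adjoint = A.graph := by
  rw [← LinearPMap.adjoint_graph_eq_graph_adjoint hA.dense_domain]
  exact congrArg _ hA

/-- Symmetry against the eigenvectors puts `A` inside the diagonal operator. Both are self-adjoint,
and passing to adjoints reverses the inclusion. -/
lemma eq_diagOp_of_isSelfAdjoint {A : H →ₗ.[ℂ] H} (hA : IsSelfAdjoint A)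
    (hb : ∀ i, (b i, (lam i : ℂ) • b i) ∈ A.graph) : A = diagOp b lam := by
  apply LinearPMap.eq_of_eq_graph
  have hle : A.graph ≤ diagGraph b lam := by
    rintro ⟨x, y⟩ hxy i
    rw [← graph_adjoint_eq_self hA, Submodule.mem_adjoint_iff] at hxy
    have := hxy _ _ (hb i)
    rw [inner_smul_left, Complex.conj_ofReal] at this
    exact (sub_eq_zero.1 this).symm
  rw [diagOp_graph]
  refine le_antisymm hle ?_
  rintro ⟨x, y⟩ hxy
  rw [← diagGraph_adjoint, Submodule.mem_adjoint_iff] at hxy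
  rw [← graph_adjoint_eq_self hA, Submodule.mem_adjoint_iff]
  exact fun u v huv => hxy u v (hle huv)

/-! ### The absolute value of a diagonal operator -/

lemma isAbsoluteValue_diagOp : IsAbsoluteValue (diagOp b lam) (diagOp b fun i => |lam i|) where
  isSelfAdjoint := diagOp_adjoint b _
  nonneg := by
    rintro x
    have hx : ((x : H), diagOp b (fun i => |lam i|) x) ∈ (diagOp b fun i => |lam i|).graph :=
      LinearPMap.mem_graph _ x
    rw [mem_diagOp_graph] at hx
    have h := Complex.hasSum_re (b.hasSum_inner_mul_inner (diagOp b (fun i => |lam i|) x) x)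
    refine h.nonneg fun i => ?_
    rw [← inner_conj_symm _ (b i), hx i, map_mul, Complex.conj_ofReal, mul_assoc,
      ← Complex.normSq_eq_conj_mul_self, ← Complex.ofReal_mul, Complex.ofReal_re]
    exact mul_nonneg (abs_nonneg _) (Complex.normSq_nonneg _)
  sq_eq := by
    intro x z
    -- The sign operator of the diagonal operator: applied to the intermediate vector `y`, it turns
    -- a chain for `|lam|` into one for `lam` and back.
    obtain ⟨T, hT⟩ := exists_diagCLM b (fun i => if lam i < 0 then -1 else 1)
      (fun i => by split_ifs <;> simp)
    rw [diagOp_adjoint]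
    simp only [mem_diagOp_graph]
    constructor
    · rintro ⟨y, h1, h2⟩
      refine ⟨T y, fun i => ?_, fun i => ?_⟩
      · rw [hT, h1]
        split_ifs with h
        · rw [abs_of_neg h]; push_cast; ring
        · rw [abs_of_nonneg (not_lt.1 h)]; ring
      · rw [hT, h2]
        split_ifs with h
        · rw [abs_of_neg h]; push_cast; ring
        · rw [abs_of_nonneg (not_lt.1 h)]; ring
    · rintro ⟨y, h1, h2⟩
      refine ⟨T y, fun i => ?_, fun i => ?_⟩
      · rw [hT, h1]
        split_ifs with h
        · rw [abs_of_neg h]; push_cast; ring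
        · rw [abs_of_nonneg (not_lt.1 h)]; ring
      · rw [hT, h2]
        split_ifs with h
        · rw [abs_of_neg h]; push_cast; ring
        · rw [abs_of_nonneg (not_lt.1 h)]; ring

/-- Uniqueness of the non-negative square root, tested on an eigenvector. If `y = A b_i`, then `A y
= lam² b_i`, so `w = y - |lam| b_i` satisfies `A w = -|lam| w`, and positivity forces `w = 0` when
`lam ≠ 0`. When `lam = 0`, symmetry gives `‖y‖² = 0`. -/
lemma IsAbsoluteValue.eq_diagOp {A : H →ₗ.[ℂ] H} (hA : IsAbsoluteValue (diagOp b lam) A) :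
    A = diagOp b fun i => |lam i| := by
  refine eq_diagOp_of_isSelfAdjoint b _ hA.isSelfAdjoint fun i => ?_
  have hb := basis_mem_diagGraph b lam i
  rw [← diagOp_graph] at hb
  obtain ⟨y, h1, h2⟩ := (hA.sq_eq (b i) ((lam i : ℂ) • (lam i : ℂ) • b i)).2
    ⟨(lam i : ℂ) • b i, hb, by rw [diagOp_adjoint]; exact Submodule.smul_mem _ (lam i : ℂ) hb⟩
  set m : ℂ := ((|lam i| : ℝ) : ℂ) with hm
  have hmm : m * m = lam i * lam i := by
    rw [hm, ← Complex.ofReal_mul, abs_mul_abs_self, Complex.ofReal_mul]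
  have hw : (y - m • b i, -(m • (y - m • b i))) ∈ A.graph := by
    have := A.graph.sub_mem h2 (A.graph.smul_mem m h1)
    convert this using 1
    simp only [Prod.smul_mk, Prod.mk_sub_mk, smul_smul, smul_sub, hmm]
    rw [neg_sub]
  have key : y - m • b i = 0 := by
    rcases eq_or_ne (lam i) 0 with h0 | h0
    · have hm0 : m = 0 := by rw [hm, h0]; simp
      rw [hm0, zero_smul, sub_zero]
      rw [h0, Complex.ofReal_zero, zero_smul] at h2
      rw [← graph_adjoint_eq_self hA.isSelfAdjoint, Submodule.mem_adjoint_iff] at h2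
      have := h2 _ _ h1
      simpa using this
    · obtain ⟨w, hw1, hw2⟩ := (LinearPMap.mem_graph_iff _).1 hw
      have hn := hA.nonneg w
      simp only at hw1 hw2
      rw [hw1, hw2, inner_neg_left, inner_smul_left, inner_self_eq_norm_sq_to_K] at hn
      rw [hm, Complex.conj_ofReal] at hn
      have h3 : 0 < |lam i| := abs_pos.2 h0
      have h4 : |lam i| * ‖y - m • b i‖ ^ 2 ≤ 0 := by
        have e : RCLike.re (-(((|lam i| : ℝ) : ℂ) * ((‖y - m • b i‖ : ℝ) : ℂ) ^ 2))
            = -(|lam i| * ‖y - m • b i‖ ^ 2) := by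
          rw [← Complex.ofReal_pow, ← Complex.ofReal_mul, ← Complex.ofReal_neg]
          exact Complex.ofReal_re _
        have h5 := e ▸ hn
        linarith
      have h5 : ‖y - m • b i‖ ^ 2 ≤ 0 := by
        by_contra! h
        exact absurd h4 (not_le.2 (mul_pos h3 h))
      have : ‖y - m • b i‖ = 0 := by
        have := sq_nonneg ‖y - m • b i‖
        exact pow_eq_zero_iff two_ne_zero |>.1 (le_antisymm h5 this)
      exact norm_eq_zero.1 this
  rw [sub_eq_zero] at key
  rwa [key] at h1

end Diagonal

end SphereDirac

end

noncomputable section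

namespace SphereDirac

/-! ### The heat semigroup of a diagonal operator -/

section Diagonal

variable {H : Type} [NormedAddCommGroup H] [InnerProductSpace ℂ H] {ι : Type}
  (b : HilbertBasis ι ℂ H) {lam : ι → ℝ}

lemma exists_diag_heat (hlam : ∀ i, 0 ≤ lam i) :
    ∃ T : ℝ → H →L[ℂ] H, ∀ t, 0 ≤ t → ∀ i x,
      inner ℂ (b i) (T t x) = (Real.exp (-lam i * t) : ℂ) * inner ℂ (b i) x := by
  have h : ∀ t : ℝ, ∃ T : H →L[ℂ] H, 0 ≤ t → ∀ i x,
      inner ℂ (b i) (T x) = (Real.exp (-lam i * t) : ℂ) * inner ℂ (b i) x := by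
    intro t
    by_cases ht : 0 ≤ t
    · obtain ⟨T, hT⟩ := exists_diagCLM b (fun i => (Real.exp (-lam i * t) : ℂ)) fun i => by
        rw [Complex.norm_real, Real.norm_eq_abs, abs_of_pos (Real.exp_pos _)]
        exact Real.exp_le_one_iff.2 (by nlinarith [hlam i])
      exact ⟨T, fun _ => hT⟩
    -- Nothing is asked at negative times; `0` is a filler.
    · exact ⟨0, fun h => absurd h ht⟩
  choose T hT using h
  exact ⟨T, hT⟩

/-- The bound, uniform in `t`, that dominates the difference quotients of the semigroup at `0`. -/
lemma norm_exp_sub_one_div_le {m t : ℝ} (hm : 0 ≤ m) (ht : 0 < t) :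
    |(Real.exp (-m * t) - 1) / t| ≤ m := by
  have h1 : Real.exp (-m * t) ≤ 1 := Real.exp_le_one_iff.2 (by nlinarith)
  have h2 := Real.add_one_le_exp (-m * t)
  rw [abs_div, abs_of_pos ht, div_le_iff₀ ht, abs_le]
  constructor <;> nlinarith

lemma hasDerivAt_exp_neg_mul (m : ℝ) (z : ℂ) :
    HasDerivAt (fun t : ℝ => (Real.exp (-m * t) : ℂ) * z) (-(m * z)) 0 := by
  have h1 : HasDerivAt (fun t : ℝ => Real.exp (-m * t)) (-m) 0 := by
    have := ((hasDerivAt_id (0 : ℝ)).const_mul (-m)).exp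
    simpa using this
  have := h1.ofReal_comp.mul_const z
  simpa using this

lemma isHeatSemigroup_diagOp (hlam : ∀ i, 0 ≤ lam i) {T : ℝ → H →L[ℂ] H}
    (hT : ∀ t, 0 ≤ t → ∀ i x,
      inner ℂ (b i) (T t x) = (Real.exp (-lam i * t) : ℂ) * inner ℂ (b i) x) :
    IsHeatSemigroup (diagOp b lam) T where
  zero := by
    ext x
    refine hilbertBasis_ext b fun i => ?_
    rw [hT 0 le_rfl]; simp
  add := by
    intro s t hs ht
    ext x
    refine hilbertBasis_ext b fun i => ?_
    rw [hT _ (add_nonneg hs ht), mul_apply_eq_comp, hT s hs, hT t ht, ← mul_assoc,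
      ← Complex.ofReal_mul, ← Real.exp_add, mul_add]
  continuousOn := by
    intro x t ht
    refine tendsto_of_coeff b (bound := fun i => 4 * ‖inner ℂ (b i) x‖ ^ 2)
      ((hilbertBasis_hasSum_norm_sq b x).summable.mul_left 4) (fun i => ?_) ?_
    · rw [hT t ht]
      have hc : Continuous fun s : ℝ => (Real.exp (-lam i * s) : ℂ) * inner ℂ (b i) x := by
        fun_prop
      refine ((hc.tendsto t).mono_left nhdsWithin_le_nhds).congr' ?_
      filter_upwards [self_mem_nhdsWithin] with s hs
      rw [hT s hs]
    · filter_upwards [self_mem_nhdsWithin] with s hs i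
      rw [hT s hs, hT t ht, ← sub_mul, norm_mul, mul_pow]
      refine mul_le_mul_of_nonneg_right ?_ (by positivity)
      rw [← Complex.ofReal_sub, Complex.norm_real, Real.norm_eq_abs, sq_abs]
      have h1 : Real.exp (-lam i * s) ≤ 1 :=
        Real.exp_le_one_iff.2 (by nlinarith [hlam i, Set.mem_Ici.1 hs])
      have h2 : Real.exp (-lam i * t) ≤ 1 :=
        Real.exp_le_one_iff.2 (by nlinarith [hlam i, Set.mem_Ici.1 ht])
      nlinarith [Real.exp_pos (-lam i * s), Real.exp_pos (-lam i * t)]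
  generator := by
    intro x y
    rw [mem_diagOp_graph]
    constructor
    · intro hxy
      rw [hasDerivWithinAt_iff_tendsto_slope]
      -- The factor `4` is the square of `2`: the coefficient of the error is `(e^{-λt} - 1)/t + λ`,
      -- at most `2λ`, times that of `x`, and `λ` times the latter is the coefficient of `y`.
      refine tendsto_of_coeff b (bound := fun i => 4 * ‖inner ℂ (b i) y‖ ^ 2)
        ((hilbertBasis_hasSum_norm_sq b y).summable.mul_left 4) (fun i => ?_) ?_
      · have h := (hasDerivAt_exp_neg_mul (lam i) (inner ℂ (b i) x)).hasDerivWithinAt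
          (s := Set.Ici 0)
        rw [hasDerivWithinAt_iff_tendsto_slope, ← hxy, ← inner_neg_right] at h
        refine h.congr' ?_
        filter_upwards [self_mem_nhdsWithin] with t ht
        rw [slope_def_module, slope_def_module, inner_smul_right_eq_smul, inner_sub_right,
          hT t ht.1, hT 0 le_rfl]
      · filter_upwards [self_mem_nhdsWithin] with t ht i
        have ht0 : 0 < t := lt_of_le_of_ne ht.1 (Ne.symm ht.2)
        rw [slope_def_module, inner_smul_right_eq_smul, inner_sub_right, hT t ht.1, hT 0 le_rfl,
          inner_neg_right, hxy i]
        have e : ((t - 0)⁻¹ : ℝ) • ((Real.exp (-lam i * t) : ℂ) * inner ℂ (b i) x -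
            (Real.exp (-lam i * 0) : ℂ) * inner ℂ (b i) x) - -((lam i : ℂ) * inner ℂ (b i) x)
            = (((Real.exp (-lam i * t) - 1) / t + lam i : ℝ) : ℂ) * inner ℂ (b i) x := by
          rw [Complex.real_smul, mul_zero, Real.exp_zero, sub_zero]
          push_cast
          ring
        rw [e, norm_mul, norm_mul, mul_pow, mul_pow, Complex.norm_real, Complex.norm_real,
          Real.norm_eq_abs, Real.norm_eq_abs, ← mul_assoc]
        refine mul_le_mul_of_nonneg_right ?_ (by positivity)
        have h1 := norm_exp_sub_one_div_le (hlam i) ht0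
        rw [sq_abs, sq_abs]
        rw [abs_le] at h1
        nlinarith [hlam i]
    · intro h i
      have h1 : HasDerivWithinAt (fun t => inner ℂ (b i) (T t x)) (inner ℂ (b i) (-y))
          (Set.Ici 0) 0 :=
        ((innerSL ℂ (b i)).restrictScalars ℝ).hasFDerivAt.comp_hasDerivWithinAt 0 h
      have h2 := (hasDerivAt_exp_neg_mul (lam i) (inner ℂ (b i) x)).hasDerivWithinAt
        (s := Set.Ici 0)
      have h3 := h2.congr (f₁ := fun t => inner ℂ (b i) (T t x)) (fun t ht => hT t ht i x)
        (hT 0 le_rfl i x)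
      have h4 := (uniqueDiffWithinAt_Ici (0 : ℝ)).eq_deriv _ h1 h3
      rw [inner_neg_right] at h4
      exact neg_injective h4

/-- Any semigroup with this generator acts on an eigenvector by the exponential, because `e^{λr} T_r
b_i` has vanishing right derivative and is constant. -/
lemma IsHeatSemigroup.apply_basis {T : ℝ → H →L[ℂ] H} (hT : IsHeatSemigroup (diagOp b lam) T)
    {t : ℝ} (ht : 0 ≤ t) (i : ι) : T t (b i) = (Real.exp (-lam i * t) : ℂ) • b i := by
  have hb := basis_mem_diagGraph b lam i
  rw [← diagOp_graph, hT.generator] at hb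
  -- The generator gives the right derivative at `0` only; the law `T r = T s * T (r - s)`
  -- transports it to `s`.
  have hder : ∀ s, 0 ≤ s → HasDerivWithinAt (fun r => T r (b i)) (-((lam i : ℂ) • T s (b i)))
      (Set.Ici s) s := by
    intro s hs
    have h0 : HasDerivWithinAt (fun r => T r (b i)) (-((lam i : ℂ) • b i)) (Set.Ici 0)
        ((fun r => r - s) s) := by
      change HasDerivWithinAt _ _ _ (s - s)
      rw [sub_self]; exact hb
    have hsub : HasDerivWithinAt (fun r : ℝ => r - s) 1 (Set.Ici s) s :=
      (hasDerivWithinAt_id s _).sub_const s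
    have h1 := HasDerivWithinAt.scomp (h := fun r => r - s) s h0 hsub (fun r (hr : s ≤ r) => sub_nonneg.2 hr)
    have h2 := ((T s).restrictScalars ℝ).hasFDerivAt.comp_hasDerivWithinAt s h1
    have h3 : ((T s).restrictScalars ℝ) ((1 : ℝ) • -((lam i : ℂ) • b i))
        = -((lam i : ℂ) • T s (b i)) := by simp
    rw [h3] at h2
    refine h2.congr (fun r hr => ?_) ?_
    · have := hT.add s (r - s) hs (sub_nonneg.2 hr)
      rw [add_sub_cancel] at this
      simp [this]
    · simp [hT.zero]
  have hconst := constant_of_has_deriv_right_zero (a := 0) (b := t)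
    (f := fun r => (Real.exp (lam i * r) : ℂ) • T r (b i)) ?_ ?_ t ⟨ht, le_rfl⟩
  · simp only [mul_zero, Real.exp_zero, Complex.ofReal_one, one_smul, hT.zero,
      one_apply_eq_self] at hconst
    nth_rewrite 2 [← hconst]
    rw [smul_smul, ← Complex.ofReal_mul, ← Real.exp_add, neg_mul, neg_add_cancel, Real.exp_zero,
      Complex.ofReal_one, one_smul]
  · refine ContinuousOn.smul (by fun_prop) ((hT.continuousOn (b i)).mono Set.Icc_subset_Ici_self)
  · intro s hs
    have he : HasDerivWithinAt (fun r : ℝ => (Real.exp (lam i * r) : ℂ))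
        ((Real.exp (lam i * s) * lam i : ℝ) : ℂ) (Set.Ici s) s := by
      have := (((hasDerivAt_id s).const_mul (lam i)).exp).ofReal_comp
      simpa using this.hasDerivWithinAt
    have h := he.smul (hder s hs.1)
    have e : (Real.exp (lam i * s) : ℂ) • -((lam i : ℂ) • T s (b i)) +
        ((Real.exp (lam i * s) * lam i : ℝ) : ℂ) • T s (b i) = 0 := by
      rw [smul_neg, smul_smul, Complex.ofReal_mul, neg_add_cancel]
    rw [e] at h
    exact h

/-- The trace does not depend on the basis: the non-negative double series with terms `w_i ‖⟪c_j,
b_i⟫‖²` is summed in both orders, with Parseval for the inner sum over `j`. -/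
lemma hasTrace_of_diag {T : H →L[ℂ] H} {w : ι → ℝ} {W : ℝ} (hw : ∀ i, 0 ≤ w i) (hW : HasSum w W)
    (hT : ∀ i, T (b i) = (w i : ℂ) • b i) : HasTrace T (W : ℂ) := by
  intro κ c
  have hsum : HasSum (fun p : ι × κ => w p.1 * ‖inner ℂ (c p.2) (b p.1)‖ ^ 2) W := by
    have h1 : ∀ i, HasSum (fun j => w i * ‖inner ℂ (c j) (b i)‖ ^ 2) (w i) := by
      intro i
      have := (hilbertBasis_hasSum_norm_sq c (b i)).mul_left (w i)
      rwa [b.orthonormal.1 i, one_pow, mul_one] at this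
    have hs : Summable fun p : ι × κ => w p.1 * ‖inner ℂ (c p.2) (b p.1)‖ ^ 2 := by
      refine (summable_prod_of_nonneg fun p => mul_nonneg (hw _) (by positivity)).2
        ⟨fun i => (h1 i).summable, ?_⟩
      refine hW.summable.congr fun i => ?_
      exact ((h1 i).tsum_eq).symm
    have h2 := hs.hasSum.prod_fiberwise h1
    rw [hW.unique h2]
    exact hs.hasSum
  have hsw : HasSum (fun p : κ × ι => ((w p.2 * ‖inner ℂ (c p.1) (b p.2)‖ ^ 2 : ℝ) : ℂ)) (W : ℂ) :=
    Complex.hasSum_ofReal.2 ((Equiv.prodComm κ ι).hasSum_iff.2 hsum)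
  refine hsw.prod_fiberwise fun j => ?_
  have h1 := (hilbertBasis_hasSum b (c j)).mapL T
  have h2 := h1.mapL (innerSL ℂ (c j))
  refine h2.congr_fun' fun i => ?_
  rw [map_smul, map_smul, hT, map_smul, innerSL_apply_apply, smul_eq_mul, smul_eq_mul,
    ← inner_conj_symm (b i) (c j)]
  push_cast
  rw [← Complex.conj_mul']
  ring

/-- An eigenvector for `m` has zero coefficients at all indices with another eigenvalue, so the
`b_i` with `lam i = m` span the kernel. -/
lemma multiplicity_diagOp (m : ℝ) [Finite {i // lam i = m}] :
    multiplicity (diagOp b lam) m = Nat.card {i // lam i = m} := by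
  classical
  have : Fintype {i // lam i = m} := Fintype.ofFinite _
  set A := diagOp b lam
  set K := LinearMap.ker (A.toFun - (m : ℂ) • A.domain.subtype) with hK
  have hmap : K.map A.domain.subtype = Submodule.span ℂ (Set.range fun i : {i // lam i = m} => b i) := by
    ext x
    simp only [Submodule.mem_map, hK, LinearMap.mem_ker, LinearMap.sub_apply, LinearMap.smul_apply,
      Submodule.subtype_apply, sub_eq_zero]
    have hg : ∀ x y, (x, y) ∈ A.graph ↔ ∀ i, inner ℂ (b i) y = lam i * inner ℂ (b i) x :=
      fun x y => mem_diagOp_graph b lam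
    constructor
    · rintro ⟨x, hx, rfl⟩
      have h1 := (hg _ _).1 (LinearPMap.mem_graph A x)
      have h0 : ∀ i, lam i ≠ m → inner ℂ (b i) (x : H) = 0 := by
        intro i hi
        have h2 := h1 i
        rw [show A x = (m : ℂ) • (x : H) from hx, inner_smul_right] at h2
        have h3 : ((lam i : ℂ) - m) * inner ℂ (b i) (x : H) = 0 := by rw [sub_mul, h2, sub_self]
        refine (mul_eq_zero.1 h3).resolve_left fun h => hi ?_
        exact_mod_cast sub_eq_zero.1 h
      have hfin : {i | lam i = m}.Finite := ‹Finite {i // lam i = m}›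
      have h4 := hilbertBasis_hasSum b (x : H)
      have h5 : HasSum (fun i => inner ℂ (b i) (x : H) • b i)
          (∑ i ∈ hfin.toFinset, inner ℂ (b i) (x : H) • b i) := by
        refine hasSum_sum_of_ne_finset_zero fun i hi => ?_
        rw [h0 i (by simpa using hi), zero_smul]
      change (x : H) ∈ _
      rw [h4.unique h5]
      refine Submodule.sum_mem _ fun i hi => Submodule.smul_mem _ _ (Submodule.subset_span ?_)
      exact ⟨⟨i, by simpa using hi⟩, rfl⟩
    · intro hx
      have h1 : (x, (m : ℂ) • x) ∈ A.graph := by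
        rw [hg]
        intro i
        rw [inner_smul_right]
        by_cases hi : lam i = m
        · rw [hi]
        · have : inner ℂ (b i) x = 0 := by
            refine Submodule.span_induction (p := fun x _ => inner ℂ (b i) x = 0) ?_ ?_ ?_ ?_ hx
            · rintro _ ⟨j, rfl⟩
              refine hilbertBasis_inner_ne b fun h => hi ?_
              rw [h]; exact j.2
            · exact inner_zero_right _
            · intro u v _ _ hu hv
              rw [inner_add_right, hu, hv, add_zero]
            · intro c u _ hu
              rw [inner_smul_right, hu, mul_zero]
          rw [this, mul_zero, mul_zero]
      obtain ⟨u, hu1, hu2⟩ := (LinearPMap.mem_graph_iff _).1 h1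
      simp only at hu1 hu2
      refine ⟨u, ?_, hu1⟩
      rw [show A.toFun u = (m : ℂ) • x from hu2, hu1]
  have h1 : multiplicity A m = Module.finrank ℂ K := rfl
  rw [h1, (Submodule.equivMapOfInjective A.domain.subtype A.domain.injective_subtype K).finrank_eq,
    hmap, finrank_span_eq_card, Nat.card_eq_fintype_card]
  exact b.orthonormal.linearIndependent.comp _ Subtype.val_injective

end Diagonal

end SphereDirac

end

noncomputable section

namespace SphereDirac

/-! ### Zeta function and heat trace of a diagonal operator with equidistant eigenvalues -/

/-- The values `0` and `k + θ` taken by the eigenvalues of the absolute value. -/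
def spectralValue (θ : ℝ) : Option ℕ → ℝ
  | none => 0
  | some k => k + θ

lemma spectralValue_injective {θ : ℝ} (hθ : 0 < θ) : Function.Injective (spectralValue θ) := by
  rintro (_ | k) (_ | l) h
  · rfl
  · have : (0 : ℝ) ≤ l := l.cast_nonneg
    simp only [spectralValue] at h; linarith
  · have : (0 : ℝ) ≤ k := k.cast_nonneg
    simp only [spectralValue] at h; linarith
  · simp only [spectralValue, add_left_inj, Nat.cast_inj] at h
    rw [h]

lemma hasSum_option {f : Option ℕ → ℝ} {x : ℝ} (h : HasSum (fun k => f (some k)) x) :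
    HasSum f (f none + x) := by
  have h1 : HasSum (fun o : Option ℕ => if o = none then f none else 0) (f none) :=
    hasSum_ite_eq none (f none)
  have h2 : HasSum (fun o : Option ℕ => if o = none then 0 else f o) x := by
    rw [← (Option.some_injective ℕ).hasSum_iff]
    · exact h.congr_fun' fun k => by simp
    · rintro (_ | k) hk
      · simp
      · exact absurd ⟨k, rfl⟩ hk
  refine (h1.add h2).congr_fun' fun o => ?_
  by_cases ho : o = none <;> simp [ho]

lemma hasSum_fiberwise {ι κ : Type*} {f : ι → κ} {n : κ → ℕ} [∀ k, Finite {i // f i = k}]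
    (hn : ∀ k, Nat.card {i // f i = k} = n k) {g : κ → ℝ} (hg : ∀ k, 0 ≤ g k) {x : ℝ}
    (h : HasSum (fun k => n k * g k) x) : HasSum (fun i => g (f i)) x := by
  rw [← (Equiv.sigmaFiberEquiv f).hasSum_iff]
  have hf : ∀ k, HasSum (fun c : {i // f i = k} =>
      ((fun i => g (f i)) ∘ (Equiv.sigmaFiberEquiv f)) ⟨k, c⟩) (n k * g k) := by
    intro k
    have : Fintype {i // f i = k} := Fintype.ofFinite _
    have h1 := hasSum_fintype (fun _ : {i // f i = k} => g k)
    rw [Finset.sum_const, nsmul_eq_mul, Finset.card_univ, ← Nat.card_eq_fintype_card, hn] at h1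
    refine h1.congr_fun' fun c => ?_
    simp [Equiv.sigmaFiberEquiv, c.2]
  refine h.sigma_of_hasSum hf ?_
  refine (summable_sigma_of_nonneg fun p => hg _).2 ⟨fun k => (hf k).summable, ?_⟩
  exact h.summable.congr fun k => ((hf k).tsum_eq).symm

variable {H : Type} [NormedAddCommGroup H] [InnerProductSpace ℂ H] [CompleteSpace H] {ι : Type}

/-- Here the geometry has disappeared: only the values `|lam i|` and their multiplicities enter. The
label `none` marks the kernel, which adds a constant to the heat trace and is invisible to the zeta
function. -/
theorem exists_heat_zeta_diagOp (b : HilbertBasis ι ℂ H) (lam : ι → ℝ) {d : ℕ} (hd : 1 ≤ d)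
    {θ : ℝ} (hθ : 0 < θ) (c : ℝ) (f : ι → Option ℕ) (hf : ∀ i, |lam i| = spectralValue θ (f i))
    [∀ k, Finite {i // f i = k}]
    (hn : ∀ k : ℕ, (Nat.card {i // f i = some k} : ℝ) = c * ((k + (d - 1)).choose (d - 1) : ℝ)) :
    (∃ (A : H →ₗ.[ℂ] H) (T : ℝ → H →L[ℂ] H),
      IsAbsoluteValue (diagOp b lam) A ∧ IsHeatSemigroup A T) ∧
    ∀ (A : H →ₗ.[ℂ] H) (T : ℝ → H →L[ℂ] H),
      IsAbsoluteValue (diagOp b lam) A → IsHeatSemigroup A T →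
      ∃ (heat : ℝ → ℝ) (ζ : ℂ → ℂ) (a : ℕ → ℝ),
        (∀ t : ℝ, 0 < t → HasTrace (T t) (heat t : ℂ)) ∧
        (∀ s : ℂ, (d : ℝ) < s.re →
          HasSum (fun μ : {μ : ℝ // 0 < μ} => (multiplicity A μ : ℂ) * ((μ : ℝ) : ℂ) ^ (-s))
            (ζ s)) ∧
        MeromorphicOn ζ Set.univ ∧
        (∀ s : ℂ, (∀ k : ℕ, s ≠ (d : ℂ) - k) → AnalyticAt ℂ ζ s) ∧
        (∀ k : ℕ, Tendsto (fun s : ℂ => (s - ((d : ℂ) - k)) * (Complex.Gamma s * ζ s))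
          (𝓝[≠] ((d : ℂ) - k)) (𝓝 (a k : ℂ))) ∧
        (∀ N : ℕ, (fun t : ℝ => heat t - multiplicity A 0 -
            ∑ k ∈ Finset.range N, a k * t ^ ((k : ℤ) - (d : ℤ)))
          =O[𝓝[>] 0] fun t : ℝ => t ^ ((N : ℤ) - (d : ℤ))) ∧
        HasSumLocallyUniformlyOn (fun (k : ℕ) (t : ℝ) => a k * t ^ ((k : ℤ) - (d : ℤ)))
          (fun t => heat t - multiplicity A 0) (Set.Ioo 0 (2 * Real.pi)) := by
  have habs : ∀ i, 0 ≤ |lam i| := fun i => abs_nonneg _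
  constructor
  · obtain ⟨T, hT⟩ := exists_diag_heat b habs
    exact ⟨_, T, isAbsoluteValue_diagOp b lam, isHeatSemigroup_diagOp b habs hT⟩
  · intro A T hA hT
    obtain rfl := hA.eq_diagOp
    obtain ⟨ζ, a, h1, h2, h3, h4, h5, h6⟩ := exists_zeta_expansion hd hθ c
    have hset : ∀ o, {i // |lam i| = spectralValue θ o} ≃ {i // f i = o} := fun o =>
      Equiv.subtypeEquivRight fun i => by rw [hf, (spectralValue_injective hθ).eq_iff]
    have hmult : ∀ o, multiplicity (diagOp b fun i => |lam i|) (spectralValue θ o)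
        = Nat.card {i // f i = o} := by
      intro o
      have : Finite {i // |lam i| = spectralValue θ o} := Finite.of_equiv _ (hset o).symm
      rw [multiplicity_diagOp, Nat.card_congr (hset o)]
    have hmult0 : multiplicity (diagOp b fun i => |lam i|) 0 = Nat.card {i // f i = none} :=
      hmult none
    refine ⟨fun t => (Nat.card {i // f i = none} : ℝ) + heatSum d θ c t, ζ, a, ?_, ?_, h2, h3, h4,
      ?_, ?_⟩
    · intro t ht
      refine hasTrace_of_diag b (w := fun i => Real.exp (-|lam i| * t))
        (fun i => (Real.exp_pos _).le) ?_ fun i => hT.apply_basis b ht.le i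
      simp only [hf]
      refine hasSum_fiberwise (f := f) (n := fun o => Nat.card {i // f i = o}) (fun _ => rfl)
        (g := fun o => Real.exp (-spectralValue θ o * t)) (fun o => (Real.exp_pos _).le) ?_
      have h7 := hasSum_option (f := fun o => (Nat.card {i // f i = o} : ℝ) *
        Real.exp (-spectralValue θ o * t)) (x := heatSum d θ c t) ?_
      · simpa [spectralValue] using h7
      · refine (hasSum_heatSum hd θ c ht).congr_fun' fun k => ?_
        rw [hn, spectralValue]
    · intro s hs
      have hinj : Function.Injective (fun k : ℕ => (⟨k + θ, by positivity⟩ : {μ : ℝ // 0 < μ})) := by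
        intro k l hkl
        simpa using hkl
      rw [← hinj.hasSum_iff]
      · refine (h1 s hs).congr_fun' fun k => ?_
        have : multiplicity (diagOp b fun i => |lam i|) (k + θ) = Nat.card {i // f i = some k} :=
          hmult (some k)
        simp only [Function.comp_apply, this]
        rw [← hn, Complex.ofReal_natCast]
      -- Positive reals not of the form `k + θ` have multiplicity zero, so the sum over all `μ > 0`
      -- collapses to a sum over `k`.
      · rintro ⟨m, hm⟩ hmr
        have hempty : IsEmpty {i // |lam i| = m} := by
          refine ⟨fun i => ?_⟩
          have := i.2
          rw [hf] at this
          rcases ho : f i with _ | k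
          · rw [ho, spectralValue] at this
            exact hm.ne this
          · rw [ho, spectralValue] at this
            exact hmr ⟨k, Subtype.ext this⟩
        have : multiplicity (diagOp b fun i => |lam i|) m = 0 := by
          rw [multiplicity_diagOp, Nat.card_of_isEmpty]
        simp [this]
    · intro N
      rw [hmult0]
      refine (h5 N).congr_left fun t => ?_
      ring
    · rw [hmult0]
      simpa only [add_sub_cancel_left] using h6

end SphereDirac

end

noncomputable section

namespace SphereDirac

/-! ### The square of the spherical Dirac operator -/

section WeylClifford

variable {R σ : Type*} [Ring R] [Fintype σ] [DecidableEq σ] {x D : σ → R} {b : σ → σ → R}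

/-- Positions `x`, derivatives `D` and even Clifford products `b i j` of generators of square `-1`. -/
structure IsWeylClifford (x D : σ → R) (b : σ → σ → R) : Prop where
  xx : ∀ i j, x i * x j = x j * x i
  DD : ∀ i j, D i * D j = D j * D i
  Dx : ∀ i j, D i * x j = x j * D i + if i = j then 1 else 0
  bx : ∀ i j k, b i j * x k = x k * b i j
  bD : ∀ i j k, b i j * D k = D k * b i j
  mid : ∀ i j k, b i j * b j k = -b i k
  anti : ∀ i j, b i j + b j i = if i = j then -2 else 0
  swap : ∀ i j k l, b i j * b k l = -(b i k * b j l) - if j = k then 2 * b i l else 0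

/-- The products `y_i y_j` are symmetric, so only the symmetric part of `b`, minus the identity on
the diagonal, contributes. Symmetrising doubles the sum, hence the hypothesis on `2`. -/
lemma sum_symm_mul_clifford (h : IsWeylClifford x D b) {y : σ → R}
    (hy : ∀ i j, y i * y j = y j * y i) (h2 : ∀ a : R, 2 * a = 0 → a = 0) :
    ∑ i, ∑ j, y i * y j * b i j = -∑ i, y i * y i := by
  rw [← sub_eq_zero, sub_neg_eq_add]
  apply h2
  have h1 : ∑ i, ∑ j, y i * y j * b i j = ∑ i, ∑ j, y i * y j * b j i := by
    rw [Finset.sum_comm]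
    exact Finset.sum_congr rfl fun i _ => Finset.sum_congr rfl fun j _ => by rw [hy j i]
  have h3 : ∑ i, ∑ j, (y i * y j * b i j + y i * y j * b j i) = -(2 * ∑ i, y i * y i) := by
    simp only [← mul_add, h.anti, mul_ite, mul_zero, Finset.sum_ite_eq, Finset.mem_univ, if_true]
    rw [← Finset.sum_mul, mul_neg, mul_two, two_mul]
  rw [mul_add, two_mul]
  nth_rewrite 2 [h1]
  rw [← Finset.sum_add_distrib]
  simp only [← Finset.sum_add_distrib]
  rw [h3, neg_add_cancel]

/-- Each derivative lowers the degree by one. -/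
lemma deriv_euler (h : IsWeylClifford x D b) (j : σ) :
    (∑ i, x i * D i) * D j = D j * (∑ i, x i * D i) - D j := by
  rw [Finset.sum_mul, Finset.mul_sum, eq_sub_iff_add_eq]
  have : ∀ i, D j * (x i * D i) = x i * D i * D j + if j = i then D i else 0 := by
    intro i
    rw [← mul_assoc, h.Dx, add_mul, mul_assoc, h.DD j i, mul_assoc]
    split_ifs <;> simp
  simp only [this, Finset.sum_add_distrib, Finset.sum_ite_eq, Finset.mem_univ, if_true]

/-- `X² + 2 X E + (n - 2) X = - r² Δ` for `X = ∑ x i * D j * b i j` and the Euler operator `E`. -/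
theorem sq_weylClifford (h : IsWeylClifford x D b) (h2 : ∀ a : R, 2 * a = 0 → a = 0) :
    (∑ i, ∑ j, x i * D j * b i j) * (∑ i, ∑ j, x i * D j * b i j) +
      2 * ((∑ i, ∑ j, x i * D j * b i j) * ∑ i, x i * D i) +
      (Fintype.card σ : R) * (∑ i, ∑ j, x i * D j * b i j) - 2 * (∑ i, ∑ j, x i * D j * b i j) =
    -((∑ i, x i * x i) * ∑ i, D i * D i) := by
  -- Commuting `D j` past `x k` leaves a first-order term when `j = k`. Exchanging the two middle
  -- Clifford indices pairs position with position and derivative with derivative, at the cost of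
  -- another term for `j = k`.
  have hterm : ∀ i j k l, x i * D j * b i j * (x k * D l * b k l) =
      -((x i * x k * b i k) * (D j * D l * b j l)) -
      (if j = k then 2 * (x i * x j * (D j * D l) * b i l) else 0) -
      (if j = k then x i * D l * b i l else 0) := by
    intro i j k l
    have e1 : x i * D j * b i j * (x k * D l * b k l) =
        x i * (D j * x k) * D l * (b i j * b k l) := by
      rw [mul_assoc (x k), ← mul_assoc (x i * D j * b i j), mul_assoc (x i * D j) (b i j), h.bx,
        mul_assoc _ _ (D l * b k l), mul_assoc (x k), ← mul_assoc (b i j) (D l), h.bD]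
      simp only [mul_assoc]
    have e2 : (x i * x k * b i k) * (D j * D l * b j l) =
        x i * x k * (D j * D l) * (b i k * b j l) := by
      rw [mul_assoc (D j), mul_assoc _ (b i k), ← mul_assoc (b i k), h.bD, mul_assoc (D j),
        ← mul_assoc (b i k), h.bD]
      simp only [mul_assoc]
    rw [e1, e2, h.Dx]
    by_cases hjk : j = k
    · subst hjk
      simp only [if_true]
      have e3 : b i j * b j l = -(b i j * b j l) - 2 * b i l := by simpa using h.swap i j j l
      rw [mul_add, add_mul, add_mul, mul_one, h.mid i j l]
      nth_rewrite 1 [← h.mid i j l]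
      rw [e3, h.mid]
      noncomm_ring
    · simp only [hjk, if_false, add_zero, sub_zero]
      rw [h.swap i j k l]
      simp only [hjk, if_false, sub_zero]
      noncomm_ring
  have hsum : (∑ i, ∑ j, x i * D j * b i j) * (∑ i, ∑ j, x i * D j * b i j) =
      ∑ i, ∑ j, ∑ k, ∑ l, x i * D j * b i j * (x k * D l * b k l) := by
    simp_rw [Finset.sum_mul]
    simp_rw [Finset.mul_sum]
  -- After the exchange the quadruple sum factors into two symmetric sums, with values `-r²` and
  -- `-Δ`.
  have hA : ∑ i, ∑ j, ∑ k, ∑ l, (x i * x k * b i k) * (D j * D l * b j l) =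
      (∑ i, x i * x i) * ∑ i, D i * D i := by
    have : ∑ i, ∑ j, ∑ k, ∑ l, (x i * x k * b i k) * (D j * D l * b j l) =
        (∑ i, ∑ k, x i * x k * b i k) * ∑ j, ∑ l, D j * D l * b j l := by
      simp_rw [Finset.sum_mul]
      simp_rw [Finset.mul_sum]
      exact Finset.sum_congr rfl fun i _ => Finset.sum_comm
    rw [this, sum_symm_mul_clifford h h.xx h2, sum_symm_mul_clifford h h.DD h2, neg_mul_neg]
  have hB : ∑ i, ∑ j, ∑ k, ∑ l, (if j = k then 2 * (x i * x j * (D j * D l) * b i l) else 0) =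
      2 * ((∑ i, ∑ j, x i * D j * b i j) * ∑ i, x i * D i) -
        2 * (∑ i, ∑ j, x i * D j * b i j) := by
    have hbE : ∀ i l, b i l * (∑ j, x j * D j) = (∑ j, x j * D j) * b i l := by
      intro i l
      rw [Finset.mul_sum, Finset.sum_mul]
      refine Finset.sum_congr rfl fun j _ => ?_
      rw [← mul_assoc, h.bx, mul_assoc, h.bD, mul_assoc]
    have h3 : ∀ i l, ∑ j, x i * x j * (D j * D l) * b i l =
        x i * D l * b i l * (∑ j, x j * D j) - x i * D l * b i l := by
      intro i l
      have : ∑ j, x i * x j * (D j * D l) * b i l = x i * ((∑ j, x j * D j) * D l) * b i l := by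
        rw [Finset.sum_mul, Finset.mul_sum, Finset.sum_mul]
        exact Finset.sum_congr rfl fun j _ => by simp only [mul_assoc]
      rw [this, deriv_euler h, mul_sub, sub_mul, mul_assoc _ (b i l), hbE]
      simp only [mul_assoc]
    have h4 : ∀ i j, ∑ k, ∑ l, (if j = k then 2 * (x i * x j * (D j * D l) * b i l) else 0) =
        ∑ l, 2 * (x i * x j * (D j * D l) * b i l) := by
      intro i j
      rw [Finset.sum_comm]
      simp
    simp_rw [h4]
    have h5 : ∀ i, ∑ j, ∑ l, 2 * (x i * x j * (D j * D l) * b i l) =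
        ∑ l, 2 * (x i * D l * b i l * (∑ j, x j * D j) - x i * D l * b i l) := by
      intro i
      rw [Finset.sum_comm]
      exact Finset.sum_congr rfl fun l _ => by rw [← h3, Finset.mul_sum]
    simp_rw [h5, mul_sub, Finset.sum_sub_distrib, ← Finset.mul_sum, ← Finset.sum_mul]
  have hC : ∑ i, ∑ j : σ, ∑ k, ∑ l, (if j = k then x i * D l * b i l else 0) =
      (Fintype.card σ : R) * (∑ i, ∑ j, x i * D j * b i j) := by
    have h4 : ∀ i j : σ, ∑ k, ∑ l, (if j = k then x i * D l * b i l else 0) =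
        ∑ l, x i * D l * b i l := by
      intro i j
      rw [Finset.sum_comm]
      simp
    simp_rw [h4, Finset.sum_const, Finset.card_univ, nsmul_eq_mul, Finset.mul_sum]
  rw [hsum]
  simp only [hterm, Finset.sum_sub_distrib, Finset.sum_neg_distrib]
  rw [hA, hB, hC]
  abel

/-- `X + E` commutes with multiplication by `r²`. -/
theorem commute_radius_sq (h : IsWeylClifford x D b) (h2 : ∀ a : R, 2 * a = 0 → a = 0) :
    (∑ i, ∑ j, x i * D j * b i j + ∑ i, x i * D i) * (∑ i, x i * x i) =
      (∑ i, x i * x i) * (∑ i, ∑ j, x i * D j * b i j + ∑ i, x i * D i) := by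
  have hD : ∀ j, D j * (∑ i, x i * x i) = (∑ i, x i * x i) * D j + 2 * x j := by
    intro j
    have : ∀ i, D j * (x i * x i) = x i * x i * D j + if j = i then 2 * x i else 0 := by
      intro i
      rw [← mul_assoc, h.Dx, add_mul, mul_assoc, h.Dx, mul_add]
      split_ifs
      · rw [mul_one, one_mul, two_mul, mul_assoc, add_assoc]
      · rw [mul_zero, zero_mul, mul_assoc, add_zero]
    rw [Finset.mul_sum, Finset.sum_mul]
    simp only [this, Finset.sum_add_distrib, Finset.sum_ite_eq, Finset.mem_univ, if_true]
  have hx : ∀ j, x j * (∑ i, x i * x i) = (∑ i, x i * x i) * x j := by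
    intro j
    rw [Finset.mul_sum, Finset.sum_mul]
    exact Finset.sum_congr rfl fun i _ => by
      rw [← mul_assoc, h.xx j i, mul_assoc, h.xx j i, mul_assoc]
  have hb : ∀ i j, b i j * (∑ i, x i * x i) = (∑ i, x i * x i) * b i j := by
    intro i j
    rw [Finset.mul_sum, Finset.sum_mul]
    exact Finset.sum_congr rfl fun k _ => by rw [← mul_assoc, h.bx, mul_assoc, h.bx, mul_assoc]
  set r := ∑ i, x i * x i with hr
  have h1 : ∀ i j, x i * D j * r = r * (x i * D j) + 2 * (x i * x j) := by
    intro i j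
    rw [mul_assoc, hD, mul_add, ← mul_assoc, hx, mul_assoc, two_mul, mul_add, ← two_mul]
  have h3 : ∀ i j, x i * D j * b i j * r = r * (x i * D j * b i j) + 2 * (x i * x j * b i j) := by
    intro i j
    rw [mul_assoc, hb, ← mul_assoc, h1, add_mul, mul_assoc, mul_assoc 2]
  rw [add_mul, mul_add, Finset.sum_mul, Finset.sum_mul]
  simp_rw [Finset.sum_mul, h1, h3, Finset.sum_add_distrib, ← Finset.mul_sum]
  -- The commutator of `X` with `r²` is `2 ∑ x_i x_j b_ij = -2r²`; that of `E` is `2r²`, and they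
  -- cancel.
  rw [sum_symm_mul_clifford h h.xx h2, ← hr]
  noncomm_ring

end WeylClifford

end SphereDirac

end

noncomputable section

namespace SphereDirac

/-! ### Eigenspaces of a traceless operator that is quadratic modulo a subspace -/

section Quadratic

open Module Module.End

variable {V : Type*} [AddCommGroup V] [Module ℂ V]

lemma finrank_eigenspace_restrict {L : End ℂ V} {W : Submodule ℂ V} (hW : ∀ u ∈ W, L u ∈ W) {c : ℂ}
    (hc : eigenspace L c ≤ W) :
    finrank ℂ (eigenspace (L.restrict hW) c) = finrank ℂ (eigenspace L c) := by
  have : (eigenspace (L.restrict hW) c).map W.subtype = eigenspace L c := by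
    ext u
    simp only [Submodule.mem_map, mem_eigenspace_iff, Submodule.subtype_apply]
    constructor
    · rintro ⟨w, hw, rfl⟩
      exact congrArg Subtype.val hw
    · intro hu
      exact ⟨⟨u, hc (mem_eigenspace_iff.2 hu)⟩, Subtype.ext hu, rfl⟩
  rw [← this]
  exact (Submodule.equivMapOfInjective W.subtype W.injective_subtype _).finrank_eq

variable [FiniteDimensional ℂ V]

lemma trace_eq_add_of_isCompl {L : End ℂ V} {W U : Submodule ℂ V} (h : IsCompl W U)
    (hW : ∀ u ∈ W, L u ∈ W) (hU : ∀ u ∈ U, L u ∈ U) :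
    LinearMap.trace ℂ V L = LinearMap.trace ℂ W (L.restrict hW) +
      LinearMap.trace ℂ U (L.restrict hU) := by
  let A : Bool → Submodule ℂ V := fun b => cond b W U
  have hA : DirectSum.IsInternal A :=
    (DirectSum.isInternal_submodule_iff_isCompl A (i := true) (j := false) (by simp)
      (by ext b; cases b <;> simp)).2 h
  have hf : ∀ b, Set.MapsTo L (A b) (A b) := by
    rintro (_ | _)
    · exact hU
    · exact hW
  rw [LinearMap.trace_eq_sum_trace_restrict hA hf, Fintype.sum_bool]
  rfl

/-- The eigenvalues `a` and `-c` of a traceless operator with `(N - a) (N + c) = 0`. -/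
lemma finrank_eigenspace_of_quadratic {N : End ℂ V} {a c : ℂ} (hac : a + c ≠ 0)
    (hN : ∀ u, N (N u) = (a * c) • u - (c - a) • N u) (htr : LinearMap.trace ℂ V N = 0) :
    (a + c) * finrank ℂ (eigenspace N a) = c * finrank ℂ V ∧
    (a + c) * finrank ℂ (eigenspace N (-c)) = a * finrank ℂ V ∧
    eigenspace N a ⊔ eigenspace N (-c) = ⊤ := by
  -- The two eigenprojections are `(N + c)/(a + c)` and `(a - N)/(a + c)`. The rank of a projection
  -- is its trace, and `N` contributes nothing to it.
  have h1 : LinearMap.IsProj (eigenspace N a) ((a + c)⁻¹ • (N + c • (1 : End ℂ V))) := by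
    refine ⟨fun u => ?_, fun u hu => ?_⟩
    · rw [mem_eigenspace_iff]
      simp only [LinearMap.smul_apply, LinearMap.add_apply, one_apply, map_smul, map_add, hN]
      rw [smul_comm a]
      congr 1
      module
    · rw [mem_eigenspace_iff] at hu
      simp only [LinearMap.smul_apply, LinearMap.add_apply, one_apply, hu]
      rw [← add_smul, smul_smul, inv_mul_cancel₀ hac, one_smul]
  have h2 : LinearMap.IsProj (eigenspace N (-c)) ((a + c)⁻¹ • (a • (1 : End ℂ V) - N)) := by
    refine ⟨fun u => ?_, fun u hu => ?_⟩
    · rw [mem_eigenspace_iff]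
      simp only [LinearMap.smul_apply, LinearMap.sub_apply, one_apply, map_smul, map_sub, hN]
      rw [smul_comm (-c)]
      congr 1
      module
    · rw [mem_eigenspace_iff] at hu
      simp only [LinearMap.smul_apply, LinearMap.sub_apply, one_apply, hu]
      rw [← sub_smul, smul_smul, sub_neg_eq_add, inv_mul_cancel₀ hac, one_smul]
  have t1 := h1.trace
  have t2 := h2.trace
  rw [map_smul, map_add, map_smul, LinearMap.trace_one, htr, zero_add, smul_eq_mul,
    smul_eq_mul] at t1
  rw [map_smul, map_sub, map_smul, LinearMap.trace_one, htr, sub_zero, smul_eq_mul,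
    smul_eq_mul] at t2
  refine ⟨by rw [← t1, mul_inv_cancel_left₀ hac], by rw [← t2, mul_inv_cancel_left₀ hac], ?_⟩
  rw [eq_top_iff]
  intro u _
  have : u = ((a + c)⁻¹ • (N + c • (1 : End ℂ V))) u + ((a + c)⁻¹ • (a • (1 : End ℂ V) - N)) u := by
    simp only [LinearMap.smul_apply, LinearMap.sub_apply, LinearMap.add_apply, one_apply]
    rw [← smul_add, show N u + c • u + (a • u - N u) = (a + c) • u by module, smul_smul,
      inv_mul_cancel₀ hac, one_smul]
  rw [this]
  exact Submodule.add_mem_sup (h1.map_mem u) (h2.map_mem u)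

/-- The polynomial `T = (L - a)(L + c)` maps the space into `U` and is bijective on `U`, so its
kernel is an `L`-invariant complement of `U`. The trace vanishes on the whole space and on `U`,
hence on the kernel, where the exact quadratic case applies. -/
lemma finrank_eigenspace_of_quadratic_mod {L : End ℂ V} {U : Submodule ℂ V} {a c : ℂ}
    (hac : a + c ≠ 0) (hU : ∀ u ∈ U, L u ∈ U) (htr : LinearMap.trace ℂ V L = 0)
    (htrU : LinearMap.trace ℂ U (L.restrict hU) = 0)
    (hmod : ∀ u, L (L u) + (c - a) • L u - (a * c) • u ∈ U)
    (hinj : ∀ u ∈ U, L (L u) + (c - a) • L u - (a * c) • u = 0 → u = 0) :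
    (a + c) * finrank ℂ (eigenspace L a) = c * (finrank ℂ V - finrank ℂ U) ∧
    (a + c) * finrank ℂ (eigenspace L (-c)) = a * (finrank ℂ V - finrank ℂ U) ∧
    eigenspace L a ⊔ eigenspace L (-c) ⊔ U = ⊤ := by
  set T : End ℂ V := L * L + (c - a) • L - (a * c) • 1 with hT
  have hTa : ∀ u, T u = L (L u) + (c - a) • L u - (a * c) • u := fun u => rfl
  have hTL : ∀ u, T (L u) = L (T u) := by
    intro u
    simp only [hTa, map_sub, map_add, map_smul]
  set W := LinearMap.ker T with hWdef
  have hWmem : ∀ u, u ∈ W ↔ T u = 0 := fun u => LinearMap.mem_ker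
  have hTU : ∀ u ∈ U, T u ∈ U := fun u _ => by rw [hTa]; exact hmod u
  have hWU : IsCompl W U := by
    rw [isCompl_iff, Submodule.disjoint_def, Submodule.codisjoint_iff_exists_add_eq]
    refine ⟨fun u hw hu => hinj u hu ?_, fun u => ?_⟩
    · rw [← hTa]; exact (hWmem u).1 hw
    · have hi : Function.Injective (T.restrict hTU) := by
        rw [injective_iff_map_eq_zero]
        intro w hw
        exact Subtype.ext (hinj w w.2 (by rw [← hTa]; exact congrArg Subtype.val hw))
      obtain ⟨w, hw⟩ := LinearMap.surjective_of_injective hi ⟨T u, by rw [hTa]; exact hmod u⟩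
      have hw' : T w = T u := congrArg Subtype.val hw
      refine ⟨u - w, w, ?_, w.2, by abel⟩
      rw [hWmem, map_sub, hw', sub_self]
  have hWL : ∀ u ∈ W, L u ∈ W := by
    intro u hu
    rw [hWmem] at hu ⊢
    rw [hTL, hu, map_zero]
  have htrW : LinearMap.trace ℂ W (L.restrict hWL) = 0 := by
    have := trace_eq_add_of_isCompl hWU hWL hU
    rwa [htr, htrU, add_zero, eq_comm] at this
  have hfr : (finrank ℂ W : ℂ) = finrank ℂ V - finrank ℂ U := by
    rw [← Submodule.finrank_add_eq_of_isCompl hWU]; push_cast; ring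
  have hq : ∀ u, L.restrict hWL (L.restrict hWL u) =
      (a * c) • u - (c - a) • L.restrict hWL u := by
    intro u
    apply Subtype.ext
    have h1 := (hWmem u).1 u.2
    rw [hTa] at h1
    change L (L u) = (a * c) • (u : V) - (c - a) • L u
    rw [sub_eq_zero] at h1
    rw [eq_sub_iff_add_eq, h1]
  obtain ⟨h1, h2, h3⟩ := finrank_eigenspace_of_quadratic hac hq htrW
  have e1 : eigenspace L a ≤ W := by
    intro u hu
    rw [mem_eigenspace_iff] at hu
    rw [hWmem, hTa, hu, map_smul, hu]
    module
  have e2 : eigenspace L (-c) ≤ W := by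
    intro u hu
    rw [mem_eigenspace_iff] at hu
    rw [hWmem, hTa, hu, map_smul, hu]
    module
  rw [finrank_eigenspace_restrict hWL e1, hfr] at h1
  rw [finrank_eigenspace_restrict hWL e2, hfr] at h2
  refine ⟨h1, h2, ?_⟩
  rw [eq_top_iff, ← hWU.sup_eq_top]
  refine sup_le_sup_right (fun u hu => ?_) U
  have h4 : (⟨u, hu⟩ : W) ∈ eigenspace (L.restrict hWL) a ⊔ eigenspace (L.restrict hWL) (-c) := by
    rw [h3]; trivial
  obtain ⟨y, hy, z, hz, hyz⟩ := Submodule.mem_sup.1 h4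
  rw [mem_eigenspace_iff] at hy hz
  refine Submodule.mem_sup.2 ⟨y, mem_eigenspace_iff.2 (congrArg Subtype.val hy), z,
    mem_eigenspace_iff.2 (congrArg Subtype.val hz), congrArg Subtype.val hyz⟩

end Quadratic

/-! ### Graded operators, treated by induction on the degree in steps of two. -/

section Graded

open Module Module.End

variable {F : ℕ → Type*} [∀ k, AddCommGroup (F k)] [∀ k, Module ℂ (F k)]

/-- A graded operator `L` that commutes with an injection `R` of degree `2` and satisfies
`(L - k) (L + k + e) = 0` modulo the range of `R` in degree `k`. -/
structure IsGradedDirac (e : ℕ) (L : ∀ k, End ℂ (F k)) (R : ∀ k, F k →ₗ[ℂ] F (k + 2)) : Prop where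
  inj : ∀ k, Function.Injective (R k)
  comm : ∀ k u, L (k + 2) (R k u) = R k (L k u)
  quad : ∀ k u, ∃ w, L (k + 2) (L (k + 2) u) + (e : ℂ) • L (k + 2) u -
    (((k + 2 : ℕ) : ℂ) * ((k + 2 : ℕ) + e)) • u = R k w
  zero : ∀ u, L 0 u = 0
  one : ∀ u, L 1 (L 1 u) + (e : ℂ) • L 1 u - ((1 : ℂ) * (1 + e)) • u = 0
  trace : ∀ k, LinearMap.trace ℂ (F k) (L k) = 0

variable {e : ℕ} {L : ∀ k, End ℂ (F k)} {R : ∀ k, F k →ₗ[ℂ] F (k + 2)}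

/-- Put `q(x) = x (x + e)`, which is strictly increasing on the naturals. In degree `k < m` the
operator `L² + eL` is `q(k)` modulo the range of `R`, so a solution for `q(m)` lies in that range;
injectivity and commutation move it down two degrees, until degree `0` or `1`. -/
lemma IsGradedDirac.eq_zero (h : IsGradedDirac e L R) {m : ℕ} : ∀ (k : ℕ), k < m → ∀ u : F k,
    L k (L k u) + (e : ℂ) • L k u - ((m : ℂ) * (m + e)) • u = 0 → u = 0
  | 0, hm, u, hu => by
    rw [h.zero, h.zero, smul_zero, add_zero, zero_sub, neg_eq_zero] at hu
    refine (smul_eq_zero.1 hu).resolve_left ?_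
    have : 0 < m * (m + e) := by positivity
    exact_mod_cast this.ne'
  | 1, hm, u, hu => by
    have h1 := h.one u
    rw [sub_eq_zero] at h1
    rw [h1, ← sub_smul] at hu
    refine (smul_eq_zero.1 hu).resolve_left fun h0 => ?_
    have h2 : 1 * (1 + e) = m * (m + e) := by exact_mod_cast sub_eq_zero.1 h0
    nlinarith
  | k + 2, hm, u, hu => by
    obtain ⟨w, hw⟩ := h.quad k u
    have h3 : ((m : ℂ) * (m + e) - ((k + 2 : ℕ) : ℂ) * ((k + 2 : ℕ) + e)) • u = R k w := by
      rw [← hw, sub_smul]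
      rw [sub_eq_zero] at hu
      rw [hu]
    set c : ℂ := (m : ℂ) * (m + e) - ((k + 2 : ℕ) : ℂ) * ((k + 2 : ℕ) + e) with hc
    have hc0 : c ≠ 0 := by
      intro h0
      have h2 : m * (m + e) = (k + 2) * ((k + 2) + e) := by exact_mod_cast sub_eq_zero.1 h0
      nlinarith
    have h4 : u = R k (c⁻¹ • w) := by
      rw [map_smul, ← h3, smul_smul, inv_mul_cancel₀ hc0, one_smul]
    have h5 := h.eq_zero (m := m) k (by omega) (c⁻¹ • w) ?_
    · rw [h4, h5, map_zero]
    · apply h.inj k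
      rw [h4, h.comm, h.comm, ← map_smul (R k), ← map_smul (R k), ← map_add, ← map_sub] at hu
      rw [hu, map_zero]

/-- The part of degree `k` that comes from degree `k - 2`. -/
def radialPart (R : ∀ k, F k →ₗ[ℂ] F (k + 2)) : ∀ k, Submodule ℂ (F k)
  | 0 => ⊥
  | 1 => ⊥
  | k + 2 => LinearMap.range (R k)

/-- The quadratic lemma with `a = k`, `c = k + e` and `U` the radial part. On `U` the operator is
conjugate to `L` in degree `k - 2`, hence traceless, and `eq_zero` supplies the injectivity. -/
lemma IsGradedDirac.eigenspaces [∀ k, FiniteDimensional ℂ (F k)] (h : IsGradedDirac e L R) {k : ℕ} (hk : 1 ≤ k) :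
    ((k : ℂ) + (k + e)) * finrank ℂ (eigenspace (L k) (k : ℂ)) =
      (k + e) * (finrank ℂ (F k) - finrank ℂ (radialPart R k)) ∧
    ((k : ℂ) + (k + e)) * finrank ℂ (eigenspace (L k) (-(k + e))) =
      k * (finrank ℂ (F k) - finrank ℂ (radialPart R k)) ∧
    eigenspace (L k) (k : ℂ) ⊔ eigenspace (L k) (-(k + e)) ⊔ radialPart R k = ⊤ := by
  have hac : (k : ℂ) + (k + e) ≠ 0 := by
    have : 0 < k + (k + e) := by omega
    exact_mod_cast this.ne'
  have he : (k : ℂ) + e - k = e := by ring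
  match k, hk with
  | 1, _ =>
    refine finrank_eigenspace_of_quadratic_mod (U := (⊥ : Submodule ℂ (F 1))) hac ?_ (h.trace 1)
      ?_ ?_ ?_
    · rintro u hu
      rw [(Submodule.mem_bot ℂ).1 hu, map_zero]; exact Submodule.zero_mem _
    · exact (congrArg _ (Subsingleton.elim _ 0)).trans (map_zero _)
    · intro u
      rw [Submodule.mem_bot, he]
      simpa using h.one u
    · intro u hu _
      exact (Submodule.mem_bot ℂ).1 hu
  | k + 2, _ =>
    have hU : ∀ u ∈ LinearMap.range (R k), L (k + 2) u ∈ LinearMap.range (R k) := by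
      rintro _ ⟨w, rfl⟩
      exact ⟨L k w, (h.comm k w).symm⟩
    refine finrank_eigenspace_of_quadratic_mod (U := LinearMap.range (R k)) hac hU
      (h.trace (k + 2)) ?_ ?_ ?_
    · let E := LinearEquiv.ofInjective (R k) (h.inj k)
      have : (L (k + 2)).restrict hU = E.conj (L k) := by
        ext u
        obtain ⟨w, rfl⟩ := E.surjective u
        rw [LinearEquiv.conj_apply_apply, LinearEquiv.symm_apply_apply]
        exact h.comm k w
      rw [this, LinearMap.trace_conj', h.trace]
    · intro u
      rw [he]
      obtain ⟨w, hw⟩ := h.quad k u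
      exact ⟨w, hw.symm⟩
    · rintro _ ⟨w, rfl⟩ hw
      rw [he, h.comm, h.comm, ← map_smul (R k), ← map_smul (R k), ← map_add, ← map_sub] at hw
      rw [h.eq_zero (m := k + 2) k (by omega) w ((h.inj k) (by rw [hw, map_zero])), map_zero]

end Graded

end SphereDirac

end

noncomputable section

namespace SphereDirac

/-! ### Spinor-valued polynomials -/

section Polynomials

open Module Module.End MvPolynomial TensorProduct

variable {n : ℕ} {S : Type} [AddCommGroup S] [Module ℂ S]

/-- Even products of Clifford generators of square `-1`. -/
structure IsCliffordFamily (B : Fin n → Fin n → End ℂ S) : Prop where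
  mid : ∀ i j k, B i j * B j k = -B i k
  anti : ∀ i j, B i j + B j i = if i = j then -2 else 0
  swap : ∀ i j k l, B i j * B k l = -(B i k * B j l) - if j = k then 2 * B i l else 0

lemma IsCliffordFamily.self {B : Fin n → Fin n → End ℂ S} (hB : IsCliffordFamily B) (i : Fin n) :
    B i i = -1 := by
  have h := hB.anti i i
  rw [if_pos rfl, ← two_smul ℂ] at h
  have h2 : (-2 : End ℂ S) = (2 : ℂ) • (-1 : End ℂ S) := by
    rw [smul_neg, two_smul]; norm_num
  rw [h2] at h
  exact smul_right_injective _ two_ne_zero h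

/-- Spinor-valued polynomials on `ℝ^n`. -/
abbrev PolySpinor (n : ℕ) (S : Type) [AddCommGroup S] [Module ℂ S] : Type :=
  MvPolynomial (Fin n) ℂ ⊗[ℂ] S

/-- Multiplication by a coordinate. -/
def mulX (S : Type) [AddCommGroup S] [Module ℂ S] (i : Fin n) : End ℂ (PolySpinor n S) :=
  (LinearMap.mulLeft ℂ (X i)).rTensor S

/-- Partial derivative. -/
def partialX (S : Type) [AddCommGroup S] [Module ℂ S] (i : Fin n) : End ℂ (PolySpinor n S) :=
  (pderiv i).toLinearMap.rTensor S

/-- Action on the values. -/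
def actVal (n : ℕ) : End ℂ S →ₐ[ℂ] End ℂ (PolySpinor n S) := lTensorAlgHom ℂ S _

@[simp] lemma mulX_tmul (i : Fin n) (p : MvPolynomial (Fin n) ℂ) (v : S) :
    mulX S i (p ⊗ₜ v) = (X i * p) ⊗ₜ v := rfl

@[simp] lemma partialX_tmul (i : Fin n) (p : MvPolynomial (Fin n) ℂ) (v : S) :
    partialX S i (p ⊗ₜ v) = (pderiv i p) ⊗ₜ v := rfl

@[simp] lemma actVal_tmul (A : End ℂ S) (p : MvPolynomial (Fin n) ℂ) (v : S) :
    actVal n A (p ⊗ₜ v) = p ⊗ₜ A v := rfl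

lemma pderiv_comm (i j : Fin n) (p : MvPolynomial (Fin n) ℂ) :
    pderiv i (pderiv j p) = pderiv j (pderiv i p) := by
  have h : ⁅(pderiv i : Derivation ℂ (MvPolynomial (Fin n) ℂ) (MvPolynomial (Fin n) ℂ)),
      (pderiv j : Derivation ℂ (MvPolynomial (Fin n) ℂ) (MvPolynomial (Fin n) ℂ))⁆ = 0 := by
    refine MvPolynomial.derivation_ext fun k => ?_
    rw [Derivation.commutator_apply]
    simp only [pderiv_X, Derivation.coe_zero, Pi.zero_apply]
    by_cases h1 : j = k <;> by_cases h2 : i = k <;> simp [h1, h2]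
  have h2 := congrArg (fun D => D p) h
  rw [Derivation.commutator_apply] at h2
  exact sub_eq_zero.1 h2

lemma isWeylClifford_polySpinor {B : Fin n → Fin n → End ℂ S} (hB : IsCliffordFamily B) :
    IsWeylClifford (mulX S) (partialX S) (fun i j => actVal n (B i j)) where
  xx i j := by
    ext p v
    simp [mul_left_comm]
  DD i j := by
    refine TensorProduct.ext' fun p v => ?_
    simp [pderiv_comm i j]
  Dx i j := by
    refine TensorProduct.ext' fun p v => ?_
    by_cases h : i = j
    · subst h
      simp [add_comm, TensorProduct.add_tmul]
    · simp [h, pderiv_X_of_ne (Ne.symm h)]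
  bx i j k := by
    refine TensorProduct.ext' fun p v => ?_
    simp
  bD i j k := by
    refine TensorProduct.ext' fun p v => ?_
    simp
  mid i j k := by
    rw [← map_mul, hB.mid, map_neg]
  anti i j := by
    rw [← map_add, hB.anti, apply_ite (actVal n), map_neg, map_ofNat, map_zero]
  swap i j k l := by
    rw [← map_mul, hB.swap, map_sub, map_neg, map_mul, apply_ite (actVal n), map_mul, map_ofNat,
      map_zero]

/-- The tangential Dirac operator `∑ B i j x_i ∂_j + ∑ x_i ∂_i` on spinor-valued polynomials. -/
def polyDirac (B : Fin n → Fin n → End ℂ S) : End ℂ (PolySpinor n S) :=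
  ∑ i, ∑ j, mulX S i * partialX S j * actVal n (B i j) + ∑ i, mulX S i * partialX S i

/-- Multiplication by the square of the radius. -/
def radiusSq (n : ℕ) (S : Type) [AddCommGroup S] [Module ℂ S] : End ℂ (PolySpinor n S) :=
  ∑ i, mulX S i * mulX S i

/-- The Laplace operator. -/
def polyLap (n : ℕ) (S : Type) [AddCommGroup S] [Module ℂ S] : End ℂ (PolySpinor n S) :=
  ∑ i, partialX S i * partialX S i

lemma eq_zero_of_two_mul {V : Type*} [AddCommGroup V] [Module ℂ V] (a : End ℂ V) (h : 2 * a = 0) :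
    a = 0 := by
  have : (2 : ℂ) • a = 0 := by rw [two_smul, ← two_mul, h]
  exact (smul_eq_zero.1 this).resolve_left two_ne_zero

/-! ### Homogeneous spinor-valued polynomials -/

/-- Homogeneous spinor-valued polynomials of degree `k`. -/
abbrev HomSpinor (n : ℕ) (S : Type) [AddCommGroup S] [Module ℂ S] (k : ℕ) : Type :=
  homogeneousSubmodule (Fin n) ℂ k ⊗[ℂ] S

/-- The inclusion of the homogeneous spinor-valued polynomials. -/
def homIncl (n : ℕ) (S : Type) [AddCommGroup S] [Module ℂ S] (k : ℕ) :
    HomSpinor n S k →ₗ[ℂ] PolySpinor n S :=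
  (homogeneousSubmodule (Fin n) ℂ k).subtype.rTensor S

@[simp] lemma homIncl_tmul (k : ℕ) (p : homogeneousSubmodule (Fin n) ℂ k) (v : S) :
    homIncl n S k (p ⊗ₜ v) = (p : MvPolynomial (Fin n) ℂ) ⊗ₜ v := rfl

lemma homIncl_injective (k : ℕ) : Function.Injective (homIncl n S k) :=
  Module.Flat.rTensor_preserves_injective_linearMap _ (Submodule.injective_subtype _)

lemma isHomogeneous_X_mul_pderiv {p : MvPolynomial (Fin n) ℂ} {k : ℕ} (hp : p.IsHomogeneous k)
    (i j : Fin n) : (X i * pderiv j p).IsHomogeneous k := by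
  rcases k with _ | k
  · rw [← totalDegree_zero_iff_isHomogeneous, totalDegree_eq_zero_iff_eq_C] at hp
    rw [hp, pderiv_C, mul_zero]
    exact isHomogeneous_zero _ _ _
  · have := (isHomogeneous_X ℂ i).mul (hp.pderiv (i := j))
    rwa [Nat.add_sub_cancel, add_comm] at this

/-- The operator `x_i ∂_j` on homogeneous polynomials. -/
def mulDeriv (k : ℕ) (i j : Fin n) : End ℂ (homogeneousSubmodule (Fin n) ℂ k) :=
  LinearMap.restrict (LinearMap.mulLeft ℂ (X i) * (pderiv j).toLinearMap)
    fun _ hp => isHomogeneous_X_mul_pderiv hp i j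

lemma coe_mulDeriv (k : ℕ) (i j : Fin n) (p : homogeneousSubmodule (Fin n) ℂ k) :
    (mulDeriv k i j p : MvPolynomial (Fin n) ℂ) = X i * pderiv j (p : MvPolynomial (Fin n) ℂ) := rfl

/-- The Dirac operator on homogeneous spinor-valued polynomials. -/
def homDirac (B : Fin n → Fin n → End ℂ S) (k : ℕ) : End ℂ (HomSpinor n S k) :=
  ∑ i, ∑ j, TensorProduct.map (mulDeriv k i j) (B i j) + (k : ℂ) • 1

/-- The eigenspaces of the Dirac operator on homogeneous spinor-valued polynomials. -/
abbrev diracEigenspace (B : Fin n → Fin n → End ℂ S) (k : ℕ) (c : ℂ) :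
    Submodule ℂ (HomSpinor n S k) :=
  eigenspace (M := HomSpinor n S k) (homDirac B k) c

lemma homIncl_euler (k : ℕ) (u : HomSpinor n S k) :
    (∑ i, mulX S i * partialX S i) (homIncl n S k u) = (k : ℂ) • homIncl n S k u := by
  induction u using TensorProduct.induction_on with
  | zero => simp
  | add u w hu hw => rw [map_add, map_add, hu, hw, smul_add]
  | tmul p v =>
    have h := p.2.sum_X_mul_pderiv
    simp only [LinearMap.sum_apply, mul_apply, homIncl_tmul, partialX_tmul, mulX_tmul]
    rw [← TensorProduct.sum_tmul, h, ← Nat.cast_smul_eq_nsmul ℂ, TensorProduct.smul_tmul']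

lemma homIncl_homDirac (B : Fin n → Fin n → End ℂ S) (k : ℕ) (u : HomSpinor n S k) :
    homIncl n S k (homDirac B k u) = polyDirac B (homIncl n S k u) := by
  rw [polyDirac, LinearMap.add_apply, homIncl_euler, homDirac, LinearMap.add_apply, map_add,
    LinearMap.smul_apply, one_apply, map_smul]
  congr 1
  induction u using TensorProduct.induction_on with
  | zero => simp
  | add u w hu hw => rw [map_add, map_add, map_add, map_add, hu, hw]
  | tmul p v =>
    simp only [LinearMap.sum_apply, mul_apply, map_sum, TensorProduct.map_tmul, homIncl_tmul,
      partialX_tmul, mulX_tmul, actVal_tmul, coe_mulDeriv]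

/-- Multiplication by the square of the radius on homogeneous spinor-valued polynomials. -/
def homRadiusSq (n : ℕ) (S : Type) [AddCommGroup S] [Module ℂ S] (k : ℕ) :
    HomSpinor n S k →ₗ[ℂ] HomSpinor n S (k + 2) :=
  LinearMap.rTensor S (LinearMap.restrict (LinearMap.mulLeft ℂ (∑ i, X i * X i)) fun p hp => by
    rw [add_comm]
    exact (IsHomogeneous.sum _ _ _ fun i _ =>
      (isHomogeneous_X ℂ i).mul (isHomogeneous_X ℂ i)).mul hp)

lemma homIncl_homRadiusSq (k : ℕ) (u : HomSpinor n S k) :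
    homIncl n S (k + 2) (homRadiusSq n S k u) = radiusSq n S (homIncl n S k u) := by
  induction u using TensorProduct.induction_on with
  | zero => simp
  | add u w hu hw => rw [map_add, map_add, map_add, map_add, hu, hw]
  | tmul p v =>
    have : homIncl n S (k + 2) (homRadiusSq n S k (p ⊗ₜ v)) =
      ((∑ i, X i * X i) * (p : MvPolynomial (Fin n) ℂ)) ⊗ₜ v := rfl
    rw [this, radiusSq]
    simp only [LinearMap.sum_apply, mul_apply, homIncl_tmul, mulX_tmul, Finset.sum_mul,
      TensorProduct.sum_tmul, mul_assoc]

lemma exists_polyLap (k : ℕ) (u : HomSpinor n S (k + 2)) :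
    ∃ w : HomSpinor n S k, homIncl n S k w = polyLap n S (homIncl n S (k + 2) u) := by
  induction u using TensorProduct.induction_on with
  | zero => exact ⟨0, by simp⟩
  | add u w hu hw =>
    obtain ⟨a, ha⟩ := hu
    obtain ⟨b, hb⟩ := hw
    exact ⟨a + b, by rw [map_add, map_add, map_add, ha, hb]⟩
  | tmul p v =>
    refine ⟨(⟨∑ i, pderiv i (pderiv i (p : MvPolynomial (Fin n) ℂ)), ?_⟩ :
      homogeneousSubmodule (Fin n) ℂ k) ⊗ₜ v, ?_⟩
    · exact IsHomogeneous.sum _ _ _ fun i _ => (IsHomogeneous.pderiv (IsHomogeneous.pderiv p.2))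
    · simp only [homIncl_tmul, polyLap, LinearMap.sum_apply, mul_apply, partialX_tmul,
        TensorProduct.sum_tmul]

lemma polyLap_of_le_one {k : ℕ} (hk : k ≤ 1) (u : HomSpinor n S k) :
    polyLap n S (homIncl n S k u) = 0 := by
  induction u using TensorProduct.induction_on with
  | zero => simp
  | add u w hu hw => rw [map_add, map_add, hu, hw, add_zero]
  | tmul p v =>
    simp only [homIncl_tmul, polyLap, LinearMap.sum_apply, mul_apply, partialX_tmul]
    refine Finset.sum_eq_zero fun i _ => ?_
    have h : (pderiv i (p : MvPolynomial (Fin n) ℂ)).IsHomogeneous 0 := by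
      have := IsHomogeneous.pderiv (i := i) p.2
      rwa [show k - 1 = 0 by omega] at this
    rw [← totalDegree_zero_iff_isHomogeneous, totalDegree_eq_zero_iff_eq_C] at h
    rw [h, pderiv_C, TensorProduct.zero_tmul]

/-- `L² + (n - 2) L - k (k + n - 2) = - r² Δ` in degree `k`. -/
lemma homIncl_quadratic {d : ℕ} (hd : 1 ≤ d) {B : Fin (d + 1) → Fin (d + 1) → End ℂ S}
    (hB : IsCliffordFamily B) (k : ℕ) (u : HomSpinor (d + 1) S k) :
    homIncl (d + 1) S k (homDirac B k (homDirac B k u) + ((d - 1 : ℕ) : ℂ) • homDirac B k u -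
      ((k : ℂ) * (k + (d - 1 : ℕ))) • u) =
    -(radiusSq (d + 1) S (polyLap (d + 1) S (homIncl (d + 1) S k u))) := by
  have h := sq_weylClifford (isWeylClifford_polySpinor hB) eq_zero_of_two_mul
  set Y : End ℂ (PolySpinor (d + 1) S) :=
    ∑ i, ∑ j, mulX S i * partialX S j * actVal (d + 1) (B i j) with hY
  set E : End ℂ (PolySpinor (d + 1) S) := ∑ i, mulX S i * partialX S i with hE
  have h1 := LinearMap.congr_fun h (homIncl (d + 1) S k u)
  have hEu := homIncl_euler k u
  have hL : ∀ w, homIncl (d + 1) S k (homDirac B k w) =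
      Y (homIncl (d + 1) S k w) + (k : ℂ) • homIncl (d + 1) S k w := by
    intro w
    rw [homIncl_homDirac, polyDirac, LinearMap.add_apply, homIncl_euler]
  have hc : ((Fintype.card (Fin (d + 1)) : ℕ) : End ℂ (PolySpinor (d + 1) S)) * Y =
      ((d : ℂ) + 1) • Y := by
    rw [Fintype.card_fin, ← nsmul_eq_mul, ← Nat.cast_smul_eq_nsmul ℂ]; push_cast; rfl
  have h2 : ∀ Z : End ℂ (PolySpinor (d + 1) S), 2 * Z = (2 : ℂ) • Z := by
    intro Z; rw [two_smul, two_mul]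
  rw [hc, h2, h2] at h1
  simp only [LinearMap.sub_apply, LinearMap.add_apply, LinearMap.smul_apply, mul_apply,
    LinearMap.neg_apply] at h1
  rw [← hE] at hEu
  rw [hEu, map_smul] at h1
  change _ = -(radiusSq (d + 1) S (polyLap (d + 1) S (homIncl (d + 1) S k u))) at h1
  rw [← h1, map_sub, map_add, map_smul, map_smul, hL, hL, map_add, map_smul, Nat.cast_sub hd,
    Nat.cast_one]
  module

/-! ### Traces, dimensions and multiplicities in each degree. -/

variable [FiniteDimensional ℂ S]

instance (k : ℕ) : FiniteDimensional ℂ (homogeneousSubmodule (Fin n) ℂ k) :=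
  Module.Finite.iff_fg.2 (homogeneousSubmodule_fg (Fin n) ℂ k)

lemma trace_mul_sub_mul {V : Type*} [AddCommGroup V] [Module ℂ V] (f g : End ℂ V) :
    LinearMap.trace ℂ V (f * g - g * f) = 0 := by
  rw [map_sub, LinearMap.trace_mul_comm, sub_self]

lemma trace_smul_one {V : Type*} [AddCommGroup V] [Module ℂ V] [FiniteDimensional ℂ V] (c : ℂ) :
    LinearMap.trace ℂ V (c • 1) = c * finrank ℂ V := by
  rw [map_smul, LinearMap.trace_one, smul_eq_mul]

/-- For `i ≠ j` the operator is a commutator: `x_i ∂_j = [x_i ∂_i, x_i ∂_j]`. -/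
lemma trace_mulDeriv_of_ne (k : ℕ) {i j : Fin n} (hij : i ≠ j) :
    LinearMap.trace ℂ _ (mulDeriv k i j) = 0 := by
  have h : mulDeriv k i j = mulDeriv k i i * mulDeriv k i j - mulDeriv k i j * mulDeriv k i i := by
    refine LinearMap.ext fun p => Subtype.ext ?_
    simp only [LinearMap.sub_apply, mul_apply, Submodule.coe_sub, coe_mulDeriv, Derivation.leibniz,
      pderiv_X_self, pderiv_X_of_ne hij, smul_eq_mul, mul_one, mul_zero, add_zero, mul_add,
      pderiv_comm i j]
    ring
  exact (congrArg _ h).trans (trace_mul_sub_mul _ _)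

lemma sum_mulDeriv_self (k : ℕ) : ∑ i : Fin n, mulDeriv k i i = (k : ℂ) • 1 := by
  refine LinearMap.ext fun p => Subtype.ext ?_
  have h := p.2.sum_X_mul_pderiv
  simp only [LinearMap.sum_apply, Submodule.coe_sum, coe_mulDeriv, h, LinearMap.smul_apply,
    one_apply, Nat.cast_smul_eq_nsmul]
  rfl

/-- Off-diagonal terms are traceless. On the diagonal `B i i = -1`, so Euler's identity yields `-k`
times the dimension, which the summand `k` cancels. -/
lemma trace_homDirac {B : Fin n → Fin n → End ℂ S} (hB : IsCliffordFamily B) (k : ℕ) :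
    LinearMap.trace ℂ _ (homDirac B k) = 0 := by
  have h1 : ∀ i, ∑ j, LinearMap.trace ℂ _ (TensorProduct.map (mulDeriv k i j) (B i j)) =
      -(LinearMap.trace ℂ _ (mulDeriv k i i) * finrank ℂ S) := by
    intro i
    rw [Finset.sum_eq_single i]
    · rw [LinearMap.trace_tensorProduct', hB.self, map_neg, LinearMap.trace_one, mul_neg]
    · intro j _ hj
      rw [LinearMap.trace_tensorProduct', trace_mulDeriv_of_ne k (Ne.symm hj), zero_mul]
    · simp
  have h2 : LinearMap.trace ℂ (HomSpinor n S k) 1 =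
      finrank ℂ (homogeneousSubmodule (Fin n) ℂ k) * finrank ℂ S := by
    rw [← Nat.cast_mul, ← finrank_tensorProduct]
    exact LinearMap.trace_one ℂ (HomSpinor n S k)
  have h3 : ∑ i : Fin n, LinearMap.trace ℂ (homogeneousSubmodule (Fin n) ℂ k) (mulDeriv k i i) =
      k * finrank ℂ (homogeneousSubmodule (Fin n) ℂ k) := by
    rw [← map_sum]
    exact (congrArg (LinearMap.trace ℂ (homogeneousSubmodule (Fin n) ℂ k))
      (sum_mulDeriv_self (n := n) k)).trans (trace_smul_one _)
  rw [homDirac, map_add, map_smul, h2, map_sum]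
  simp only [map_sum, h1]
  rw [Finset.sum_neg_distrib, ← Finset.sum_mul, h3, smul_eq_mul]
  ring

/-- The monomials of degree `k` form a basis, counted by stars and bars. -/
lemma finrank_homogeneousSubmodule (d k : ℕ) :
    finrank ℂ (homogeneousSubmodule (Fin (d + 1)) ℂ k) = (k + d).choose d := by
  classical
  have hset : ∀ a : Fin (d + 1) →₀ ℕ, a ∈ (Finset.univ : Finset (Fin (d + 1))).finsuppAntidiag k ↔
      a.degree = k := by
    intro a
    simp [Finset.mem_finsuppAntidiag, Finsupp.degree_eq_sum]
  let A := {a // a ∈ (Finset.univ : Finset (Fin (d + 1))).finsuppAntidiag k}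
  have hspan : homogeneousSubmodule (Fin (d + 1)) ℂ k =
      Submodule.span ℂ (Set.range fun a : A => basisMonomials (Fin (d + 1)) ℂ a) := by
    rw [homogeneousSubmodule_eq_finsupp_supported, AddMonoidAlgebra.supported_eq_span_single]
    congr 1
    ext p
    constructor
    · rintro ⟨a, ha, rfl⟩
      exact ⟨⟨a, (hset a).2 ha⟩, by simp [MvPolynomial.monomial]⟩
    · rintro ⟨a, rfl⟩
      exact ⟨a, (hset a).1 a.2, by simp [MvPolynomial.monomial]⟩
  have hli : LinearIndependent ℂ fun a : A => basisMonomials (Fin (d + 1)) ℂ a :=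
    (basisMonomials (Fin (d + 1)) ℂ).linearIndependent.comp _ Subtype.val_injective
  rw [hspan, finrank_span_eq_card hli, Fintype.card_coe, Finset.card_finsuppAntidiag_nat_eq_choose,
    Finset.card_univ, Fintype.card_fin, show d + 1 + k - 1 = k + d by omega,
    Nat.choose_symm_add]

lemma isGradedDirac_homDirac {d : ℕ} (hd : 1 ≤ d) {B : Fin (d + 1) → Fin (d + 1) → End ℂ S}
    (hB : IsCliffordFamily B) :
    IsGradedDirac (F := HomSpinor (d + 1) S) (d - 1) (homDirac B) (homRadiusSq (d + 1) S) where
  inj k := by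
    refine Module.Flat.rTensor_preserves_injective_linearMap _ ?_
    intro p q hpq
    have h := congrArg Subtype.val hpq
    refine Subtype.ext (mul_left_cancel₀ (a := ∑ i : Fin (d + 1), (X i * X i : MvPolynomial _ ℂ))
      ?_ h)
    intro h0
    have := congrArg (MvPolynomial.eval (Pi.single 0 1 : Fin (d + 1) → ℂ)) h0
    simp [Pi.single_apply] at this
  comm k u := by
    apply homIncl_injective
    rw [homIncl_homDirac, homIncl_homRadiusSq, homIncl_homRadiusSq, homIncl_homDirac]
    exact LinearMap.congr_fun
      (commute_radius_sq (isWeylClifford_polySpinor hB) eq_zero_of_two_mul) (homIncl (d + 1) S k u)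
  quad k u := by
    obtain ⟨w, hw⟩ := exists_polyLap k u
    refine ⟨(-1 : ℂ) • w, homIncl_injective _ ?_⟩
    rw [homIncl_quadratic hd hB, homIncl_homRadiusSq, map_smul, map_smul, hw]
    exact (neg_one_smul ℂ _).symm
  zero u := by
    have h : homDirac B 0 = 0 := by
      have h1 : ∀ i j, mulDeriv (n := d + 1) 0 i j = 0 := by
        intro i j
        refine LinearMap.ext fun p => Subtype.ext ?_
        have hp := p.2
        rw [mem_homogeneousSubmodule, ← totalDegree_zero_iff_isHomogeneous,
          totalDegree_eq_zero_iff_eq_C] at hp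
        rw [coe_mulDeriv, hp, pderiv_C, mul_zero]
        rfl
      rw [homDirac]
      simp [h1]
    rw [h]; rfl
  one u := by
    apply homIncl_injective
    have h := homIncl_quadratic hd hB 1 u
    rw [polyLap_of_le_one le_rfl, map_zero, neg_zero, Nat.cast_one] at h
    rw [h, map_zero]
  trace k := trace_homDirac hB k

lemma finrank_homSpinor (d k : ℕ) :
    finrank ℂ (HomSpinor (d + 1) S k) = (k + d).choose d * finrank ℂ S := by
  rw [finrank_tensorProduct, finrank_homogeneousSubmodule]

/-- Pascal's rule, used twice; in degree `1` the radial part is zero. -/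
lemma finrank_homSpinor_sub {d : ℕ} (hd : 1 ≤ d) {B : Fin (d + 1) → Fin (d + 1) → End ℂ S}
    (hB : IsCliffordFamily B) (k : ℕ) :
    finrank ℂ (HomSpinor (d + 1) S (k + 1)) =
      finrank ℂ (radialPart (F := HomSpinor _ S) (homRadiusSq (d + 1) S) (k + 1)) +
      ((k + 1 + (d - 1)).choose (d - 1) + (k + (d - 1)).choose (d - 1)) * finrank ℂ S := by
  obtain ⟨e, rfl⟩ : ∃ e, d = e + 1 := ⟨d - 1, by omega⟩
  have h := isGradedDirac_homDirac hd hB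
  rcases k with _ | k
  · have : finrank ℂ (radialPart (F := HomSpinor _ S) (homRadiusSq (e + 1 + 1) S) (0 + 1)) = 0 := finrank_bot _ _
    rw [this, finrank_homSpinor]
    simp only [Nat.add_sub_cancel, zero_add, Nat.choose_self]
    rw [add_comm 1 (e + 1), Nat.choose_succ_self_right, add_comm 1 e, Nat.choose_succ_self_right]
  · have : finrank ℂ (radialPart (F := HomSpinor _ S) (homRadiusSq (e + 1 + 1) S) (k + 1 + 1)) =
        finrank ℂ (HomSpinor (e + 1 + 1) S k) := LinearMap.finrank_range_of_inj (h.inj k)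
    rw [this, finrank_homSpinor, finrank_homSpinor, ← add_mul, Nat.add_sub_cancel]
    congr 1
    have h1 := Nat.choose_succ_succ (k + e + 2) e
    have h2 := Nat.choose_succ_succ (k + e + 1) e
    rw [show k + 1 + 1 + (e + 1) = (k + e + 2).succ by omega, h1,
      show k + e + 2 = (k + e + 1).succ by omega, h2, show k + 1 + 1 + e = (k + e + 1).succ by omega,
      show k + 1 + e = k + e + 1 by omega, show k + (e + 1) = k + e + 1 by omega]
    simp only [Nat.succ_eq_add_one]
    omega

/-- The dimensions of the two eigenspaces of the Dirac operator in degree `k`. -/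
theorem finrank_eigenspace_homDirac {d : ℕ} (hd : 1 ≤ d)
    {B : Fin (d + 1) → Fin (d + 1) → End ℂ S} (hB : IsCliffordFamily B) :
    (∀ k : ℕ, finrank ℂ (diracEigenspace B k (k : ℂ)) =
      (k + (d - 1)).choose (d - 1) * finrank ℂ S) ∧
    (∀ k : ℕ, finrank ℂ (diracEigenspace B (k + 1)
      (-(((k + 1 : ℕ) : ℂ) + ((d - 1 : ℕ) : ℂ)))) =
      (k + (d - 1)).choose (d - 1) * finrank ℂ S) := by
  have h := isGradedDirac_homDirac hd hB
  -- By this identity the two binomial coefficients in `hsub` stand in the ratio that the vanishing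
  -- trace prescribes for the two multiplicities.
  have key : ∀ k : ℕ, ((k + 1 : ℕ) : ℂ) * ((k + 1 + (d - 1)).choose (d - 1) : ℕ) =
      (((k + 1 : ℕ) : ℂ) + ((d - 1 : ℕ) : ℂ)) * ((k + (d - 1)).choose (d - 1) : ℕ) := by
    intro k
    have := Nat.choose_mul_succ_eq (k + (d - 1)) (d - 1)
    rw [show k + (d - 1) + 1 - (d - 1) = k + 1 by omega,
      show k + (d - 1) + 1 = k + 1 + (d - 1) by omega] at this
    have h2 : (((k + (d - 1)).choose (d - 1) * (k + 1 + (d - 1)) : ℕ) : ℂ) =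
      (((k + 1 + (d - 1)).choose (d - 1) * (k + 1) : ℕ) : ℂ) := by rw [this]
    push_cast at h2 ⊢
    linear_combination -h2
  have hne : ∀ k : ℕ, ((k + 1 : ℕ) : ℂ) + (((k + 1 : ℕ) : ℂ) + ((d - 1 : ℕ) : ℂ)) ≠ 0 := by
    intro k
    have : 0 < (k + 1) + ((k + 1) + (d - 1)) := by omega
    exact_mod_cast this.ne'
  have hsub : ∀ k : ℕ, (finrank ℂ (HomSpinor (d + 1) S (k + 1)) : ℂ) -
      finrank ℂ (radialPart (F := HomSpinor _ S) (homRadiusSq (d + 1) S) (k + 1)) =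
      (((k + 1 + (d - 1)).choose (d - 1) : ℕ) + ((k + (d - 1)).choose (d - 1) : ℕ)) *
        finrank ℂ S := by
    intro k
    rw [finrank_homSpinor_sub hd hB]
    push_cast
    ring
  refine ⟨fun k => ?_, fun k => ?_⟩
  · rcases k with _ | k
    · have : diracEigenspace B 0 ((0 : ℕ) : ℂ) = ⊤ := by
        rw [eq_top_iff]
        intro u _
        rw [mem_eigenspace_iff, h.zero, Nat.cast_zero, zero_smul]
      rw [this, finrank_top, finrank_homSpinor]
      simp
    · have h1 := (h.eigenspaces (k := k + 1) (by omega)).1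
      rw [hsub] at h1
      have h2 : (finrank ℂ (diracEigenspace B (k + 1) ((k + 1 : ℕ) : ℂ)) : ℂ) =
          ((k + 1 + (d - 1)).choose (d - 1) * finrank ℂ S : ℕ) := by
        refine mul_left_cancel₀ (hne k) (h1.trans ?_)
        push_cast
        have := key k
        push_cast at this
        linear_combination -(finrank ℂ S : ℂ) * this
      exact_mod_cast h2
  · have h1 := (h.eigenspaces (k := k + 1) (by omega)).2.1
    rw [hsub] at h1
    have h2 : (finrank ℂ (diracEigenspace B (k + 1)
        (-(((k + 1 : ℕ) : ℂ) + ((d - 1 : ℕ) : ℂ)))) : ℂ) =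
        ((k + (d - 1)).choose (d - 1) * finrank ℂ S : ℕ) := by
      refine mul_left_cancel₀ (hne k) (h1.trans ?_)
      push_cast
      have := key k
      push_cast at this
      linear_combination (finrank ℂ S : ℂ) * this
    exact_mod_cast h2

end Polynomials

end SphereDirac

end


noncomputable section

namespace SphereDirac

/-! ### The Clifford relations of a spinor module -/

variable {d : ℕ}

/-- Clifford multiplication as a real bilinear map. -/
def cliffordBilin (ρ : SpinorModule d) :
    Ambient d →ₗ[ℝ] Ambient d →ₗ[ℝ] (Spinor d →L[ℂ] Spinor d) :=
  (CliffordAlgebra.even.ι (negNormSq d)).bilin.compr₂ ρ.rep.toLinearMap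

lemma cliffordBilin_apply (ρ : SpinorModule d) (x y : Ambient d) :
    cliffordBilin ρ x y = cliffordMul ρ x y := rfl

lemma negNormSq_apply (x : Ambient d) : negNormSq d x = -(‖x‖ ^ 2) := by
  simp [negNormSq]

lemma cliffordBilin_self (ρ : SpinorModule d) (x : Ambient d) :
    cliffordBilin ρ x x = -(‖x‖ ^ 2) • (1 : Spinor d →L[ℂ] Spinor d) := by
  have h := (CliffordAlgebra.even.ι (negNormSq d)).contract x
  rw [cliffordBilin_apply, cliffordMul, h, AlgHom.commutes, negNormSq_apply,
    Algebra.algebraMap_eq_smul_one]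

lemma cliffordBilin_mul_mid (ρ : SpinorModule d) (x y z : Ambient d) :
    cliffordBilin ρ x y * cliffordBilin ρ y z = -(‖y‖ ^ 2) • cliffordBilin ρ x z := by
  have h := (CliffordAlgebra.even.ι (negNormSq d)).contract_mid x y z
  simp only [cliffordBilin_apply, cliffordMul, ← map_mul, h, map_smul, negNormSq_apply]

lemma cliffordBilin_add_swap (ρ : SpinorModule d) (x y : Ambient d) :
    cliffordBilin ρ x y + cliffordBilin ρ y x =
      -(2 * ⟪x, y⟫) • (1 : Spinor d →L[ℂ] Spinor d) := by
  have h := cliffordBilin_self ρ (x + y)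
  rw [map_add, map_add, LinearMap.add_apply, LinearMap.add_apply, cliffordBilin_self,
    cliffordBilin_self, norm_add_sq_real] at h
  have e : cliffordBilin ρ x y + cliffordBilin ρ y x =
      -(‖x‖ ^ 2 + 2 * ⟪x, y⟫ + ‖y‖ ^ 2) • (1 : Spinor d →L[ℂ] Spinor d)
        + (‖x‖ ^ 2) • (1 : Spinor d →L[ℂ] Spinor d) + (‖y‖ ^ 2) • (1 : Spinor d →L[ℂ] Spinor d) := by
    rw [← h]
    module
  rw [e]
  module

/-- Polarisation of `cliffordBilin_mul_mid` in the middle vector. -/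
lemma cliffordBilin_mul_swap (ρ : SpinorModule d) (w x y z : Ambient d) :
    cliffordBilin ρ w x * cliffordBilin ρ y z =
      -(cliffordBilin ρ w y * cliffordBilin ρ x z) - (2 * ⟪x, y⟫) • cliffordBilin ρ w z := by
  have h := cliffordBilin_mul_mid ρ w (x + y) z
  rw [map_add, map_add, LinearMap.add_apply, mul_add, add_mul, add_mul, cliffordBilin_mul_mid,
    cliffordBilin_mul_mid, norm_add_sq_real] at h
  have e : cliffordBilin ρ w x * cliffordBilin ρ y z =
      -(‖x‖ ^ 2 + 2 * ⟪x, y⟫ + ‖y‖ ^ 2) • cliffordBilin ρ w z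
        + (‖x‖ ^ 2) • cliffordBilin ρ w z + (‖y‖ ^ 2) • cliffordBilin ρ w z
        - cliffordBilin ρ w y * cliffordBilin ρ x z := by
    rw [← h]
    module
  rw [e]
  module

lemma inner_cliffordBilin_left (ρ : SpinorModule d) (x y : Ambient d) (v w : Spinor d) :
    inner ℂ (cliffordBilin ρ x y v) w = inner ℂ v (cliffordBilin ρ y x w) := by
  have h := ρ.adjoint_rep y x
  rw [cliffordBilin_apply, cliffordBilin_apply, cliffordMul, cliffordMul, ← h,
    ContinuousLinearMap.adjoint_inner_left]

/-- The standard basis vectors of the ambient space. -/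
abbrev stdVec (d : ℕ) (i : Fin (d + 1)) : Ambient d := EuclideanSpace.single i (1 : ℝ)

/-- Clifford multiplication in coordinates. -/
def cliffordFamily (ρ : SpinorModule d) (i j : Fin (d + 1)) : Module.End ℂ (Spinor d) :=
  (cliffordBilin ρ (stdVec d i) (stdVec d j)).toLinearMap

lemma inner_stdVec (i j : Fin (d + 1)) : ⟪stdVec d i, stdVec d j⟫ = if i = j then 1 else 0 := by
  simp [stdVec, EuclideanSpace.inner_single_left]

lemma isCliffordFamily_cliffordFamily (ρ : SpinorModule d) :
    IsCliffordFamily (cliffordFamily ρ) where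
  mid i j k := by
    have h := cliffordBilin_mul_mid ρ (stdVec d i) (stdVec d j) (stdVec d k)
    ext1 v
    have h := DFunLike.congr_fun h v
    simpa [cliffordFamily] using h
  anti i j := by
    have h := cliffordBilin_add_swap ρ (stdVec d i) (stdVec d j)
    rw [inner_stdVec] at h
    refine LinearMap.ext fun v => ?_
    have h := DFunLike.congr_fun h v
    by_cases hij : i = j
    · rw [if_pos hij] at h ⊢
      have e : (-2 : Module.End ℂ (Spinor d)) v = -(v + v) := by
        have e2 : (-2 : Module.End ℂ (Spinor d)) = -(1 + 1) := by norm_num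
        rw [e2]
        rfl
      rw [e]
      refine h.trans ?_
      simp [two_smul]
    · rw [if_neg hij] at h ⊢
      refine h.trans ?_
      simp
  swap i j k l := by
    have h := cliffordBilin_mul_swap ρ (stdVec d i) (stdVec d j) (stdVec d k) (stdVec d l)
    rw [inner_stdVec] at h
    refine LinearMap.ext fun v => ?_
    have h := DFunLike.congr_fun h v
    by_cases hij : j = k
    · rw [if_pos hij] at h ⊢
      refine h.trans ?_
      simp [two_smul, cliffordFamily, two_mul]
    · rw [if_neg hij] at h ⊢
      refine h.trans ?_
      simp [cliffordFamily]

lemma sum_smul_stdVec (x : Ambient d) : ∑ i, x i • stdVec d i = x := by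
  have := (EuclideanSpace.basisFun (Fin (d + 1)) ℝ).sum_repr x
  simpa using this

end SphereDirac

end


noncomputable section

namespace SphereDirac

/-! ### Radial extensions and the Dirac operator in ambient coordinates -/

variable {d : ℕ}

instance factFinrankAmbient : Fact (Module.finrank ℝ (Ambient d) = d + 1) :=
  ⟨by simp⟩

lemma norm_coe_sph (x : Sph d) : ‖(x : Ambient d)‖ = 1 := norm_eq_of_mem_sphere x

lemma coe_sph_ne_zero (x : Sph d) : (x : Ambient d) ≠ 0 := ne_zero_of_mem_unit_sphere x

lemma radialExtension_coe (ψ : Sph d → Spinor d) (x : Sph d) :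
    radialExtension ψ x = ψ x := by
  rw [radialExtension, dif_neg (coe_sph_ne_zero x)]
  congr 1
  apply Subtype.ext
  simp

lemma radialExtension_smul (ψ : Sph d → Spinor d) {t : ℝ} (ht : 0 < t) (y : Ambient d) :
    radialExtension ψ (t • y) = radialExtension ψ y := by
  by_cases hy : y = 0
  · simp [hy]
  · have hty : t • y ≠ 0 := smul_ne_zero ht.ne' hy
    rw [radialExtension, radialExtension, dif_neg hy, dif_neg hty]
    congr 1
    apply Subtype.ext
    change ‖t • y‖⁻¹ • t • y = ‖y‖⁻¹ • y
    rw [norm_smul, Real.norm_of_nonneg ht.le, smul_smul]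
    congr 1
    field_simp

lemma contDiffAt_radialExtension {ψ : Sph d → Spinor d}
    (hψ : ContMDiff (𝓡 d) 𝓘(ℝ, Spinor d) ∞ ψ) {y : Ambient d} (hy : y ≠ 0) :
    ContDiffAt ℝ ∞ (radialExtension ψ) y := by
  let U : TopologicalSpace.Opens (Ambient d) := ⟨{0}ᶜ, isOpen_compl_singleton⟩
  have hU : ∀ z : U, (z : Ambient d) ≠ 0 := fun z => z.2
  have hg : ContMDiff 𝓘(ℝ, Ambient d) 𝓘(ℝ, Ambient d) ∞
      (fun z : U => ‖(z : Ambient d)‖⁻¹ • (z : Ambient d)) := by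
    intro z
    refine (contMDiffAt_subtype_iff (f := fun z : Ambient d => ‖z‖⁻¹ • z)).2 ?_
    refine ContDiffAt.contMDiffAt ?_
    exact ((contDiffAt_norm ℝ (hU z)).inv (norm_ne_zero_iff.2 (hU z))).smul contDiffAt_id
  have hs : ∀ z : U, ‖(z : Ambient d)‖⁻¹ • (z : Ambient d) ∈ sphere (0 : Ambient d) 1 := by
    intro z
    simp [norm_smul, inv_mul_cancel₀ (norm_ne_zero_iff.mpr (hU z))]
  have h1 := hψ.comp (hg.codRestrict_sphere (n := d) hs)
  have h2 := h1.contMDiffAt (x := (⟨y, hy⟩ : U))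
  have h3 : ContMDiffAt 𝓘(ℝ, Ambient d) 𝓘(ℝ, Spinor d) ∞
      (fun z : U => radialExtension ψ z) (⟨y, hy⟩ : U) := by
    refine h2.congr_of_eventuallyEq (Eventually.of_forall fun z => ?_)
    exact dif_neg (hU z)
  exact (contMDiffAt_subtype_iff.1 h3).contDiffAt

lemma differentiableAt_radialExtension {ψ : Sph d → Spinor d}
    (hψ : ContMDiff (𝓡 d) 𝓘(ℝ, Spinor d) ∞ ψ) {y : Ambient d} (hy : y ≠ 0) :
    DifferentiableAt ℝ (radialExtension ψ) y :=
  (contDiffAt_radialExtension hψ hy).differentiableAt (by simp)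

lemma fderiv_radialExtension_self (ψ : Sph d → Spinor d) (y : Ambient d) :
    fderiv ℝ (radialExtension ψ) y y = 0 := by
  by_cases h : DifferentiableAt ℝ (radialExtension ψ) y
  · have h1 : HasDerivAt (fun t : ℝ => radialExtension ψ ((1 + t) • y))
        (fderiv ℝ (radialExtension ψ) y y) 0 := by
      have h2 : HasDerivAt (fun t : ℝ => (1 + t) • y) y 0 := by
        simpa using (((hasDerivAt_id (0 : ℝ)).const_add 1).smul_const y)
      have h3 : HasFDerivAt (radialExtension ψ) (fderiv ℝ (radialExtension ψ) y)
          ((1 + (0 : ℝ)) • y) := by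
        simpa using h.hasFDerivAt
      exact h3.comp_hasDerivAt (0 : ℝ) h2
    have h4 : (fun t : ℝ => radialExtension ψ ((1 + t) • y)) =ᶠ[𝓝 0]
        fun _ => radialExtension ψ y := by
      filter_upwards [lt_mem_nhds (show (-1 : ℝ) < 0 by norm_num)] with t ht
      exact radialExtension_smul ψ (by linarith) y
    exact h1.unique ((hasDerivAt_const (0 : ℝ) _).congr_of_eventuallyEq h4)
  -- Without differentiability `fderiv` is `0` by convention, and no smoothness hypothesis is
  -- needed.
  · rw [fderiv_zero_of_not_differentiableAt h]; rfl

/-- A tangential derivative may be computed with any extension of the field. -/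
lemma tangentDeriv_eq_fderiv {ψ : Sph d → Spinor d} {F : Ambient d → Spinor d}
    (hF : Differentiable ℝ F) (h : ∀ y : Sph d, ψ y = F y) (x : Sph d) {X : Ambient d}
    (hX : ⟪(x : Ambient d), X⟫ = 0) : tangentDeriv ψ x X = fderiv ℝ F x X := by
  -- The norm is written as the root of its square. The derivative of the normalising factor along
  -- `X` is proportional to `⟪x, X⟫ = 0`, so only the derivative of `F` survives.
  have hs : DifferentiableAt ℝ (fun s : ℝ => (√s)⁻¹) (‖(x : Ambient d)‖ ^ 2) := by
    rw [norm_coe_sph]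
    exact (differentiableAt_id.sqrt (by norm_num)).inv (by norm_num)
  have hn := (hasStrictFDerivAt_norm_sq (x : Ambient d)).hasFDerivAt
  have hφ := hs.hasDerivAt.comp_hasFDerivAt (x : Ambient d) hn
  have hN : HasFDerivAt (fun y : Ambient d => (√(‖y‖ ^ 2))⁻¹ • y) _ (x : Ambient d) :=
    hφ.smul (hasFDerivAt_id (x : Ambient d))
  have e1 : (√(‖(x : Ambient d)‖ ^ 2))⁻¹ • (x : Ambient d) = x := by
    simp
  have hF' : HasFDerivAt F (fderiv ℝ F x) ((√(‖(x : Ambient d)‖ ^ 2))⁻¹ • (x : Ambient d)) := by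
    rw [e1]
    exact (hF _).hasFDerivAt
  have hc := HasFDerivAt.comp (f := fun y : Ambient d => (√(‖y‖ ^ 2))⁻¹ • y) (x : Ambient d) hF' hN
  have he : radialExtension ψ =ᶠ[𝓝 (x : Ambient d)]
      (F ∘ fun y : Ambient d => (√(‖y‖ ^ 2))⁻¹ • y) := by
    filter_upwards [isOpen_ne.mem_nhds (coe_sph_ne_zero x)] with y hy
    rw [radialExtension, dif_neg hy, h, Function.comp_apply, Real.sqrt_sq (norm_nonneg y)]
  rw [tangentDeriv, (hc.congr_of_eventuallyEq he).fderiv]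
  simp [hX]

/-- The trace of a bilinear form does not depend on the orthonormal basis; completing a basis of the
tangent space by the unit normal `x` adds `β x x`. -/
lemma sum_bilin_orthogonal {V : Type*} [AddCommGroup V] [Module ℝ V] (x : Sph d)
    (β : Ambient d →ₗ[ℝ] Ambient d →ₗ[ℝ] V) :
    ∑ j, β (stdOrthonormalBasis ℝ (ℝ ∙ (x : Ambient d))ᗮ j : Ambient d)
      (stdOrthonormalBasis ℝ (ℝ ∙ (x : Ambient d))ᗮ j : Ambient d) =
    ∑ i, β (stdVec d i) (stdVec d i) - β x x := by
  set f := stdOrthonormalBasis ℝ (ℝ ∙ (x : Ambient d))ᗮ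
  have hproj : ∀ y : Ambient d, ∑ j, ⟪(f j : Ambient d), y⟫ • (f j : Ambient d) =
      y - ⟪(x : Ambient d), y⟫ • (x : Ambient d) := by
    intro y
    have hmem : y - ⟪(x : Ambient d), y⟫ • (x : Ambient d) ∈ (ℝ ∙ (x : Ambient d))ᗮ := by
      rw [Submodule.mem_orthogonal_singleton_iff_inner_right, inner_sub_right, inner_smul_right,
        real_inner_self_eq_norm_sq, norm_coe_sph]
      ring
    have h := congrArg Subtype.val (f.sum_repr' ⟨_, hmem⟩)
    simp only [Submodule.coe_sum, Submodule.coe_smul, Submodule.coe_inner] at h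
    rw [← h]
    refine Finset.sum_congr rfl fun j _ => ?_
    have h0 : ⟪(f j : Ambient d), (x : Ambient d)⟫ = 0 :=
      Submodule.mem_orthogonal_singleton_iff_inner_left.1 (f j).2
    rw [inner_sub_right, inner_smul_right, h0, mul_zero, sub_zero]
  calc ∑ j, β (f j : Ambient d) (f j : Ambient d)
      = ∑ j, ∑ i, β (stdVec d i) (⟪(f j : Ambient d), stdVec d i⟫ • (f j : Ambient d)) := by
        refine Finset.sum_congr rfl fun j _ => ?_
        have h := congrArg (fun y => β y (f j : Ambient d)) (sum_smul_stdVec (f j : Ambient d))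
        simp only [map_sum, LinearMap.sum_apply, map_smul, LinearMap.smul_apply] at h
        rw [← h]
        refine Finset.sum_congr rfl fun i _ => ?_
        rw [map_smul]
        congr 1
        simp [stdVec, EuclideanSpace.inner_single_right]
    _ = ∑ i, β (stdVec d i) (stdVec d i - (x : Ambient d) i • (x : Ambient d)) := by
        rw [Finset.sum_comm]
        refine Finset.sum_congr rfl fun i _ => ?_
        rw [← map_sum, hproj]
        congr 3
        simp [stdVec, EuclideanSpace.inner_single_right]
    _ = _ := by
        simp only [map_sub, map_smul, Finset.sum_sub_distrib]
        congr 1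
        conv_rhs => enter [1]; rw [← sum_smul_stdVec (x : Ambient d)]
        simp only [map_sum, map_smul, LinearMap.sum_apply, LinearMap.smul_apply]

/-- The Dirac operator in ambient coordinates, up to a constant. -/
def ambientDirac (ρ : SpinorModule d) (F : Ambient d → Spinor d) (y : Ambient d) : Spinor d :=
  ∑ i, cliffordBilin ρ y (stdVec d i) (fderiv ℝ F y (stdVec d i)) + fderiv ℝ F y y

/-- The difference of the Dirac operator and `ambientDirac`. -/
def diracShift : {d : ℕ} → SpinStructure d → ℝ
  | d, .bounding _ => (d : ℝ) / 2
  | _, .trivial => 0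

/-- The normal term of the full trace is `x * x` applied to `D x`, that is `-D x`. Subtracting it
produces the Euler term of `ambientDirac`. -/
lemma sum_clifford_orthogonal (ρ : SpinorModule d) (x : Sph d)
    (D : Ambient d →L[ℝ] Spinor d) :
    ∑ j, cliffordMul ρ x (stdOrthonormalBasis ℝ (ℝ ∙ (x : Ambient d))ᗮ j : Ambient d)
      (D (stdOrthonormalBasis ℝ (ℝ ∙ (x : Ambient d))ᗮ j : Ambient d)) =
    ∑ i, cliffordBilin ρ x (stdVec d i) (D (stdVec d i)) + D x := by
  let ev : (Spinor d →L[ℂ] Spinor d) →ₗ[ℝ] Spinor d →ₗ[ℝ] Spinor d :=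
    LinearMap.mk₂ ℝ (fun T v => T v) (fun _ _ _ => rfl) (fun _ _ _ => rfl)
      (fun T v w => map_add T v w) (fun c T v => (T.restrictScalars ℝ).map_smul c v)
  let β : Ambient d →ₗ[ℝ] Ambient d →ₗ[ℝ] Spinor d :=
    ev.compl₁₂ (cliffordBilin ρ x) D.toLinearMap
  have h := sum_bilin_orthogonal x β
  have hβ : ∀ X Y, β X Y = cliffordMul ρ x X (D Y) := fun _ _ => rfl
  simp only [hβ, ← cliffordBilin_apply, cliffordBilin_self, norm_coe_sph] at h ⊢
  rw [h]
  simp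

lemma cliffordBilin_sq_of_inner_eq_zero (ρ : SpinorModule d) {x X : Ambient d}
    (hx : ‖x‖ = 1) (hX : ‖X‖ = 1) (h : ⟪x, X⟫ = 0) (v : Spinor d) :
    cliffordBilin ρ x X (cliffordBilin ρ x X v) = -v := by
  have h1 := cliffordBilin_mul_swap ρ x X x X
  rw [real_inner_comm, h, cliffordBilin_self, cliffordBilin_self, hx, hX] at h1
  have := DFunLike.congr_fun h1 v
  simpa using this

/-- For the bounding structure each of the `d` tangent directions contributes `-(1/2)(x e_j)² = 1/2`
through the connection, whence the shift `d/2`. -/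
lemma dirac_eq_ambientDirac (σ : SpinStructure d) (ρ : SpinorModule d) {ψ : Sph d → Spinor d}
    {F : Ambient d → Spinor d} (x : Sph d)
    (h : ∀ X : Ambient d, ⟪(x : Ambient d), X⟫ = 0 → tangentDeriv ψ x X = fderiv ℝ F x X) :
    dirac σ ρ ψ x = ambientDirac ρ F x + (diracShift σ : ℂ) • ψ x := by
  set f := stdOrthonormalBasis ℝ (ℝ ∙ (x : Ambient d))ᗮ with hf
  have h0 : ∀ j, ⟪(x : Ambient d), (f j : Ambient d)⟫ = 0 := fun j =>
    Submodule.mem_orthogonal_singleton_iff_inner_right.1 (f j).2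
  have hsum := sum_clifford_orthogonal ρ x (fderiv ℝ F x)
  rw [ambientDirac, ← hsum, ← hf]
  cases σ with
  | trivial =>
    simp only [dirac, spinConnection, diracShift, ← hf, Complex.ofReal_zero, zero_smul, add_zero]
    exact Finset.sum_congr rfl fun j _ => by rw [h _ (h0 j)]
  | bounding =>
    simp only [dirac, spinConnection, diracShift, ← hf]
    have hj : ∀ j, cliffordMul ρ x (f j) (tangentDeriv ψ x (f j) -
        (1 / 2 : ℂ) • cliffordMul ρ x (f j) (ψ x)) =
        cliffordMul ρ x (f j) (fderiv ℝ F x (f j)) + (1 / 2 : ℂ) • ψ x := by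
      intro j
      have hn : ‖(f j : Ambient d)‖ = 1 := f.orthonormal.1 j
      have := cliffordBilin_sq_of_inner_eq_zero ρ (norm_coe_sph x) hn (h0 j) (ψ x)
      rw [cliffordBilin_apply] at this
      rw [map_sub, map_smul, this, h _ (h0 j), smul_neg, sub_neg_eq_add]
    rw [Finset.sum_congr rfl fun j _ => hj j, Finset.sum_add_distrib, Finset.sum_const,
      Finset.card_univ, Fintype.card_fin]
    congr 1
    rw [Submodule.finrank_orthogonal_span_singleton (n := d) (coe_sph_ne_zero x),
      ← Nat.cast_smul_eq_nsmul ℂ, smul_smul]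
    congr 1
    push_cast
    ring

lemma dirac_eq_of_contMDiff (σ : SpinStructure d) (ρ : SpinorModule d) (ψ : Sph d → Spinor d)
    (x : Sph d) :
    dirac σ ρ ψ x = ambientDirac ρ (radialExtension ψ) x + (diracShift σ : ℂ) • ψ x :=
  dirac_eq_ambientDirac σ ρ x fun _ _ => rfl

lemma dirac_eq_of_extension (σ : SpinStructure d) (ρ : SpinorModule d) {ψ : Sph d → Spinor d}
    {F : Ambient d → Spinor d} (hF : Differentiable ℝ F) (h : ∀ y : Sph d, ψ y = F y) (x : Sph d) :
    dirac σ ρ ψ x = ambientDirac ρ F x + (diracShift σ : ℂ) • F x := by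
  rw [dirac_eq_ambientDirac σ ρ x fun X hX => tangentDeriv_eq_fderiv hF h x hX, h]

end SphereDirac

end


noncomputable section

namespace SphereDirac

/-! ### Symmetry of the Dirac operator -/

variable {d : ℕ}

lemma integral_fderiv_eq_zero {E : Type*} [NormedAddCommGroup E] [NormedSpace ℝ E]
    [FiniteDimensional ℝ E] [MeasurableSpace E] [BorelSpace E] (μ : Measure E)
    [μ.IsAddHaarMeasure] {G : E → ℂ} (hG : ContDiff ℝ 1 G) (hc : HasCompactSupport G) (v : E) :
    ∫ y, fderiv ℝ G y v ∂μ = 0 := by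
  have hd : Continuous fun y => fderiv ℝ G y v := (hG.continuous_fderiv one_ne_zero).clm_apply
    continuous_const
  have hcd : HasCompactSupport fun y => fderiv ℝ G y v := hc.fderiv_apply ℝ v
  have h := integral_smul_fderiv_eq_neg_fderiv_smul_of_integrable (μ := μ) (f := fun _ : E => (1 : ℝ))
    (g := G) (v := v) (by simp) (by simpa using hd.integrable_of_hasCompactSupport hcd)
    (by simpa using hG.continuous.integrable_of_hasCompactSupport hc)
    (fun _ _ => differentiableAt_const _) (fun _ _ => hG.differentiable one_ne_zero _)
  simpa using h

/-- A smooth bump function of the squared radius. -/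
def radialBump : ContDiffBump (1 : ℝ) := ⟨1 / 4, 1 / 2, by norm_num, by norm_num⟩

lemma radialBump_eq_zero {s : ℝ} (hs : s < 1 / 2 ∨ 3 / 2 < s) : radialBump s = 0 := by
  refine radialBump.zero_of_le_dist ?_
  change (1 / 2 : ℝ) ≤ dist s 1
  rw [Real.dist_eq, le_abs]
  rcases hs with h | h
  · right; linarith
  · left; linarith

lemma hasCompactSupport_radialBump {F : Type*} [Zero F] {G : Ambient d → F}
    (hG : ∀ y, radialBump (‖y‖ ^ 2) = 0 → G y = 0) : HasCompactSupport G := by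
  refine HasCompactSupport.intro (isCompact_closedBall (0 : Ambient d) 2) fun y hy => hG y ?_
  refine radialBump_eq_zero (Or.inr ?_)
  rw [mem_closedBall_zero_iff, not_le] at hy
  nlinarith

/-- Polar coordinates for a function of the radius times a function of the direction. -/
lemma integral_radial_mul (d : ℕ) (b : ℝ → ℂ) {g : Ambient d → ℂ}
    (hg : ∀ (t : ℝ) (y : Ambient d), 0 < t → g (t • y) = g y) :
    ∫ y : Ambient d, b ‖y‖ * g y =
      (∫ x : Sph d, g (x : Ambient d) ∂sphVolume d) * ∫ r : Set.Ioi (0 : ℝ), b (r : ℝ) ∂(Measure.volumeIoiPow d) := by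
  have hdim : Module.finrank ℝ (Ambient d) - 1 = d := by simp
  calc ∫ y : Ambient d, b ‖y‖ * g y
      = ∫ y : ({(0)}ᶜ : Set (Ambient d)), b ‖y.1‖ * g y.1 ∂(volume.comap Subtype.val) := by
        rw [integral_subtype_comap (measurableSet_singleton _).compl fun y : Ambient d => b ‖y‖ * g y,
          restrict_compl_singleton]
    _ = ∫ p : Sph d × Set.Ioi (0 : ℝ), g (p.1 : Ambient d) * b (p.2 : ℝ)
          ∂(sphVolume d).prod (Measure.volumeIoiPow d) := by
        have h := (volume : Measure (Ambient d)).measurePreserving_homeomorphUnitSphereProd.integral_comp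
          (Homeomorph.measurableEmbedding _) (fun p : Sph d × Set.Ioi (0 : ℝ) => g (p.1 : Ambient d) * b (p.2 : ℝ))
        rw [hdim] at h
        rw [← h]
        refine integral_congr_ae (Eventually.of_forall fun y => ?_)
        have hy : 0 < ‖(y : Ambient d)‖ := norm_pos_iff.2 y.2
        have := hg ‖(y : Ambient d)‖⁻¹ y (inv_pos.2 hy)
        simp [mul_comm, this]
    _ = _ := integral_prod_mul (fun x : Sph d => g (x : Ambient d))
        (fun r : Set.Ioi (0 : ℝ) => b (r : ℝ))

/-- In polar coordinates the solid integral is the spherical one times a radial factor, which is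
nonzero because the formula with `g = 1` computes a positive integral. -/
lemma integral_sphere_eq_zero {g : Ambient d → ℂ}
    (hg : ∀ (t : ℝ) (y : Ambient d), 0 < t → g (t • y) = g y)
    (h : ∫ y : Ambient d, (radialBump (‖y‖ ^ 2) : ℂ) * g y = 0) :
    ∫ x : Sph d, g x ∂sphVolume d = 0 := by
  have h1 := integral_radial_mul d (fun r => (radialBump (r ^ 2) : ℂ)) hg
  have h2 := integral_radial_mul d (fun r => (radialBump (r ^ 2) : ℂ)) (g := fun _ => 1)
    (fun _ _ _ => rfl)
  have h3 : 0 < ∫ y : Ambient d, radialBump (‖y‖ ^ 2) := by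
    refine Continuous.integral_pos_of_hasCompactSupport_nonneg_nonzero
      (x := stdVec d 0) ?_ (hasCompactSupport_radialBump fun _ h => h)
      (fun _ => radialBump.nonneg) ?_
    · exact radialBump.continuous.comp (continuous_norm.pow 2)
    · have : ‖stdVec d 0‖ ^ 2 = 1 := by simp
      rw [this, radialBump.one_of_mem_closedBall]
      · exact one_ne_zero
      · exact mem_closedBall_self (by simp [radialBump])
  have h4 : ∫ y : Ambient d, (radialBump (‖y‖ ^ 2) : ℂ) * 1 ≠ 0 := by
    simp only [mul_one]
    rw [integral_complex_ofReal]
    exact_mod_cast h3.ne'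
  rw [h2] at h4
  rw [h1] at h
  exact (mul_eq_zero.1 h).resolve_right (right_ne_zero_of_mul h4)

/-! ### The vector field whose divergence measures the failure of symmetry. -/

/-- Clifford multiplication as a continuous linear map of the base point. -/
def cliffordCLM (ρ : SpinorModule d) (X : Ambient d) :
    Ambient d →L[ℝ] Spinor d →L[ℝ] Spinor d :=
  LinearMap.toContinuousLinearMap
    { toFun := fun y => (cliffordBilin ρ y X).restrictScalars ℝ
      map_add' := fun y z => by rw [map_add]; rfl
      map_smul' := fun c y => by rw [map_smul]; rfl }

lemma cliffordCLM_apply (ρ : SpinorModule d) (X y : Ambient d) (v : Spinor d) :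
    cliffordCLM ρ X y v = cliffordBilin ρ y X v := rfl

/-- The components of the vector field whose divergence is the defect of symmetry. -/
def symmetryField (ρ : SpinorModule d) (Φ Ψ : Ambient d → Spinor d) (i : Fin (d + 1))
    (y : Ambient d) : ℂ :=
  inner ℂ (Φ y) (cliffordCLM ρ (stdVec d i) y (Ψ y)) + ((y i : ℝ) : ℂ) * inner ℂ (Φ y) (Ψ y)

/-- The field is tangential to spheres: `y * y = -‖y‖²` cancels the second summand. Hence
differentiating a radial cut-off will contribute nothing. -/
lemma sum_smul_symmetryField (ρ : SpinorModule d) (Φ Ψ : Ambient d → Spinor d) (y : Ambient d) :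
    ∑ i, ((y i : ℝ) : ℂ) * symmetryField ρ Φ Ψ i y = 0 := by
  have h1 : ∑ i, ((y i : ℝ) : ℂ) • cliffordBilin ρ y (stdVec d i) (Ψ y) =
      -((‖y‖ ^ 2 : ℝ) : ℂ) • Ψ y := by
    have h := DFunLike.congr_fun (cliffordBilin_self ρ y) (Ψ y)
    have h2 := congrArg (fun z => cliffordBilin ρ y z (Ψ y)) (sum_smul_stdVec y)
    simp only [map_sum, map_smul, sum_apply, smul_apply] at h2
    simp only [Complex.coe_smul, neg_smul]
    rw [h2, h]
    simp
  have h3 : ((‖y‖ ^ 2 : ℝ) : ℂ) = ∑ i, ((y i : ℝ) : ℂ) * ((y i : ℝ) : ℂ) := by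
    rw [EuclideanSpace.norm_sq_eq]
    push_cast
    refine Finset.sum_congr rfl fun i _ => ?_
    rw [← pow_two, ← Complex.ofReal_pow, ← Complex.ofReal_pow, Real.norm_eq_abs, sq_abs]
  have h4 := congrArg (fun w => inner ℂ (Φ y) w) h1
  simp only [inner_sum, inner_smul_right] at h4
  simp only [symmetryField, mul_add, Finset.sum_add_distrib, cliffordCLM_apply, ← mul_assoc]
  rw [h4, ← Finset.sum_mul, ← h3]
  ring

/-- Differentiating the base point in `y * e_i` gives `e_i * e_i = -1`, and differentiating the
coordinate `y_i` gives `1`; these zeroth-order terms cancel. -/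
lemma fderiv_symmetryField (ρ : SpinorModule d) {Φ Ψ : Ambient d → Spinor d} {y : Ambient d}
    (hΦ : DifferentiableAt ℝ Φ y) (hΨ : DifferentiableAt ℝ Ψ y) (i : Fin (d + 1)) :
    DifferentiableAt ℝ (symmetryField ρ Φ Ψ i) y ∧
    fderiv ℝ (symmetryField ρ Φ Ψ i) y (stdVec d i) =
      inner ℂ (Φ y) (cliffordBilin ρ y (stdVec d i) (fderiv ℝ Ψ y (stdVec d i))) +
      inner ℂ (cliffordBilin ρ (stdVec d i) y (fderiv ℝ Φ y (stdVec d i))) (Ψ y) +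
      ((y i : ℝ) : ℂ) * (inner ℂ (Φ y) (fderiv ℝ Ψ y (stdVec d i)) +
        inner ℂ (fderiv ℝ Φ y (stdVec d i)) (Ψ y)) := by
  have h1 := ((cliffordCLM ρ (stdVec d i)).hasFDerivAt (x := y)).clm_apply hΨ.hasFDerivAt
  have h2 := hΦ.hasFDerivAt.inner ℂ h1
  have h3 := hΦ.hasFDerivAt.inner ℂ hΨ.hasFDerivAt
  have h4 := (Complex.ofRealCLM.comp (EuclideanSpace.proj (𝕜 := ℝ) i)).hasFDerivAt (x := y)
  have h5 := h2.add (h4.mul h3)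
  have h6 : HasFDerivAt (symmetryField ρ Φ Ψ i) _ y := h5
  refine ⟨h6.differentiableAt, ?_⟩
  have hc : cliffordCLM ρ (stdVec d i) (stdVec d i) (Ψ y) = -Ψ y := by
    have h := DFunLike.congr_fun (cliffordBilin_self ρ (stdVec d i)) (Ψ y)
    rw [cliffordCLM_apply, h]
    simp
  rw [h6.fderiv]
  simp [cliffordCLM_apply, hc, inner_cliffordBilin_left, -inner_neg_right]
  rw [inner_add_right, inner_neg_right]
  ring

lemma sum_smul_apply_stdVec {V : Type*} [NormedAddCommGroup V] [NormedSpace ℝ V]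
    (D : Ambient d →L[ℝ] V) (y : Ambient d) : ∑ i, y i • D (stdVec d i) = D y := by
  conv_rhs => rw [← sum_smul_stdVec y]
  simp only [map_sum, map_smul]

/-- Exchanging `e_i * y` for `-(y * e_i) - 2 y_i` leaves only radial derivatives besides the two
Dirac terms, and these vanish by hypothesis. -/
lemma sum_fderiv_symmetryField (ρ : SpinorModule d) {Φ Ψ : Ambient d → Spinor d} {y : Ambient d}
    (hΦ : DifferentiableAt ℝ Φ y) (hΨ : DifferentiableAt ℝ Ψ y)
    (hΦ' : fderiv ℝ Φ y y = 0) (hΨ' : fderiv ℝ Ψ y y = 0) :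
    ∑ i, fderiv ℝ (symmetryField ρ Φ Ψ i) y (stdVec d i) =
      inner ℂ (Φ y) (ambientDirac ρ Ψ y) - inner ℂ (ambientDirac ρ Φ y) (Ψ y) := by
  have h1 : ∀ i, cliffordBilin ρ (stdVec d i) y (fderiv ℝ Φ y (stdVec d i)) =
      -cliffordBilin ρ y (stdVec d i) (fderiv ℝ Φ y (stdVec d i)) -
        (2 : ℂ) • (y i • fderiv ℝ Φ y (stdVec d i)) := by
    intro i
    have h := DFunLike.congr_fun (cliffordBilin_add_swap ρ (stdVec d i) y)
      (fderiv ℝ Φ y (stdVec d i))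
    have h2 : ⟪stdVec d i, y⟫ = y i := by simp [stdVec, EuclideanSpace.inner_single_left]
    rw [h2] at h
    rw [eq_sub_of_add_eq (a := cliffordBilin ρ (stdVec d i) y (fderiv ℝ Φ y (stdVec d i))) h]
    simp only [neg_smul, smul_apply, one_apply_eq_self, mul_smul,
      two_smul]
    abel
  have hs1 := sum_smul_apply_stdVec (fderiv ℝ Φ y) y
  have hs2 := sum_smul_apply_stdVec (fderiv ℝ Ψ y) y
  rw [hΦ'] at hs1
  rw [hΨ'] at hs2
  have h4 : ∑ i, ((y i : ℝ) : ℂ) * (inner ℂ (Φ y) (fderiv ℝ Ψ y (stdVec d i)) +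
      inner ℂ (fderiv ℝ Φ y (stdVec d i)) (Ψ y)) = 0 := by
    have e1 := congrArg (fun w => inner ℂ (Φ y) w) hs2
    have e2 := congrArg (fun w => inner ℂ w (Ψ y)) hs1
    simp only [inner_sum, sum_inner, inner_zero_right, inner_zero_left, ← Complex.coe_smul,
      inner_smul_right, inner_smul_left, Complex.conj_ofReal] at e1 e2
    simp only [mul_add, Finset.sum_add_distrib, e1, e2, add_zero]
  simp only [(fderiv_symmetryField ρ hΦ hΨ _).2, Finset.sum_add_distrib, h4, add_zero]
  rw [← inner_sum, ← sum_inner]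
  simp only [h1, Finset.sum_sub_distrib, Finset.sum_neg_distrib, ← Finset.smul_sum, hs1,
    ambientDirac, hΦ', hΨ', add_zero, smul_zero, sub_zero, inner_neg_left]
  ring

/-- The symmetry field, cut off near the unit sphere. -/
def cutoffField (ρ : SpinorModule d) (Φ Ψ : Ambient d → Spinor d) (i : Fin (d + 1))
    (y : Ambient d) : ℂ := (radialBump (‖y‖ ^ 2) : ℂ) * symmetryField ρ Φ Ψ i y

lemma contDiff_cutoffField (ρ : SpinorModule d) {Φ Ψ : Ambient d → Spinor d}
    (hΦ : ∀ y, y ≠ 0 → ContDiffAt ℝ ∞ Φ y) (hΨ : ∀ y, y ≠ 0 → ContDiffAt ℝ ∞ Ψ y)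
    (i : Fin (d + 1)) : ContDiff ℝ 1 (cutoffField ρ Φ Ψ i) := by
  rw [contDiff_iff_contDiffAt]
  intro y
  by_cases hy : y = 0
  · have h0 : cutoffField ρ Φ Ψ i =ᶠ[𝓝 y] fun _ => 0 := by
      rw [hy]
      filter_upwards [ball_mem_nhds (0 : Ambient d) (show (0 : ℝ) < 1 / 2 by norm_num)] with z hz
      rw [mem_ball_zero_iff] at hz
      have : radialBump (‖z‖ ^ 2) = 0 :=
        radialBump_eq_zero (Or.inl (by nlinarith [norm_nonneg z]))
      rw [cutoffField, this, Complex.ofReal_zero, zero_mul]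
    exact contDiffAt_const.congr_of_eventuallyEq h0
  · have h1 : ContDiffAt ℝ 1 Φ y := (hΦ y hy).of_le (by exact_mod_cast le_top)
    have h2 : ContDiffAt ℝ 1 Ψ y := (hΨ y hy).of_le (by exact_mod_cast le_top)
    have h3 : ContDiffAt ℝ 1 (fun y : Ambient d => ((y i : ℝ) : ℂ)) y :=
      (Complex.ofRealCLM.comp (EuclideanSpace.proj (𝕜 := ℝ) i)).contDiff.contDiffAt
    have h4 : ContDiffAt ℝ 1 (fun y : Ambient d => (radialBump (‖y‖ ^ 2) : ℂ)) y :=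
      (Complex.ofRealCLM.contDiff.comp
        (radialBump.contDiff.comp (contDiff_norm_sq ℝ))).contDiffAt
    exact h4.mul ((h1.inner ℂ
      ((cliffordCLM ρ (stdVec d i)).contDiff.contDiffAt.clm_apply h2)).add (h3.mul (h1.inner ℂ h2)))

lemma sum_fderiv_cutoffField (ρ : SpinorModule d) {Φ Ψ : Ambient d → Spinor d} {y : Ambient d}
    (hΦ : DifferentiableAt ℝ Φ y) (hΨ : DifferentiableAt ℝ Ψ y) :
    ∑ i, fderiv ℝ (cutoffField ρ Φ Ψ i) y (stdVec d i) =
      (radialBump (‖y‖ ^ 2) : ℂ) * ∑ i, fderiv ℝ (symmetryField ρ Φ Ψ i) y (stdVec d i) := by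
  have hb : HasDerivAt radialBump (deriv radialBump (‖y‖ ^ 2)) (‖y‖ ^ 2) :=
    ((radialBump.contDiff (n := 1)).differentiable one_ne_zero _).hasDerivAt
  have hχ := hb.comp_hasFDerivAt y (hasStrictFDerivAt_norm_sq y).hasFDerivAt
  have hχ' := Complex.ofRealCLM.hasFDerivAt.comp y hχ
  have h : ∀ i, fderiv ℝ (cutoffField ρ Φ Ψ i) y (stdVec d i) =
      (radialBump (‖y‖ ^ 2) : ℂ) * fderiv ℝ (symmetryField ρ Φ Ψ i) y (stdVec d i) +
      ((2 * deriv radialBump (‖y‖ ^ 2) : ℝ) : ℂ) * (((y i : ℝ) : ℂ) * symmetryField ρ Φ Ψ i y) := by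
    intro i
    have h1 : HasFDerivAt (cutoffField ρ Φ Ψ i) _ y :=
      hχ'.mul (fderiv_symmetryField ρ hΦ hΨ i).1.hasFDerivAt
    rw [h1.fderiv]
    simp [stdVec, EuclideanSpace.inner_single_right]
    ring
  simp only [h, Finset.sum_add_distrib, ← Finset.mul_sum, sum_smul_symmetryField, mul_zero,
    add_zero]

lemma fderiv_radialExtension_smul (ψ : Sph d → Spinor d) {t : ℝ} (ht : 0 < t) (y : Ambient d) :
    t • fderiv ℝ (radialExtension ψ) (t • y) = fderiv ℝ (radialExtension ψ) y := by
  have h := fderiv_comp_smul (𝕜 := ℝ) (f := radialExtension ψ) t (x := y)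
  rw [← h]
  congr 1
  funext z
  exact radialExtension_smul ψ ht z

/-- The Clifford factor has degree `1` in `y` and the derivative of a radially constant field degree
`-1`. -/
lemma ambientDirac_radialExtension_smul (ρ : SpinorModule d) (ψ : Sph d → Spinor d) {t : ℝ}
    (ht : 0 < t) (y : Ambient d) :
    ambientDirac ρ (radialExtension ψ) (t • y) = ambientDirac ρ (radialExtension ψ) y := by
  simp only [ambientDirac, fderiv_radialExtension_self, add_zero]
  refine Finset.sum_congr rfl fun i _ => ?_
  rw [← fderiv_radialExtension_smul ψ ht y, map_smul, LinearMap.smul_apply]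
  exact ((cliffordCLM ρ (stdVec d i) y).map_smul t _).symm

lemma continuousAt_ambientDirac (ρ : SpinorModule d) {F : Ambient d → Spinor d} {y : Ambient d}
    (hF : ContDiffAt ℝ ∞ F y) : ContinuousAt (ambientDirac ρ F) y := by
  have h : ContinuousAt (fderiv ℝ F) y := (hF.fderiv_right (m := 0) (by simp)).continuousAt
  refine ContinuousAt.add (tendsto_finsetSum _ fun i _ => ?_) (h.clm_apply continuousAt_id)
  exact ((cliffordCLM ρ (stdVec d i)).continuous.continuousAt.clm_apply
    (h.clm_apply continuousAt_const))

lemma continuous_ambientDirac (ρ : SpinorModule d) {ψ : Sph d → Spinor d}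
    (hψ : ContMDiff (𝓡 d) 𝓘(ℝ, Spinor d) ∞ ψ) :
    Continuous fun x : Sph d => ambientDirac ρ (radialExtension ψ) x :=
  continuous_iff_continuousAt.2 fun x => ContinuousAt.comp (f := Subtype.val)
    (continuousAt_ambientDirac ρ (contDiffAt_radialExtension hψ (coe_sph_ne_zero x)))
    continuous_subtype_val.continuousAt

/-- The divergence of the cut-off field integrates to zero over the ambient space. It equals the
bump function times the defect of symmetry, which is constant along rays, so the defect integrates
to zero over the sphere. -/
lemma integral_inner_ambientDirac (ρ : SpinorModule d) {φ ψ : Sph d → Spinor d}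
    (hφ : ContMDiff (𝓡 d) 𝓘(ℝ, Spinor d) ∞ φ) (hψ : ContMDiff (𝓡 d) 𝓘(ℝ, Spinor d) ∞ ψ) :
    ∫ x : Sph d, inner ℂ (φ x) (ambientDirac ρ (radialExtension ψ) x) ∂sphVolume d =
      ∫ x : Sph d, inner ℂ (ambientDirac ρ (radialExtension φ) x) (ψ x) ∂sphVolume d := by
  set Φ := radialExtension φ
  set Ψ := radialExtension ψ
  have hΦ : ∀ y, y ≠ 0 → ContDiffAt ℝ ∞ Φ y := fun y hy => contDiffAt_radialExtension hφ hy
  have hΨ : ∀ y, y ≠ 0 → ContDiffAt ℝ ∞ Ψ y := fun y hy => contDiffAt_radialExtension hψ hy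
  have hG : ∀ i, ContDiff ℝ 1 (cutoffField ρ Φ Ψ i) := contDiff_cutoffField ρ hΦ hΨ
  have hc : ∀ i, HasCompactSupport (cutoffField ρ Φ Ψ i) := fun i =>
    hasCompactSupport_radialBump fun y hy => by
      rw [cutoffField, hy, Complex.ofReal_zero, zero_mul]
  have h0 : ∫ y : Ambient d, ∑ i, fderiv ℝ (cutoffField ρ Φ Ψ i) y (stdVec d i) = 0 := by
    rw [integral_finsetSum]
    · exact Finset.sum_eq_zero fun i _ => integral_fderiv_eq_zero _ (hG i) (hc i) _
    · intro i _
      exact (((hG i).continuous_fderiv one_ne_zero).clm_apply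
        continuous_const).integrable_of_hasCompactSupport ((hc i).fderiv_apply ℝ _)
  have h1 : ∫ x : Sph d, (inner ℂ (Φ x) (ambientDirac ρ Ψ x) -
      inner ℂ (ambientDirac ρ Φ x) (Ψ x)) ∂sphVolume d = 0 := by
    refine integral_sphere_eq_zero (g := fun y => inner ℂ (Φ y) (ambientDirac ρ Ψ y) -
      inner ℂ (ambientDirac ρ Φ y) (Ψ y)) (fun t y ht => ?_) ?_
    · simp only [Φ, Ψ, ambientDirac_radialExtension_smul ρ _ ht, radialExtension_smul _ ht]
    · rw [← h0]
      refine integral_congr_ae ?_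
      filter_upwards [compl_mem_ae_iff.2 (measure_singleton (0 : Ambient d))] with y hy
      have hd1 := differentiableAt_radialExtension hφ hy
      have hd2 := differentiableAt_radialExtension hψ hy
      rw [sum_fderiv_cutoffField ρ hd1 hd2, sum_fderiv_symmetryField ρ hd1 hd2
        (fderiv_radialExtension_self _ _) (fderiv_radialExtension_self _ _)]
  simp only [Φ, Ψ, radialExtension_coe] at h1
  rw [integral_sub] at h1
  · exact sub_eq_zero.1 h1
  · exact (Continuous.inner hφ.continuous
      (continuous_ambientDirac ρ hψ)).integrable_of_hasCompactSupport
      (HasCompactSupport.of_compactSpace _)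
  · exact (Continuous.inner (continuous_ambientDirac ρ hφ)
      hψ.continuous).integrable_of_hasCompactSupport (HasCompactSupport.of_compactSpace _)

/-- The Dirac operator is symmetric on smooth spinor fields. -/
theorem integral_inner_dirac (σ : SpinStructure d) (ρ : SpinorModule d) {φ ψ : Sph d → Spinor d}
    (hφ : ContMDiff (𝓡 d) 𝓘(ℝ, Spinor d) ∞ φ) (hψ : ContMDiff (𝓡 d) 𝓘(ℝ, Spinor d) ∞ ψ) :
    ∫ x : Sph d, inner ℂ (φ x) (dirac σ ρ ψ x) ∂sphVolume d =
      ∫ x : Sph d, inner ℂ (dirac σ ρ φ x) (ψ x) ∂sphVolume d := by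
  have hint : ∀ {f g : Sph d → Spinor d}, Continuous f → Continuous g →
      Integrable (fun x => inner ℂ (f x) (g x)) (sphVolume d) := fun hf hg =>
    (hf.inner hg).integrable_of_hasCompactSupport (HasCompactSupport.of_compactSpace _)
  simp only [dirac_eq_of_contMDiff, inner_add_right, inner_add_left, inner_smul_left,
    inner_smul_right, Complex.conj_ofReal]
  rw [integral_add (hint hφ.continuous (continuous_ambientDirac ρ hψ))
      ((hint hφ.continuous hψ.continuous).const_mul _),
    integral_add (hint (continuous_ambientDirac ρ hφ) hψ.continuous)
      ((hint hφ.continuous hψ.continuous).const_mul _), integral_inner_ambientDirac ρ hφ hψ]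

end SphereDirac

end


noncomputable section

namespace SphereDirac

open MvPolynomial TensorProduct

/-! ### Polynomial spinor fields on the sphere -/

variable {d : ℕ}

/-- The value of a complex polynomial at a real point, as an algebra homomorphism. -/
def realEval (y : Ambient d) : MvPolynomial (Fin (d + 1)) ℂ →ₐ[ℂ] ℂ :=
  aeval fun i => ((y i : ℝ) : ℂ)

@[simp] lemma realEval_X (y : Ambient d) (i : Fin (d + 1)) : realEval y (X i) = ((y i : ℝ) : ℂ) :=
  aeval_X _ _

@[simp] lemma realEval_C (y : Ambient d) (c : ℂ) : realEval y (C c) = c := aeval_C _ _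

/-- The value of a spinor-valued polynomial. -/
def polyEval (y : Ambient d) : PolySpinor (d + 1) (Spinor d) →ₗ[ℂ] Spinor d :=
  TensorProduct.lift (LinearMap.lsmul ℂ (Spinor d) ∘ₗ (realEval y).toLinearMap)

@[simp] lemma polyEval_tmul (y : Ambient d) (p : MvPolynomial (Fin (d + 1)) ℂ) (v : Spinor d) :
    polyEval y (p ⊗ₜ v) = realEval y p • v := rfl

lemma contDiff_coord (i : Fin (d + 1)) : ContDiff ℝ ∞ fun y : Ambient d => ((y i : ℝ) : ℂ) :=
  (Complex.ofRealCLM.comp (EuclideanSpace.proj (𝕜 := ℝ) i)).contDiff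

lemma fderiv_coord (y : Ambient d) (i j : Fin (d + 1)) :
    fderiv ℝ (fun y : Ambient d => ((y i : ℝ) : ℂ)) y (stdVec d j) = if j = i then 1 else 0 := by
  have h := (Complex.ofRealCLM.comp (EuclideanSpace.proj (𝕜 := ℝ) i)).hasFDerivAt (x := y)
  have h' : HasFDerivAt (fun y : Ambient d => ((y i : ℝ) : ℂ)) _ y := h
  rw [h'.fderiv]
  by_cases hij : j = i
  · subst hij; simp
  · simp [hij, Ne.symm hij]

lemma contDiff_realEval (p : MvPolynomial (Fin (d + 1)) ℂ) :
    ContDiff ℝ ∞ fun y : Ambient d => realEval y p := by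
  induction p using MvPolynomial.induction_on with
  | C a => simpa using contDiff_const
  | add p q hp hq => simpa using hp.add hq
  | mul_X p i hp => simpa using hp.mul (contDiff_coord i)

lemma differentiable_realEval (p : MvPolynomial (Fin (d + 1)) ℂ) :
    Differentiable ℝ fun y : Ambient d => realEval y p :=
  (contDiff_realEval p).differentiable (by simp)

lemma fderiv_realEval (p : MvPolynomial (Fin (d + 1)) ℂ) (y : Ambient d) (j : Fin (d + 1)) :
    fderiv ℝ (fun y : Ambient d => realEval y p) y (stdVec d j) = realEval y (pderiv j p) := by
  induction p using MvPolynomial.induction_on with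
  | C a => simp
  | add p q hp hq =>
    simp only [map_add]
    rw [fderiv_fun_add (differentiable_realEval p y) (differentiable_realEval q y), add_apply,
      hp, hq]
  | mul_X p i hp =>
    have hi : DifferentiableAt ℝ (fun y : Ambient d => ((y i : ℝ) : ℂ)) y :=
      (contDiff_coord i).differentiable (by simp) y
    simp only [map_mul, realEval_X]
    rw [fderiv_fun_mul (differentiable_realEval p y) hi, add_apply, smul_apply, smul_apply, hp,
      fderiv_coord, Derivation.leibniz, pderiv_X, map_add]
    by_cases hij : j = i
    · subst hij; simp
    · simp [hij, Ne.symm hij]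

lemma contDiff_polyEval (u : PolySpinor (d + 1) (Spinor d)) :
    ContDiff ℝ ∞ fun y : Ambient d => polyEval y u := by
  induction u using TensorProduct.induction_on with
  | zero => simpa using contDiff_const
  | add u w hu hw => simpa using hu.add hw
  | tmul p v => exact (contDiff_realEval p).fun_smul contDiff_const

lemma differentiable_polyEval (u : PolySpinor (d + 1) (Spinor d)) :
    Differentiable ℝ fun y : Ambient d => polyEval y u :=
  (contDiff_polyEval u).differentiable (by simp)

lemma fderiv_polyEval (u : PolySpinor (d + 1) (Spinor d)) (y : Ambient d) (j : Fin (d + 1)) :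
    fderiv ℝ (fun y : Ambient d => polyEval y u) y (stdVec d j) =
      polyEval y (partialX (Spinor d) j u) := by
  induction u using TensorProduct.induction_on with
  | zero => simp
  | add u w hu hw =>
    simp only [map_add]
    rw [fderiv_fun_add (differentiable_polyEval u y) (differentiable_polyEval w y), add_apply,
      hu, hw]
  | tmul p v =>
    simp only [polyEval_tmul, partialX_tmul]
    rw [fderiv_smul_const (differentiable_realEval p y), ContinuousLinearMap.smulRight_apply,
      fderiv_realEval]

lemma polyEval_mulX (y : Ambient d) (i : Fin (d + 1)) (u : PolySpinor (d + 1) (Spinor d)) :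
    polyEval y (mulX (Spinor d) i u) = ((y i : ℝ) : ℂ) • polyEval y u := by
  induction u using TensorProduct.induction_on with
  | zero => simp
  | add u w hu hw => rw [map_add, map_add, map_add, smul_add, hu, hw]
  | tmul p v => simp [mul_smul]

lemma polyEval_partialX_actVal (y : Ambient d) (j : Fin (d + 1)) (T : Module.End ℂ (Spinor d))
    (u : PolySpinor (d + 1) (Spinor d)) :
    polyEval y (partialX (Spinor d) j (actVal (d + 1) T u)) =
      T (polyEval y (partialX (Spinor d) j u)) := by
  induction u using TensorProduct.induction_on with
  | zero => simp
  | add u w hu hw => simp only [map_add, hu, hw]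
  | tmul p v => simp

lemma polyEval_radiusSq (y : Ambient d) (u : PolySpinor (d + 1) (Spinor d)) :
    polyEval y (radiusSq (d + 1) (Spinor d) u) = ((‖y‖ ^ 2 : ℝ) : ℂ) • polyEval y u := by
  simp only [radiusSq, LinearMap.sum_apply, Module.End.mul_apply, map_sum, polyEval_mulX, smul_smul]
  rw [← Finset.sum_smul, EuclideanSpace.real_norm_sq_eq]
  push_cast
  simp only [pow_two]

lemma ambientDirac_polyEval (ρ : SpinorModule d) (u : PolySpinor (d + 1) (Spinor d))
    (y : Ambient d) :
    ambientDirac ρ (fun y => polyEval y u) y = polyEval y (polyDirac (cliffordFamily ρ) u) := by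
  rw [ambientDirac, polyDirac, ← sum_smul_apply_stdVec (fderiv ℝ (fun y => polyEval y u) y) y]
  simp only [fderiv_polyEval, LinearMap.add_apply, LinearMap.sum_apply, Module.End.mul_apply,
    map_add, map_sum, polyEval_mulX, polyEval_partialX_actVal, Complex.coe_smul]
  congr 1
  rw [Finset.sum_comm]
  refine Finset.sum_congr rfl fun j _ => ?_
  have h := congrArg (fun z => cliffordBilin ρ z (stdVec d j)
    (polyEval y (partialX (Spinor d) j u))) (sum_smul_stdVec y)
  simp only [map_sum, map_smul, LinearMap.sum_apply, LinearMap.smul_apply, sum_apply,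
    smul_apply] at h
  exact h.symm

/-- The spinor field on the sphere given by a spinor-valued polynomial. -/
def polyField (d : ℕ) : PolySpinor (d + 1) (Spinor d) →ₗ[ℂ] C(Sph d, Spinor d) where
  toFun u := ⟨fun x : Sph d => polyEval (x : Ambient d) u,
    (contDiff_polyEval u).continuous.comp continuous_subtype_val⟩
  map_add' u w := by ext1 x; exact map_add (polyEval (x : Ambient d)) u w
  map_smul' c u := by ext1 x; exact map_smul (polyEval (x : Ambient d)) c u

lemma polyField_apply (u : PolySpinor (d + 1) (Spinor d)) (x : Sph d) :
    polyField d u x = polyEval x u := rfl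

lemma contMDiff_polyField (u : PolySpinor (d + 1) (Spinor d)) :
    ContMDiff (𝓡 d) 𝓘(ℝ, Spinor d) ∞ (polyField d u) :=
  (contDiff_polyEval u).contMDiff.comp (contMDiff_coe_sphere (n := d))

lemma dirac_polyField (σ : SpinStructure d) (ρ : SpinorModule d)
    (u : PolySpinor (d + 1) (Spinor d)) :
    dirac σ ρ (polyField d u) =
      polyField d (polyDirac (cliffordFamily ρ) u + (diracShift σ : ℂ) • u) := by
  funext x
  refine (dirac_eq_of_extension σ ρ (differentiable_polyEval u) (fun _ => rfl) x).trans ?_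
  rw [ambientDirac_polyEval, polyField_apply, map_add, map_smul]

lemma polyField_radiusSq (u : PolySpinor (d + 1) (Spinor d)) :
    polyField d (radiusSq (d + 1) (Spinor d) u) = polyField d u := by
  ext1 x
  rw [polyField_apply, polyEval_radiusSq, norm_coe_sph, polyField_apply]
  simp

lemma realEval_smul {p : MvPolynomial (Fin (d + 1)) ℂ} {k : ℕ} (hp : p.IsHomogeneous k) (t : ℝ)
    (y : Ambient d) : realEval (t • y) p = (t : ℂ) ^ k * realEval y p := by
  simp only [realEval, aeval_def, eval₂_eq', Finset.mul_sum]
  refine Finset.sum_congr rfl fun a ha => ?_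
  have hk : ∑ i, a i = k := by
    rw [← Finsupp.degree_eq_sum, Finsupp.degree_eq_weight_one]
    exact hp (mem_support_iff.1 ha)
  rw [← hk, ← Finset.prod_pow_eq_pow_sum, mul_left_comm, ← Finset.prod_mul_distrib]
  congr 1
  refine Finset.prod_congr rfl fun i _ => ?_
  rw [← mul_pow, PiLp.smul_apply, smul_eq_mul, Complex.ofReal_mul]

lemma polyEval_homIncl_smul (k : ℕ) (u : HomSpinor (d + 1) (Spinor d) k) (t : ℝ) (y : Ambient d) :
    polyEval (t • y) (homIncl _ _ k u) = (t : ℂ) ^ k • polyEval y (homIncl _ _ k u) := by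
  induction u using TensorProduct.induction_on with
  | zero => simp
  | add u w hu hw => simp only [map_add, smul_add, hu, hw]
  | tmul p v => rw [homIncl_tmul, polyEval_tmul, polyEval_tmul, realEval_smul p.2, mul_smul]

/-- Compared component by component in a basis of spinors: a complex polynomial is determined by its
values on the positive real orthant, a product of infinite sets. -/
lemma polyEval_ext {u w : PolySpinor (d + 1) (Spinor d)}
    (h : ∀ y : Ambient d, y ≠ 0 → polyEval y u = polyEval y w) : u = w := by
  let e := equivFinsuppOfBasisRight (M := MvPolynomial (Fin (d + 1)) ℂ) (R := ℂ)
    (EuclideanSpace.basisFun (Fin (2 ^ (d / 2))) ℂ).toBasis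
  have he : ∀ (u : PolySpinor (d + 1) (Spinor d)) (y : Ambient d) a,
      realEval y (e u a) = polyEval y u a := by
    intro u y a
    induction u using TensorProduct.induction_on with
    | zero => simp
    | add u w hu hw => simp only [map_add, Finsupp.add_apply, PiLp.add_apply, hu, hw]
    | tmul p v => simp [e, mul_comm]
  refine e.injective ?_
  ext1 a
  refine MvPolynomial.funext_set (fun _ => Complex.ofReal '' Set.Ioi 0)
    (fun _ => (Set.Ioi_infinite 0).image Complex.ofReal_injective.injOn) fun z hz => ?_
  have hz' : ∀ i, ∃ r : ℝ, 0 < r ∧ (r : ℂ) = z i := fun i => by simpa using hz i (Set.mem_univ i)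
  choose r hr hrz using hz'
  have hy : WithLp.toLp 2 r ≠ (0 : Ambient d) := fun h0 => by
    have := congrArg (fun y : Ambient d => y 0) h0
    exact (hr 0).ne' this
  have h1 := (he u (WithLp.toLp 2 r) a).trans
    ((congrArg (fun v : Spinor d => v a) (h _ hy)).trans (he w (WithLp.toLp 2 r) a).symm)
  have h2 : z = fun i => (r i : ℂ) := funext fun i => (hrz i).symm
  rw [h2]
  exact h1

lemma polyEval_homIncl_of_polyField_eq {k : ℕ} {u w : HomSpinor (d + 1) (Spinor d) k}
    (huw : polyField d (homIncl (d + 1) (Spinor d) k u) =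
      polyField d (homIncl (d + 1) (Spinor d) k w)) {y : Ambient d} (hy : y ≠ 0) :
    polyEval y (homIncl (d + 1) (Spinor d) k u) = polyEval y (homIncl (d + 1) (Spinor d) k w) := by
  have hy' : ‖y‖ ≠ 0 := norm_ne_zero_iff.2 hy
  have hmem : ‖y‖⁻¹ • y ∈ sphere (0 : Ambient d) 1 := by
    simp [norm_smul, inv_mul_cancel₀ hy']
  have h2 := polyEval_homIncl_smul k u ‖y‖ (‖y‖⁻¹ • y)
  have h3 := polyEval_homIncl_smul k w ‖y‖ (‖y‖⁻¹ • y)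
  rw [smul_inv_smul₀ hy'] at h2 h3
  have h1 := polyField_apply (homIncl (d + 1) (Spinor d) k u) ⟨‖y‖⁻¹ • y, hmem⟩
  rw [huw, polyField_apply] at h1
  rw [h2, h3, h1]

/-- Homogeneity recovers the values off the sphere. A common degree is essential, since `r²`
restricts to `1`. -/
lemma eq_of_polyField_homIncl_eq (k : ℕ) {u w : HomSpinor (d + 1) (Spinor d) k}
    (huw : polyField d (homIncl (d + 1) (Spinor d) k u) =
      polyField d (homIncl (d + 1) (Spinor d) k w)) : u = w :=
  homIncl_injective (n := d + 1) (S := Spinor d) k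
    (polyEval_ext fun _ hy => polyEval_homIncl_of_polyField_eq huw hy)

end SphereDirac

end


noncomputable section

namespace SphereDirac

open MvPolynomial TensorProduct

/-! ### Density of the polynomial spinor fields -/

variable {d : ℕ}

/-- The coordinate functions on the sphere. -/
def coordFun (i : Fin (d + 1)) : C(Sph d, ℂ) :=
  ⟨fun x : Sph d => (((x : Ambient d) i : ℝ) : ℂ),
    (contDiff_coord i).continuous.comp continuous_subtype_val⟩

lemma aeval_coordFun_apply (p : MvPolynomial (Fin (d + 1)) ℂ) (x : Sph d) :
    aeval coordFun p x = realEval (x : Ambient d) p := by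
  induction p using MvPolynomial.induction_on with
  | C a => rw [aeval_C, realEval_C]; rfl
  | add p q hp hq => rw [map_add, map_add, ContinuousMap.add_apply, hp, hq]
  | mul_X p i hp => rw [map_mul, map_mul, ContinuousMap.mul_apply, hp, aeval_X, realEval_X]; rfl

/-- The star subalgebra of polynomial functions on the sphere. -/
def polyStarSubalgebra (d : ℕ) : StarSubalgebra ℂ C(Sph d, ℂ) where
  __ := (aeval (R := ℂ) (coordFun (d := d))).range
  star_mem' := by
    rintro _ ⟨p, rfl⟩
    change star (aeval coordFun p) ∈ (aeval (R := ℂ) (coordFun (d := d))).range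
    induction p using MvPolynomial.induction_on with
    | C a =>
      rw [aeval_C, ← algebraMap_star_comm]
      exact Subalgebra.algebraMap_mem _ _
    | add p q hp hq =>
      rw [map_add, star_add]
      exact Subalgebra.add_mem _ hp hq
    | mul_X p i hp =>
      rw [map_mul, star_mul, aeval_X]
      refine Subalgebra.mul_mem _ ⟨X i, ?_⟩ hp
      ext1 x
      change aeval (R := ℂ) (coordFun (d := d)) (X i) x = star (coordFun i x)
      rw [aeval_X]
      exact (Complex.conj_ofReal _).symm

lemma polyStarSubalgebra_dense : (polyStarSubalgebra d).topologicalClosure = ⊤ := by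
  refine ContinuousMap.starSubalgebra_topologicalClosure_eq_top_of_separatesPoints _ ?_
  intro x y hxy
  by_contra! h
  refine hxy (Subtype.ext (PiLp.ext fun i => ?_))
  have h1 := h _ ⟨coordFun i, ⟨X i, by simp⟩, rfl⟩
  exact Complex.ofReal_injective h1

/-- A scalar function times a constant spinor. -/
def smulConst (v : Spinor d) : C(Sph d, ℂ) →L[ℂ] C(Sph d, Spinor d) :=
  ((ContinuousLinearMap.id ℂ ℂ).smulRight v).compLeftContinuous ℂ (Sph d)

/-- Stone-Weierstrass for the coordinate functions, applied to each spinor component. -/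
lemma denseRange_polyField : DenseRange (polyField d) := by
  have key : ∀ (v : Spinor d) (f : C(Sph d, ℂ)),
      smulConst v f ∈ (LinearMap.range (polyField d)).topologicalClosure := by
    intro v f
    have hf : f ∈ (polyStarSubalgebra d).topologicalClosure := by
      rw [polyStarSubalgebra_dense]; exact trivial
    have hf' : f ∈ closure (polyStarSubalgebra d : Set C(Sph d, ℂ)) := hf
    have himg := image_closure_subset_closure_image (smulConst v).continuous
      (Set.mem_image_of_mem (smulConst v) hf')
    refine closure_mono ?_ himg
    rintro _ ⟨_, ⟨p, rfl⟩, rfl⟩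
    refine ⟨p ⊗ₜ v, ?_⟩
    ext1 x
    change _ = aeval coordFun p x • v
    rw [polyField_apply, polyEval_tmul, aeval_coordFun_apply]
  intro f
  have hsum : f = ∑ a, smulConst (EuclideanSpace.single a (1 : ℂ))
      ((EuclideanSpace.proj a : Spinor d →L[ℂ] ℂ).compLeftContinuous ℂ (Sph d) f) := by
    ext1 x
    rw [ContinuousMap.sum_apply]
    have := (EuclideanSpace.basisFun (Fin (2 ^ (d / 2))) ℂ).sum_repr (f x)
    simp only [EuclideanSpace.basisFun_repr, EuclideanSpace.basisFun_apply] at this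
    exact this.symm
  have : f ∈ (LinearMap.range (polyField d)).topologicalClosure := by
    rw [hsum]
    exact Submodule.sum_mem _ fun a _ => key _ _
  exact this

/-- The square-integrable spinor field of a spinor-valued polynomial. -/
def polyL2 (d : ℕ) : PolySpinor (d + 1) (Spinor d) →ₗ[ℂ] L2Spinor d :=
  (ContinuousMap.toLp (E := Spinor d) 2 (sphVolume d) ℂ).toLinearMap ∘ₗ polyField d

lemma coeFn_polyL2 (u : PolySpinor (d + 1) (Spinor d)) :
    polyL2 d u =ᵐ[sphVolume d] polyField d u := ContinuousMap.coeFn_toLp _ _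

lemma denseRange_polyL2 : DenseRange (polyL2 d) :=
  (ContinuousMap.toLp_denseRange (Spinor d) (sphVolume d) ℂ (by norm_num)).comp
    denseRange_polyField (ContinuousMap.toLp (E := Spinor d) 2 (sphVolume d) ℂ).continuous

lemma polyL2_radiusSq (u : PolySpinor (d + 1) (Spinor d)) :
    polyL2 d (radiusSq (d + 1) (Spinor d) u) = polyL2 d u := by
  rw [polyL2, LinearMap.comp_apply, LinearMap.comp_apply, polyField_radiusSq]

/-- The map from homogeneous spinor-valued polynomials to square-integrable spinor fields. -/
def homL2 (d k : ℕ) : HomSpinor (d + 1) (Spinor d) k →ₗ[ℂ] L2Spinor d :=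
  polyL2 d ∘ₗ homIncl (d + 1) (Spinor d) k

lemma homL2_injective (k : ℕ) : Function.Injective (homL2 d k) := fun _ _ h =>
  eq_of_polyField_homIncl_eq k
    (ContinuousMap.toLp_injective (sphVolume d) (p := 2) (𝕜 := ℂ) (E := Spinor d) h)

lemma mem_of_homIncl_mem {Q : Submodule ℂ (PolySpinor (d + 1) (Spinor d))}
    (h : ∀ k u, homIncl (d + 1) (Spinor d) k u ∈ Q) (u : PolySpinor (d + 1) (Spinor d)) :
    u ∈ Q := by
  induction u using TensorProduct.induction_on with
  | zero => exact Q.zero_mem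
  | add u w hu hw => exact Q.add_mem hu hw
  | tmul p v =>
    rw [← sum_homogeneousComponent p, TensorProduct.sum_tmul]
    exact Q.sum_mem fun k _ => h k (⟨_, homogeneousComponent_isHomogeneous k p⟩ ⊗ₜ v)

end SphereDirac

end


noncomputable section

namespace SphereDirac

open MvPolynomial TensorProduct

/-! ### The spectral decomposition of the Dirac operator -/

variable {d : ℕ}

/-- The eigenvalues of `ambientDirac`: `k` and `-(k + d)`, for `k : ℕ`. -/
def ambientEigenvalue (d : ℕ) : ℕ ⊕ ℕ → ℝ
  | .inl k => k
  | .inr k => -((k + 1 : ℕ) + (d - 1 : ℕ))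

/-- The eigenspaces of the Dirac operator. -/
def sphereEigenspace (ρ : SpinorModule d) : ℕ ⊕ ℕ → Submodule ℂ (L2Spinor d)
  | .inl k => (diracEigenspace (cliffordFamily ρ) k (k : ℂ)).map (homL2 d k)
  | .inr k => (diracEigenspace (cliffordFamily ρ) (k + 1)
      (-(((k + 1 : ℕ) : ℂ) + ((d - 1 : ℕ) : ℂ)))).map (homL2 d (k + 1))

/-- The dimensions of the eigenspaces. -/
def sphereMultiplicity (d : ℕ) : ℕ ⊕ ℕ → ℕ
  | .inl k => (k + (d - 1)).choose (d - 1) * 2 ^ (d / 2)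
  | .inr k => (k + (d - 1)).choose (d - 1) * 2 ^ (d / 2)

instance finiteDimensional_sphereEigenspace (ρ : SpinorModule d) (i : ℕ ⊕ ℕ) :
    FiniteDimensional ℂ (sphereEigenspace ρ i) := by
  cases i with
  | inl k => exact Submodule.finiteDimensional_of_le (LinearMap.map_le_range (f := homL2 d k))
  | inr k => exact Submodule.finiteDimensional_of_le (LinearMap.map_le_range (f := homL2 d (k + 1)))

lemma finrank_map_homL2 (k : ℕ) (E : Submodule ℂ (HomSpinor (d + 1) (Spinor d) k)) :
    Module.finrank ℂ (E.map (homL2 d k)) = Module.finrank ℂ E :=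
  (Submodule.equivMapOfInjective (homL2 d k) (homL2_injective k) E).finrank_eq.symm

lemma finrank_sphereEigenspace (hd : 1 ≤ d) (ρ : SpinorModule d) (i : ℕ ⊕ ℕ) :
    Module.finrank ℂ (sphereEigenspace ρ i) = sphereMultiplicity d i := by
  have h := finrank_eigenspace_homDirac hd (isCliffordFamily_cliffordFamily ρ)
  have hS : Module.finrank ℂ (Spinor d) = 2 ^ (d / 2) := by simp
  rw [hS] at h
  cases i with
  | inl k => exact (finrank_map_homL2 k _).trans (h.1 k)
  | inr k => exact (finrank_map_homL2 (k + 1) _).trans (h.2 k)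

lemma exists_of_mem_map_homL2 (ρ : SpinorModule d) {k : ℕ} {c : ℂ} {w : L2Spinor d}
    (hw : w ∈ (diracEigenspace (cliffordFamily ρ) k c).map (homL2 d k)) :
    ∃ u, polyL2 d u = w ∧ polyDirac (cliffordFamily ρ) u = c • u := by
  obtain ⟨u, hu, rfl⟩ := hw
  refine ⟨homIncl _ _ k u, rfl, ?_⟩
  rw [← homIncl_homDirac, Module.End.mem_eigenspace_iff.1 hu, map_smul]

lemma exists_of_mem_sphereEigenspace (ρ : SpinorModule d) {i : ℕ ⊕ ℕ} {w : L2Spinor d}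
    (hw : w ∈ sphereEigenspace ρ i) :
    ∃ u, polyL2 d u = w ∧
      polyDirac (cliffordFamily ρ) u = (ambientEigenvalue d i : ℂ) • u := by
  cases i with
  | inl k =>
    obtain ⟨u, hu, h⟩ := exists_of_mem_map_homL2 ρ hw
    exact ⟨u, hu, by simpa [ambientEigenvalue] using h⟩
  | inr k =>
    obtain ⟨u, hu, h⟩ := exists_of_mem_map_homL2 ρ hw
    exact ⟨u, hu, by simpa [ambientEigenvalue] using h⟩

lemma ambientEigenvalue_injective (d : ℕ) : Function.Injective (ambientEigenvalue d) := by
  have hneg : ∀ k l : ℕ, ambientEigenvalue d (.inr l) < ambientEigenvalue d (.inl k) := by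
    intro k l
    simp only [ambientEigenvalue]
    push_cast
    have h1 : (0 : ℝ) ≤ k := Nat.cast_nonneg k
    have h2 : (0 : ℝ) ≤ l := Nat.cast_nonneg l
    have h3 : (0 : ℝ) ≤ (d - 1 : ℕ) := Nat.cast_nonneg _
    linarith
  rintro (k | k) (l | l) h
  · simpa [ambientEigenvalue] using h
  · exact absurd h (hneg k l).ne'
  · exact absurd h (hneg l k).ne
  · simpa [ambientEigenvalue] using h

/-- The Dirac operator on a polynomial eigenfield. -/
lemma dirac_polyField_of_eigen (σ : SpinStructure d) (ρ : SpinorModule d) {c : ℝ}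
    {u : PolySpinor (d + 1) (Spinor d)} (hu : polyDirac (cliffordFamily ρ) u = (c : ℂ) • u) :
    dirac σ ρ (polyField d u) = polyField d (((c + diracShift σ : ℝ) : ℂ) • u) := by
  rw [dirac_polyField, hu, ← add_smul, Complex.ofReal_add]

lemma polyL2_mem_smoothDiracGraph (σ : SpinStructure d) (ρ : SpinorModule d) {c : ℝ}
    {u : PolySpinor (d + 1) (Spinor d)} (hu : polyDirac (cliffordFamily ρ) u = (c : ℂ) • u) :
    (polyL2 d u, ((c + diracShift σ : ℝ) : ℂ) • polyL2 d u) ∈ smoothDiracGraph σ ρ := by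
  refine Submodule.subset_span ⟨polyField d u, contMDiff_polyField u, coeFn_polyL2 u, ?_⟩
  rw [dirac_polyField_of_eigen σ ρ hu, ← map_smul]
  exact coeFn_polyL2 _

/-- Symmetry moves the Dirac operator from an arbitrary smooth field onto the eigenfield; this puts
the smooth graph inside the diagonal one. -/
lemma inner_polyL2_of_smooth (σ : SpinStructure d) (ρ : SpinorModule d) {c : ℝ}
    {u : PolySpinor (d + 1) (Spinor d)} (hu : polyDirac (cliffordFamily ρ) u = (c : ℂ) • u)
    {ψ : Sph d → Spinor d} (hψ : ContMDiff (𝓡 d) 𝓘(ℝ, Spinor d) ∞ ψ) {v w : L2Spinor d}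
    (hv : v =ᵐ[sphVolume d] ψ) (hw : w =ᵐ[sphVolume d] dirac σ ρ ψ) :
    inner ℂ (polyL2 d u) w = ((c + diracShift σ : ℝ) : ℂ) * inner ℂ (polyL2 d u) v := by
  have h := integral_inner_dirac σ ρ (contMDiff_polyField u) hψ
  rw [dirac_polyField_of_eigen σ ρ hu] at h
  have h1 : inner ℂ (polyL2 d u) w =
      ∫ x, inner ℂ (polyField d u x) (dirac σ ρ ψ x) ∂sphVolume d := by
    rw [L2.inner_def]
    refine integral_congr_ae ?_
    filter_upwards [coeFn_polyL2 u, hw] with x h1 h2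
    rw [h1, h2]
  have h2 : inner ℂ (polyL2 d u) v = ∫ x, inner ℂ (polyField d u x) (ψ x) ∂sphVolume d := by
    rw [L2.inner_def]
    refine integral_congr_ae ?_
    filter_upwards [coeFn_polyL2 u, hv] with x h1 h2
    rw [h1, h2]
  rw [h1, h, h2, ← integral_const_mul]
  refine integral_congr_ae (Eventually.of_forall fun x => ?_)
  simp only [map_smul, ContinuousMap.smul_apply, inner_smul_left, Complex.conj_ofReal]

lemma inner_eq_of_mem_smoothDiracGraph (σ : SpinStructure d) (ρ : SpinorModule d) {c : ℝ}
    {u : PolySpinor (d + 1) (Spinor d)} (hu : polyDirac (cliffordFamily ρ) u = (c : ℂ) • u)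
    {p : L2Spinor d × L2Spinor d} (hp : p ∈ smoothDiracGraph σ ρ) :
    inner ℂ (polyL2 d u) p.2 = ((c + diracShift σ : ℝ) : ℂ) * inner ℂ (polyL2 d u) p.1 := by
  induction hp using Submodule.span_induction with
  | mem p h =>
    obtain ⟨ψ, hψ, h1, h2⟩ := h
    exact inner_polyL2_of_smooth σ ρ hu hψ h1 h2
  | zero => simp
  | add p q _ _ hp hq => rw [Prod.snd_add, Prod.fst_add, inner_add_right, inner_add_right, hp, hq,
      mul_add]
  | smul a p _ hp => rw [Prod.smul_snd, Prod.smul_fst, inner_smul_right, inner_smul_right, hp,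
      mul_left_comm]

lemma orthogonalFamily_sphereEigenspace (ρ : SpinorModule d) :
    OrthogonalFamily ℂ (fun i => sphereEigenspace ρ i)
      fun i => (sphereEigenspace ρ i).subtypeₗᵢ := by
  intro i j hij v w
  obtain ⟨u, hu, hu'⟩ := exists_of_mem_sphereEigenspace ρ v.2
  obtain ⟨z, hz, hz'⟩ := exists_of_mem_sphereEigenspace ρ w.2
  -- The eigenspaces do not depend on the spin structure and the shift cancels, so any choice would
  -- do.
  have h := inner_eq_of_mem_smoothDiracGraph (.bounding d) ρ hu'
    (polyL2_mem_smoothDiracGraph (.bounding d) ρ hz')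
  simp only [inner_smul_right] at h
  change inner ℂ (v : L2Spinor d) (w : L2Spinor d) = 0
  rw [hu, hz] at h
  by_contra h0
  have h1 := Complex.ofReal_injective (mul_right_cancel₀ h0 h)
  exact hij (ambientEigenvalue_injective d (add_right_cancel h1)).symm

/-- Induction on the degree: `F_k` is the sum of its two eigenspaces and `r² F_{k-2}`, and on the
sphere the latter has the same fields as `F_{k-2}`. -/
lemma homIncl_mem_comap (hd : 1 ≤ d) (ρ : SpinorModule d) {V : Submodule ℂ (L2Spinor d)}
    (hV : ∀ i, sphereEigenspace ρ i ≤ V) (k : ℕ) :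
    ∀ u, homIncl (d + 1) (Spinor d) k u ∈ V.comap (polyL2 d) := by
  have hinl : ∀ k, diracEigenspace (cliffordFamily ρ) k (k : ℂ) ≤ V.comap (homL2 d k) :=
    fun k => Submodule.map_le_iff_le_comap.1 (hV (.inl k))
  have hinr : ∀ k, diracEigenspace (cliffordFamily ρ) (k + 1)
      (-(((k + 1 : ℕ) : ℂ) + ((d - 1 : ℕ) : ℂ))) ≤ V.comap (homL2 d (k + 1)) :=
    fun k => Submodule.map_le_iff_le_comap.1 (hV (.inr k))
  have hB := isCliffordFamily_cliffordFamily ρ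
  have htop := fun (k : ℕ) =>
    ((isGradedDirac_homDirac hd hB).eigenspaces (Nat.succ_le_succ (Nat.zero_le k))).2.2
  suffices h : ∀ k, V.comap (homL2 d k) = ⊤ from fun u => by
    have : u ∈ V.comap (homL2 d k) := by rw [h]; exact trivial
    exact this
  intro k
  induction k using Nat.strong_induction_on with
  | _ k ih =>
    match k, ih with
    | 0, _ =>
      rw [eq_top_iff]
      intro u _
      refine hinl 0 (Module.End.mem_eigenspace_iff.2 ?_)
      rw [(isGradedDirac_homDirac hd hB).zero u, Nat.cast_zero, zero_smul]
    | 1, _ =>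
      rw [eq_top_iff, ← htop 0]
      exact sup_le (sup_le (hinl 1) (hinr 0)) bot_le
    | k + 2, ih =>
      rw [eq_top_iff, ← htop (k + 1)]
      refine sup_le (sup_le (hinl (k + 2)) (hinr (k + 1))) ?_
      rintro _ ⟨u, rfl⟩
      have h : u ∈ V.comap (homL2 d k) := by rw [ih k (by omega)]; exact trivial
      change polyL2 d (homIncl _ _ _ (homRadiusSq (d + 1) (Spinor d) k u)) ∈ V
      rw [homIncl_homRadiusSq, polyL2_radiusSq]
      exact h

end SphereDirac

end


noncomputable section

namespace SphereDirac

/-! ### The Dirac operator is diagonalisable -/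

variable {d : ℕ}

/-- The index set of the eigenbasis. -/
abbrev EigenIndex (ρ : SpinorModule d) : Type :=
  Σ i : ℕ ⊕ ℕ, Fin (Module.finrank ℂ (sphereEigenspace ρ i))

/-- The vectors of the eigenbasis. -/
def eigenVector (ρ : SpinorModule d) (a : EigenIndex ρ) : L2Spinor d :=
  (stdOrthonormalBasis ℂ (sphereEigenspace ρ a.1) a.2 : L2Spinor d)

lemma orthonormal_sigma {ι H : Type*} [NormedAddCommGroup H] [InnerProductSpace ℂ H]
    {W : ι → Submodule ℂ H} [∀ i, FiniteDimensional ℂ (W i)]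
    (hW : OrthogonalFamily ℂ (fun i => W i) fun i => (W i).subtypeₗᵢ) :
    Orthonormal ℂ fun a : Σ i, Fin (Module.finrank ℂ (W i)) =>
      (stdOrthonormalBasis ℂ (W a.1) a.2 : H) :=
  hW.orthonormal_sigma_orthonormal fun i => (stdOrthonormalBasis ℂ (W i)).orthonormal

lemma orthonormal_eigenVector (ρ : SpinorModule d) : Orthonormal ℂ (eigenVector ρ) :=
  orthonormal_sigma (orthogonalFamily_sphereEigenspace ρ)

lemma sphereEigenspace_le_span (ρ : SpinorModule d) (i : ℕ ⊕ ℕ) :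
    sphereEigenspace ρ i ≤ Submodule.span ℂ (Set.range (eigenVector ρ)) := by
  intro w hw
  have h := congrArg Subtype.val
    ((stdOrthonormalBasis ℂ (sphereEigenspace ρ i)).sum_repr ⟨w, hw⟩)
  rw [← show _ = w from h, Submodule.coe_sum]
  refine Submodule.sum_mem _ fun j _ => ?_
  exact Submodule.smul_mem _ _ (Submodule.subset_span ⟨⟨i, j⟩, rfl⟩)

lemma topologicalClosure_span_eigenVector (hd : 1 ≤ d) (ρ : SpinorModule d) :
    ⊤ ≤ (Submodule.span ℂ (Set.range (eigenVector ρ))).topologicalClosure := by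
  intro w _
  have h : Set.range (polyL2 d) ⊆ Submodule.span ℂ (Set.range (eigenVector ρ)) := by
    rintro _ ⟨u, rfl⟩
    exact mem_of_homIncl_mem
      (homIncl_mem_comap hd ρ (sphereEigenspace_le_span ρ)) u
  exact closure_mono h (denseRange_polyL2 w)

/-- An orthonormal basis of eigenvectors of the Dirac operator. -/
def eigenBasis (hd : 1 ≤ d) (ρ : SpinorModule d) : HilbertBasis (EigenIndex ρ) ℂ (L2Spinor d) :=
  HilbertBasis.mk (orthonormal_eigenVector ρ) (topologicalClosure_span_eigenVector hd ρ)

/-- The eigenvalues of the Dirac operator. -/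
def diracEigenvalue (σ : SpinStructure d) (ρ : SpinorModule d) (a : EigenIndex ρ) : ℝ :=
  ambientEigenvalue d a.1 + diracShift σ

lemma exists_eigenBasis (hd : 1 ≤ d) (ρ : SpinorModule d) (a : EigenIndex ρ) :
    ∃ u, polyL2 d u = eigenBasis hd ρ a ∧
      polyDirac (cliffordFamily ρ) u = (ambientEigenvalue d a.1 : ℂ) • u := by
  have h : eigenBasis hd ρ a = eigenVector ρ a := by rw [eigenBasis, HilbertBasis.coe_mk]
  rw [h]
  exact exists_of_mem_sphereEigenspace ρ
    (stdOrthonormalBasis ℂ (sphereEigenspace ρ a.1) a.2).2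

/-- The smooth graph contains the eigenvectors and, by symmetry, lies in the graph of the diagonal
operator. Its closure is therefore that graph, which also shows that the closed operator is
self-adjoint. -/
theorem diracOperator_eq_diagOp (hd : 1 ≤ d) (σ : SpinStructure d) (ρ : SpinorModule d) :
    diracOperator σ ρ = diagOp (eigenBasis hd ρ) (diracEigenvalue σ ρ) := by
  rw [diracOperator, diagOp]
  congr 1
  refine topologicalClosure_eq_diagGraph _ _ (fun p hp => (mem_diagGraph _ _).2 fun a => ?_) fun a => ?_
  · obtain ⟨u, hu, hu'⟩ := exists_eigenBasis hd ρ a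
    have h := inner_eq_of_mem_smoothDiracGraph σ ρ hu' hp
    rwa [hu] at h
  · obtain ⟨u, hu, hu'⟩ := exists_eigenBasis hd ρ a
    have h := polyL2_mem_smoothDiracGraph σ ρ hu'
    rwa [hu] at h

/-! ### Counting eigenvalues -/

/-- The position of an eigenvalue in the spectrum of the absolute value. -/
def spectralIndex : {d : ℕ} → SpinStructure d → ℕ ⊕ ℕ → Option ℕ
  | _, .bounding _, .inl k => some k
  | _, .trivial, .inl 0 => none
  | _, .trivial, .inl (k + 1) => some k
  | _, _, .inr k => some k

/-- The smallest positive eigenvalue of the absolute value of the Dirac operator. -/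
def smallestEigenvalue : {d : ℕ} → SpinStructure d → ℝ
  | d, .bounding _ => (d : ℝ) / 2
  | _, .trivial => 1

lemma smallestEigenvalue_pos (hd : 1 ≤ d) (σ : SpinStructure d) : 0 < smallestEigenvalue σ := by
  have : (0 : ℝ) < d := by exact_mod_cast hd
  cases σ with
  | bounding => exact half_pos this
  | trivial => exact one_pos

/-- For the bounding structure `k + d/2` and `-(k + d) + d/2` have equal absolute value. For the
trivial one the eigenvalues are `k` and `-(k + 1)`, with `0` set apart as the kernel. -/
lemma abs_ambientEigenvalue_add (hd : 1 ≤ d) (σ : SpinStructure d) (i : ℕ ⊕ ℕ) :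
    |ambientEigenvalue d i + diracShift σ| =
      spectralValue (smallestEigenvalue σ) (spectralIndex σ i) := by
  have hd' : ((d - 1 : ℕ) : ℝ) = d - 1 := by rw [Nat.cast_sub hd, Nat.cast_one]
  have hd0 : (0 : ℝ) ≤ d := Nat.cast_nonneg d
  cases σ with
  | bounding =>
    cases i with
    | inl k =>
      have : (0 : ℝ) ≤ k := Nat.cast_nonneg k
      simp only [ambientEigenvalue, diracShift, smallestEigenvalue, spectralIndex, spectralValue]
      rw [abs_of_nonneg (by positivity)]
    | inr k =>
      have : (0 : ℝ) ≤ k := Nat.cast_nonneg k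
      simp only [ambientEigenvalue, diracShift, smallestEigenvalue, spectralIndex, spectralValue,
        hd']
      push_cast
      rw [abs_of_nonpos (by linarith)]
      ring
  | trivial =>
    match i with
    | .inl 0 => simp [ambientEigenvalue, diracShift, spectralIndex, spectralValue]
    | .inl (k + 1) =>
      simp only [ambientEigenvalue, diracShift, smallestEigenvalue, spectralIndex, spectralValue]
      rw [abs_of_nonneg (by positivity)]
      push_cast
      ring
    | .inr k =>
      simp only [ambientEigenvalue, diracShift, smallestEigenvalue, spectralIndex, spectralValue]
      rw [add_zero, abs_neg, abs_of_nonneg (by positivity)]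
      push_cast
      ring

lemma card_sigma_fiber {α β : Type} (n : α → ℕ) (g : α → β) (c : β) (s : Finset α)
    (h : ∀ i, i ∈ s ↔ g i = c) :
    Finite {a : Σ i, Fin (n i) // g a.1 = c} ∧
      Nat.card {a : Σ i, Fin (n i) // g a.1 = c} = ∑ i ∈ s, n i := by
  let e := Equiv.subtypeSigmaEquiv (fun i => Fin (n i)) fun i => g i = c
  let : Fintype {i // g i = c} := Fintype.subtype s h
  refine ⟨Finite.of_equiv _ e.symm, ?_⟩
  rw [Nat.card_congr e, Nat.card_sigma]
  rw [Finset.sum_subtype s h n (F := this)]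
  simp

/-- The set of indices of a given position. -/
def spectralFiber : {d : ℕ} → SpinStructure d → Option ℕ → Finset (ℕ ⊕ ℕ)
  | _, .bounding _, none => ∅
  | _, .bounding _, some k => {.inl k, .inr k}
  | _, .trivial, none => {.inl 0}
  | _, .trivial, some k => {.inl (k + 1), .inr k}

lemma mem_spectralFiber (σ : SpinStructure d) (c : Option ℕ) (i : ℕ ⊕ ℕ) :
    i ∈ spectralFiber σ c ↔ spectralIndex σ i = c := by
  cases σ with
  | bounding => rcases i with i | i <;> cases c <;> simp [spectralFiber, spectralIndex]
  | trivial => rcases i with (_ | i) | i <;> cases c <;> simp [spectralFiber, spectralIndex]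

/-- Two eigenspaces of opposite sign meet at each level. For the trivial structure their indices
differ by one, which is harmless because `d = 1` makes every multiplicity `1`. -/
lemma sum_sphereMultiplicity (σ : SpinStructure d) (k : ℕ) :
    ∑ i ∈ spectralFiber σ (some k), sphereMultiplicity d i =
      2 * 2 ^ (d / 2) * (k + (d - 1)).choose (d - 1) := by
  cases σ with
  | bounding =>
    rw [spectralFiber, Finset.sum_pair (by simp)]
    simp only [sphereMultiplicity]
    ring
  | trivial =>
    rw [spectralFiber, Finset.sum_pair (by simp)]
    simp [sphereMultiplicity]

end SphereDirac

end

theorem mainTheorem7 (d : ℕ) (hd : 1 ≤ d) (σ : SpinStructure d) (ρ : SpinorModule d) :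
    -- the absolute value `|D|` and the heat semigroup `e^{-t|D|}` exist
    (∃ (A : L2Spinor d →ₗ.[ℂ] L2Spinor d) (T : ℝ → L2Spinor d →L[ℂ] L2Spinor d),
      IsAbsoluteValue (diracOperator σ ρ) A ∧ IsHeatSemigroup A T) ∧
    ∀ (A : L2Spinor d →ₗ.[ℂ] L2Spinor d) (T : ℝ → L2Spinor d →L[ℂ] L2Spinor d),
      IsAbsoluteValue (diracOperator σ ρ) A → IsHeatSemigroup A T →
      ∃ (heat : ℝ → ℝ) (ζ : ℂ → ℂ) (a : ℕ → ℝ),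
        -- the heat trace is well defined
        (∀ t : ℝ, 0 < t → HasTrace (T t) (heat t : ℂ)) ∧
        -- `ζ` is the meromorphic continuation of the zeta function of `|D|`
        (∀ s : ℂ, (d : ℝ) < s.re →
          HasSum (fun μ : {μ : ℝ // 0 < μ} => (multiplicity A μ : ℂ) * ((μ : ℝ) : ℂ) ^ (-s))
            (ζ s)) ∧
        MeromorphicOn ζ Set.univ ∧
        (∀ s : ℂ, (∀ k : ℕ, s ≠ (d : ℂ) - k) → AnalyticAt ℂ ζ s) ∧
        -- `Γ ζ` has at most a simple pole at `d - k`, with residue `a k`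
        (∀ k : ℕ, Tendsto (fun s : ℂ => (s - ((d : ℂ) - k)) * (Complex.Gamma s * ζ s))
          (𝓝[≠] ((d : ℂ) - k)) (𝓝 (a k : ℂ))) ∧
        -- the asymptotic expansion of the heat trace
        (∀ N : ℕ, (fun t : ℝ => heat t - multiplicity A 0 -
            ∑ k ∈ Finset.range N, a k * t ^ ((k : ℤ) - (d : ℤ)))
          =O[𝓝[>] 0] fun t : ℝ => t ^ ((N : ℤ) - (d : ℤ))) ∧
        -- its convergence to the heat trace
        HasSumLocallyUniformlyOn (fun (k : ℕ) (t : ℝ) => a k * t ^ ((k : ℤ) - (d : ℤ)))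
          (fun t => heat t - multiplicity A 0) (Set.Ioo 0 (2 * Real.pi)) := by
  rw [diracOperator_eq_diagOp hd σ ρ]
  have hcard := fun c => card_sigma_fiber (fun i => Module.finrank ℂ (sphereEigenspace ρ i))
    (spectralIndex σ) c (spectralFiber σ c) (mem_spectralFiber σ c)
  have hfin : ∀ c, Finite {a : EigenIndex ρ // spectralIndex σ a.1 = c} := fun c => (hcard c).1
  -- The constant `2 * 2 ^ (d / 2)` is the spinor rank counted once for each sign of the eigenvalue.
  refine exists_heat_zeta_diagOp (eigenBasis hd ρ) (diracEigenvalue σ ρ) hd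
    (smallestEigenvalue_pos hd σ) (2 * 2 ^ (d / 2)) (fun a => spectralIndex σ a.1)
    (fun a => abs_ambientEigenvalue_add hd σ a.1) fun k => ?_
  rw [(hcard (some k)).2, Finset.sum_congr rfl fun i _ => finrank_sphereEigenspace hd ρ i,
    sum_sphereMultiplicity]
  push_cast
  ring
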